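/- **Setting.** Let $\mathcal X,\mathcal A$ be finite, $\mathcal D$ a distribution on $\mathcal X$, $\pi_0:\mathcal X\to\Delta(\mathcal A)$ a base policy, $\phi:\mathcal X\times\mathcal A\to\mathbb R^d$ features with $\|\phi\|_2\le1$, $\gamma>0$, $p\in[1,2]$, $R\ge 2$, and $B_p(\theta_0,r)$ the closed $L^p$-ball in $\mathbb R^d$. Put $\pi_\theta(a|x)\propto\pi_0(a|x)e^{\theta^\top\phi(x,a)}$. Given a reward $r^*$, a labelled sample $(x,a^+,a^-)$ from a policy $\pi$ is obtained by drawing $x\sim\mathcal D$, independent $a^1,a^2\sim\pi(x)$, and setting $(a^+,a^-)=(a^1,a^2)$ with probability $\sigma(r^*(x,a^1)-r^*(x,a^2))$, $\sigma(z)=1/(1+e^{-z})$, and $(a^2,a^1)$ otherwise. The DPO loss of $\pi$ on a dataset $D$ is $\sum_{(x,a^+,a^-)\in D}-\ln\sigma\big(\gamma\ln\frac{\pi(a^+|x)}{\pi(a^-|x)}-\gamma\ln\frac{\pi_0(a^+|x)}{\pi_0(a^-|x)}\big)$. Fix a linear subspace $\{0\}\ne S\subseteq\mathbb R^d$ (the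 basic case is $S=\mathbb R^d$; for softmax bandits, where $\theta$ is identifiable only up to adding multiples of $\mathbf 1$, one takes $S=\mathbf 1^\perp$). On-policy DPO with batch size $n$ starts at $\hat\theta_0=0$; in round $k$ it draws $n$ fresh i.i.d. labelled samples from $\pi_{\hat\theta_k}$ and lets $\hat\theta_{k+1}$ be any minimizer of the DPO loss of $\pi_\theta$ over $\theta\in B_p(0,R)\cap S$. An offline estimator is any function $\hat\theta$ of $n$ i.i.d. labelled samples from $\pi_0$; offline DPO is the special case of a DPO minimizer. Let $\mathbb V(\pi)=\mathbb E_{x\sim\mathcal D,a\sim\pi(x)}\big[(\phi(x,a)-\mathbb E_{a'\sim\pi(x)}\phi(x,a'))^{\otimes2}\big]$, $C_{\pi\to\pi'}=\inf\{C>0:\mathbb V(\pi')\preceq C\,\mathbb V(\pi)\}$ and, for the true parameter $\theta^*$, $C_*^p(r)=\sup_{\theta\in B_p(\theta^*,r)}C_{\pi_\theta\to\pi_{\theta^*}}$. **Assumptions.** (a) $\theta^*\in B_p(0,R)\cap S$ and $\pi_{\theta^*}(a|x)\propto\pi_0(a|x)e^{r^*(x,a)/\gamma}$. (b) $v^\top\mathbb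 V(\pi_{\theta^*})v\ge\lambda\|v\|_2^2$ for all $v\in S$, with $\lambda>0$. (c) Either $r\mapsto\sqrt{C_*^p(r)}$ is convex on $[0,R]$, or, for a constant $\kappa\ge1$, $\{r\in(0,R]:C_*^p(r)/r^2\le\kappa C_*^p(R)/R^2\}$ is an interval and $\sqrt{\kappa C_*^p(R)}\ge eR$. (d) $c_1/R\le\gamma\le c_2/R$ for constants $0<c_1\le c_2$. **Corollary.** Fix $p\in[1,2]$ and $0<c_1\le c_2$. 1. (Offline lower bound and separation.) For all $b>0$, $m\in\mathbb N$ there are constants $c,\varepsilon_0,B>0$, $\kappa\ge1$, $R_0\ge2$, $M\in\mathbb N$ such that for all $R\ge R_0$, all $2\le d\le bR^m$ and all $\gamma\in[c_1/R,c_2/R]$, the $d$-armed bandit (one prompt, $\mathcal A=\{1,\dots,d\}$, $\phi(i)=e_i$, $S=\mathbf 1^\perp$) has a base policy $\pi_0$ and a nonempty class $\Theta^*\subseteq B_p(0,R)\cap S$ with the following properties, where $\theta^*\in\Theta^*$ generates the reward $r^*=\gamma\theta^{*\top}\phi$. Every $\theta^*\in\Theta^*$ satisfies (b) with $\lambda=c/d$,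 (c) with $\kappa$, and $C_*^p(R)\ge\frac cd e^{2^{1-1/p}R}$. For every $0<\varepsilon\le\varepsilon_0$: - if an offline estimator with $n_{\rm off}$ samples satisfies $\Pr(\|\hat\theta-\theta^*\|_p\le\varepsilon)\ge\frac34$ for all $\theta^*\in\Theta^*$, or $\mathbb E\|\hat\theta-\theta^*\|_p\le\varepsilon$ for all $\theta^*\in\Theta^*$, then $n_{\rm off}\ge c\,C_*^p(R)/\varepsilon^2$ for all $\theta^*\in\Theta^*$; - for every $\delta\in(0,1)$ there are $n,K$ such that on-policy DPO with batch size $n$ and $K$ rounds satisfies $\|\hat\theta_K-\theta^*\|_p\le\varepsilon$ with probability at least $1-\delta$ for every $\theta^*\in\Theta^*$, and its total number of samples $n_{\rm on}=nK$ satisfies, for every $n_{\rm off}$ as in the previous item, $$n_{\rm on}\le B\,R^M\ln^2\!\Big(\frac R{\varepsilon\delta}\Big)\Big(e^{-2^{1-1/p}R}\vee\varepsilon^2\Big)\,n_{\rm off}.$$ 2. (On-policy upper bound.) For every $\kappa\ge1$ there is a constant $B>0$, depending only on $p,c_1,c_2,\kappa$, such that for every problem satisfying (a)–(d) and all $\varepsilon\in(0,1]$,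 $\delta\in(0,1)$, with $$N_\varepsilon:=\frac{d^{2/p}}{\lambda}\Big(\frac{R^2}{\varepsilon^2}\vee C_*^p(R)\Big),$$ on-policy DPO satisfies $\|\hat\theta_K-\theta^*\|_p\le\varepsilon$ with probability at least $1-\delta$ whenever $K\ge B\ln\frac R\varepsilon$ and $n\ge B\,N_\varepsilon\ln\frac{KN_\varepsilon}{\delta}$. In particular this is achieved by some $n,K$ with $K\le B\ln\frac R\varepsilon$, $n\le B\,N_\varepsilon\ln\frac{N_\varepsilon}\delta$ and total sample size $$nK\le B\,\frac{d^{2/p}}\lambda\Big(\frac{R^2}{\varepsilon^2}\ln\frac R\varepsilon\ \vee\ \ln\frac R\varepsilon\; C_*^p(R)\Big)\ln\frac{N_\varepsilon}{\delta}.$$ -/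

import Mathlib

open scoped ENNReal

noncomputable section

namespace PrefLearn

/-! ### Norms, i.i.d. samples, exponential tilting -/

/-- The `L^p` norm on `ℝ^d` (used for real `p ≥ 1`). -/
def lpNorm {d : ℕ} (p : ℝ) (v : Fin d → ℝ) : ℝ :=
  ‖WithLp.toLp (ENNReal.ofReal p) v‖

/-- The law of `n` i.i.d. draws from a distribution `q` on a finite type. -/
def iid {Z : Type*} [Fintype Z] (n : ℕ) (q : PMF Z) : PMF (Fin n → Z) :=
  PMF.ofFintype (fun D => ∏ i, q (D i)) (by
    classical
    have h := Finset.prod_univ_sum (fun _ : Fin n => (Finset.univ : Finset Z)) (fun _ z => q z)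
    have hq : ∑ z, q z = 1 := by rw [← tsum_fintype (L := .unconditional Z)]; exact q.tsum_coe
    rw [Fintype.piFinset_univ] at h
    rw [← h]
    simp [hq])

/-- `tilt π₀ f` is the policy proportional to `π₀(a ∣ x) exp (f x a)`. -/
def tilt {X A : Type*} [Fintype A] (π₀ : X → PMF A) (f : X → A → ℝ) (x : X) : PMF A :=
  PMF.normalize (fun a => π₀ x a * ENNReal.ofReal (Real.exp (f x a)))
    (by
      obtain ⟨a, ha⟩ := (π₀ x).support_nonempty
      rw [Ne, ENNReal.tsum_eq_zero]
      intro h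
      rcases mul_eq_zero.mp (h a) with h0 | h0
      · exact ((π₀ x).mem_support_iff a).mp ha h0
      · exact absurd h0 (by simp [Real.exp_pos]))
    (by
      rw [tsum_fintype]
      refine ENNReal.sum_ne_top.mpr fun a _ => ?_
      exact ENNReal.mul_ne_top ((π₀ x).apply_ne_top a) ENNReal.ofReal_ne_top)

/-! ### The contextual bandit setting -/

/-- A preference learning problem: prompt distribution `D`, base policy `π₀`, features `φ` with
Euclidean norm at most one, and regularization parameter `γ`. -/
structure Problem (X A : Type*) (d : ℕ) where
  D : PMF X
  π₀ : X → PMF A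
  φ : X → A → Fin d → ℝ
  γ : ℝ
  norm_φ_le : ∀ x a, lpNorm 2 (φ x a) ≤ 1

variable {X A : Type*} [Fintype X] [Fintype A] {d : ℕ}

/-- The linear softmax policy `π_θ(a ∣ x) ∝ π₀(a ∣ x) exp (θᵀ φ(x, a))`. -/
def Problem.policy (P : Problem X A d) (θ : Fin d → ℝ) : X → PMF A :=
  tilt P.π₀ (fun x a => θ ⬝ᵥ P.φ x a)

/-- The target policy `π*(a ∣ x) ∝ π₀(a ∣ x) exp (r(x, a) / γ)` of the reward `r`. -/
def Problem.target (P : Problem X A d) (r : X → A → ℝ) : X → PMF A :=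
  tilt P.π₀ (fun x a => r x a / P.γ)

/-- The reward `γ θᵀ φ`, whose target policy is `π_θ` when `γ ≠ 0`. -/
def Problem.reward (P : Problem X A d) (θ : Fin d → ℝ) (x : X) (a : A) : ℝ :=
  P.γ * (θ ⬝ᵥ P.φ x a)

/-- The Bernoulli law that is `true` with probability `σ(z)`. -/
def sigmoidCoin (z : ℝ) : PMF Bool :=
  PMF.ofFintype
    (fun b => ENNReal.ofReal (if b then Real.sigmoid z else 1 - Real.sigmoid z)) (by
      rw [Fintype.sum_bool, ← ENNReal.ofReal_add]
      · simp
      · simpa using Real.sigmoid_nonneg z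
      · simpa using Real.sigmoid_le_one z)

/-- The law of one labelled sample `(x, a⁺, a⁻)`: draw `x ∼ D`, then independent
`a¹, a² ∼ π(x)`, and prefer `a¹` with the Bradley-Terry probability `σ(r(x, a¹) - r(x, a²))`. -/
def Problem.sampleLaw (P : Problem X A d) (r : X → A → ℝ) (π : X → PMF A) : PMF (X × A × A) :=
  P.D.bind fun x => (π x).bind fun a₁ => (π x).bind fun a₂ =>
    (sigmoidCoin (r x a₁ - r x a₂)).map fun b => if b then (x, a₁, a₂) else (x, a₂, a₁)

/-! ### Direct preference optimization -/

/-- The DPO objective `ℒ_DPO(π; D)` of a policy on a dataset of triples `(x, a⁺, a⁻)`. -/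
def Problem.dpoLoss (P : Problem X A d) (π : X → PMF A) {n : ℕ} (D : Fin n → X × A × A) : ℝ :=
  ∑ i, -Real.log (Real.sigmoid
    (P.γ * Real.log ((π (D i).1 (D i).2.1).toReal / (π (D i).1 (D i).2.2).toReal)
      - P.γ * Real.log ((P.π₀ (D i).1 (D i).2.1).toReal / (P.π₀ (D i).1 (D i).2.2).toReal)))

/-- The parameter set `B_p(0, R) ∩ S`. -/
def paramSet (p R : ℝ) (S : Submodule ℝ (Fin d → ℝ)) : Set (Fin d → ℝ) :=
  {θ | θ ∈ S ∧ lpNorm p θ ≤ R}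

/-- `θ` is a minimizer of `θ' ↦ ℒ_DPO(π_{θ'}; D)` over `B_p(0, R) ∩ S`. -/
def Problem.IsDPOUpdate (P : Problem X A d) (p R : ℝ) (S : Submodule ℝ (Fin d → ℝ)) {n : ℕ}
    (D : Fin n → X × A × A) (θ : Fin d → ℝ) : Prop :=
  θ ∈ paramSet p R S ∧
    ∀ θ' ∈ paramSet p R S, P.dpoLoss (P.policy θ) D ≤ P.dpoLoss (P.policy θ') D

/-- An arbitrary way of choosing the DPO minimizer: `sel k θ D` is the update made in round `k`
from the current parameter `θ` and the fresh dataset `D`. -/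
def Problem.IsDPORule (P : Problem X A d) (p R : ℝ) (S : Submodule ℝ (Fin d → ℝ)) {n : ℕ}
    (sel : ℕ → (Fin d → ℝ) → (Fin n → X × A × A) → (Fin d → ℝ)) : Prop :=
  ∀ k θ D, P.IsDPOUpdate p R S D (sel k θ D)

/-- On-policy DPO with constant batch size `n`: the law of the parameter after `K` rounds.
It starts from `θ = 0`, i.e. from `π₀`; each round draws a fresh batch of `n` samples from the
current policy, labelled according to the reward `r`, and updates the parameter by `sel`. -/
def Problem.onPolicyDPO (P : Problem X A d) (r : X → A → ℝ) {n : ℕ}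
    (sel : ℕ → (Fin d → ℝ) → (Fin n → X × A × A) → (Fin d → ℝ)) : ℕ → PMF (Fin d → ℝ)
  | 0 => PMF.pure 0
  | k + 1 => (P.onPolicyDPO r sel k).bind fun θ =>
      (iid n (P.sampleLaw r (P.policy θ))).map (sel k θ)

/-- `K` rounds of on-policy DPO with batch size `n` output, with probability at least `1 - δ`, a
parameter within `L^p` distance `ε` of `θs`, however the minimizers are chosen. -/
def Problem.OnPolicySucceeds (P : Problem X A d) (p R : ℝ) (S : Submodule ℝ (Fin d → ℝ))
    (r : X → A → ℝ) (θs : Fin d → ℝ) (ε δ : ℝ) (n K : ℕ) : Prop :=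
  ∀ sel : ℕ → (Fin d → ℝ) → (Fin n → X × A × A) → (Fin d → ℝ), P.IsDPORule p R S sel →
    ENNReal.ofReal (1 - δ) ≤
      (P.onPolicyDPO r sel K).toOuterMeasure {θ | lpNorm p (θ - θs) ≤ ε}

/-- The law of an offline dataset of `n` samples drawn from the base policy, when the true
parameter is `θs`. -/
def Problem.offlineLaw (P : Problem X A d) (θs : Fin d → ℝ) (n : ℕ) : PMF (Fin n → X × A × A) :=
  iid n (P.sampleLaw (P.reward θs) P.π₀)

/-- The offline estimator `est`, which sees `n` samples from the base policy, reaches `L^p` error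
`ε` uniformly over the true parameters in `Θs`: either with probability at least `3/4`, or in
expectation. Offline DPO is the case where `est D` is a minimizer of the DPO objective on `D`. -/
def Problem.OfflineReaches (P : Problem X A d) (p : ℝ) (Θs : Set (Fin d → ℝ)) (ε : ℝ) {n : ℕ}
    (est : (Fin n → X × A × A) → (Fin d → ℝ)) : Prop :=
  (∀ θs ∈ Θs, 3 / 4 ≤ (P.offlineLaw θs n).toOuterMeasure {D | lpNorm p (est D - θs) ≤ ε}) ∨
  (∀ θs ∈ Θs, ∑ D, ((P.offlineLaw θs n) D).toReal * lpNorm p (est D - θs) ≤ ε)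

/-! ### Coverage -/

/-- The mean feature `𝔼_{a ∼ π(x)} φ(x, a)`. -/
def Problem.featureMean (P : Problem X A d) (π : X → PMF A) (x : X) : Fin d → ℝ :=
  ∑ a, (π x a).toReal • P.φ x a

/-- The feature covariance `𝕍(π)`. -/
def Problem.featureCov (P : Problem X A d) (π : X → PMF A) : Matrix (Fin d) (Fin d) ℝ :=
  ∑ x, (P.D x).toReal • ∑ a, (π x a).toReal •
    Matrix.vecMulVec (P.φ x a - P.featureMean π x) (P.φ x a - P.featureMean π x)

/-- The coverage `C_{π → π'} = inf {C > 0 ∣ 𝕍(π') ≼ C 𝕍(π)}` of `π'` by `π`. -/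
def Problem.coverage (P : Problem X A d) (π π' : X → PMF A) : ℝ :=
  sInf {C : ℝ | 0 < C ∧ (C • P.featureCov π - P.featureCov π').PosSemidef}

/-- The local `L^p`-coverage `C_*^p(r)` of `π_{θs}` with radius `r`. -/
def Problem.localCoverage (P : Problem X A d) (p : ℝ) (θs : Fin d → ℝ) (r : ℝ) : ℝ :=
  sSup {c : ℝ | ∃ θ, lpNorm p (θ - θs) ≤ r ∧ c = P.coverage (P.policy θ) (P.policy θs)}

/-- The growth condition on `C = C_*^p`: either `r ↦ √C(r)` is convex on `[0, R]`, or
`{r ∈ [0, R] ∣ C(r) / r² ≤ κ C(R) / R²}` is an interval (the inequality is written without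
division, so that `r = 0` is excluded) and `√(κ C(R)) ≥ e R`. -/
def Problem.CoverageGrowth (P : Problem X A d) (p : ℝ) (θs : Fin d → ℝ) (R κ : ℝ) : Prop :=
  ConvexOn ℝ (Set.Icc 0 R) (fun r => √(P.localCoverage p θs r)) ∨
  (Set.OrdConnected {r : ℝ | r ∈ Set.Icc 0 R ∧
      P.localCoverage p θs r * R ^ 2 ≤ κ * P.localCoverage p θs R * r ^ 2} ∧
    Real.exp 1 * R ≤ √(κ * P.localCoverage p θs R))

/-- `𝕍(π_{θs}) ≽ λ I` on the subspace `S`. -/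
def Problem.CovLowerBound (P : Problem X A d) (S : Submodule ℝ (Fin d → ℝ)) (θs : Fin d → ℝ)
    (lam : ℝ) : Prop :=
  ∀ v ∈ S, lam * (v ⬝ᵥ v) ≤ v ⬝ᵥ (P.featureCov (P.policy θs)).mulVec v

/-! ### Multi-armed bandits -/

/-- The `d`-armed bandit with one prompt, features `φ(i) = e_i` and base policy `π₀`. -/
def armedBandit (d : ℕ) (π₀ : PMF (Fin d)) (γ : ℝ) : Problem Unit (Fin d) d where
  D := PMF.pure ()
  π₀ := fun _ => π₀
  φ := fun _ i => Pi.single i 1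
  γ := γ
  norm_φ_le := by
    intro _ i
    have h : ENNReal.ofReal 2 = 2 := by norm_num
    simp only [lpNorm]
    rw [h, EuclideanSpace.norm_eq]
    have : ∑ j, ‖(WithLp.toLp 2 (Pi.single i (1 : ℝ)) : EuclideanSpace ℝ (Fin d)) j‖ ^ 2 = 1 := by
      rw [Finset.sum_eq_single i]
      · simp
      · intro j _ hj; simp [hj]
      · simp
    rw [this, Real.sqrt_one]

/-- The subspace `{𝟏}^⊥`. -/
def sumZero (d : ℕ) : Submodule ℝ (Fin d → ℝ) where
  carrier := {v | ∑ i, v i = 0}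
  add_mem' := by
    intro a b ha hb
    change ∑ i, a i = 0 at ha
    change ∑ i, b i = 0 at hb
    change ∑ i, (a i + b i) = 0
    rw [Finset.sum_add_distrib, ha, hb, add_zero]
  zero_mem' := by
    change ∑ _i : Fin d, (0 : ℝ) = 0
    simp
  smul_mem' := by
    intro c a ha
    change ∑ i, a i = 0 at ha
    change ∑ i, c * a i = 0
    rw [← Finset.mul_sum, ha, mul_zero]

end PrefLearn

end

noncomputable section

namespace PrefLearn

/-! ### The `L^p` norm -/

section Norms

variable {d : ℕ} {p : ℝ}

/-! The upper bound is a contraction argument. Let `r` be the current `L^p` error and `C` the local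
coverage. A batch drawn from `π_θ` is analysed by likelihoods: every DPO minimizer `θ'` is at least
as likely as `θs`, while a parameter whose difference from `θs` is large in the form `𝕍(π_θ)` has
exponentially small Bhattacharyya affinity with `θs`. A union bound over a grid
(`Problem.dpoUpdate_concentration`) bounds this form at `θ' - θs` by a small multiple of `R² d / N`;
the bound `γ ≍ 1 / R` keeps all logits bounded and gives the factor `R²`.

Passing from `𝕍(π_θ)` to `𝕍(π_θs)` costs `C(r)`. The eigenvalue bound on `S` and a norm comparison
then turn this into a squared `L^p` error of order `C(r) R² / max (R² / ε²) C(R)`. Either growth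
condition yields `√C(r) ≲ 1 + (r / R) √C(R)` (`Problem.CoverageGrowth.sqrt_le`), so the new error is
at most `(ε + r) / 4` once constants are small (`Problem.lpNorm_sub_le_quarter`). The error thus
drops geometrically to `ε` in about `log (R / ε)` rounds, each allowed to fail with probability `δ /
K`.

For the lower bound, the base policy is uniform tilted by `-t (e_{i₀} - e_{i₁})`, with `t` as large
as the ball permits, and the true parameter undoes this tilt up to a perturbation of size `s ≤ 1`
along `hardDir i₀`. The target is nearly uniform, whereas the base policy plays `i₀` with
probability at most `exp (-2t)`. An offline pair is informative about `s` only if it contains `i₀`,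
so two parameters at distance of order `ε` have chi-square divergence of order `γ² ε² exp (-2t)`
(`hardBandit_chiSquare_le`), and a two-point test needs `exp (2t) / ε²` samples up to constants. The
same rarity makes `C(R)` of order at least `exp (2t) / d`, while the Lipschitz bound for features
caps it at `exp (2^(1-1/p) R)`, which is `exp (2t)` up to a constant. The instances satisfy the
growth condition because `d` is only polynomial in `R` (`Problem.FeatureLipschitz.coverageGrowth`),
so the upper bound applies and dividing the two sample sizes gives the separation. -/

lemma lpNorm_eq (hp : 1 ≤ p) (v : Fin d → ℝ) :
    lpNorm p v = (∑ i, |v i| ^ p) ^ (1 / p) := by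
  have h : (ENNReal.ofReal p).toReal = p := ENNReal.toReal_ofReal (by linarith)
  rw [lpNorm, PiLp.norm_eq_sum (by rw [h]; linarith), h]
  simp [Real.norm_eq_abs]

lemma fact_one_le (hp : 1 ≤ p) : Fact (1 ≤ ENNReal.ofReal p) :=
  ⟨by simpa using ENNReal.ofReal_le_ofReal hp⟩

lemma lpNorm_nonneg (hp : 1 ≤ p) (v : Fin d → ℝ) : 0 ≤ lpNorm p v := by
  rw [lpNorm_eq hp]; positivity

lemma lpNorm_zero (hp : 1 ≤ p) : lpNorm p (0 : Fin d → ℝ) = 0 := by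
  have := fact_one_le hp
  simp [lpNorm]

lemma lpNorm_add_le (hp : 1 ≤ p) (v w : Fin d → ℝ) :
    lpNorm p (v + w) ≤ lpNorm p v + lpNorm p w := by
  have := fact_one_le hp
  simpa [lpNorm, WithLp.toLp_add] using
    norm_add_le (WithLp.toLp (ENNReal.ofReal p) v) (WithLp.toLp (ENNReal.ofReal p) w)

lemma lpNorm_smul (hp : 1 ≤ p) (c : ℝ) (v : Fin d → ℝ) :
    lpNorm p (c • v) = |c| * lpNorm p v := by
  have := fact_one_le hp
  simp [lpNorm, WithLp.toLp_smul, norm_smul]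

lemma lpNorm_neg (hp : 1 ≤ p) (v : Fin d → ℝ) : lpNorm p (-v) = lpNorm p v := by
  simpa using lpNorm_smul hp (-1) v

lemma lpNorm_sub_comm (hp : 1 ≤ p) (v w : Fin d → ℝ) : lpNorm p (v - w) = lpNorm p (w - v) := by
  rw [← lpNorm_neg hp, neg_sub]

lemma lpNorm_rpow (hp : 1 ≤ p) (v : Fin d → ℝ) : lpNorm p v ^ p = ∑ i, |v i| ^ p := by
  rw [lpNorm_eq hp, ← Real.rpow_mul (by positivity), one_div, inv_mul_cancel₀ (by linarith),
    Real.rpow_one]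

lemma abs_apply_le_lpNorm (hp : 1 ≤ p) (v : Fin d → ℝ) (i : Fin d) : |v i| ≤ lpNorm p v := by
  have h : |v i| ^ p ≤ lpNorm p v ^ p := by
    rw [lpNorm_rpow hp]
    exact Finset.single_le_sum (f := fun j => |v j| ^ p) (fun j _ => by positivity)
      (Finset.mem_univ i)
  exact (Real.rpow_le_rpow_iff (abs_nonneg _) (lpNorm_nonneg hp v) (by linarith)).1 h

lemma lpNorm_two_sq (v : Fin d → ℝ) : lpNorm 2 v ^ 2 = v ⬝ᵥ v := by
  have h := lpNorm_rpow (p := 2) (by norm_num) v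
  rw [Real.rpow_two] at h
  rw [h]
  refine Finset.sum_congr rfl fun i _ => ?_
  rw [Real.rpow_two, sq_abs, sq]

/-- Split `|v i|^2 = |v i|^p * |v i|^(2-p)` and bound the second factor by the norm. -/
lemma dotProduct_self_le (hp : 1 ≤ p) (hp₂ : p ≤ 2) (v : Fin d → ℝ) :
    v ⬝ᵥ v ≤ lpNorm p v ^ 2 := by
  have hN := lpNorm_nonneg hp v
  rcases hN.eq_or_lt with h0 | hpos
  · have : v = 0 := by
      ext i
      have := abs_apply_le_lpNorm hp v i
      rw [← h0] at this
      simpa using abs_nonpos_iff.1 this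
    rw [this]; simp; positivity
  calc v ⬝ᵥ v = ∑ i, |v i| ^ p * |v i| ^ (2 - p) := by
        refine Finset.sum_congr rfl fun i _ => ?_
        rw [← Real.rpow_add_of_nonneg (abs_nonneg _) (by linarith) (by linarith)]
        norm_num [sq]
    _ ≤ ∑ i, |v i| ^ p * lpNorm p v ^ (2 - p) := by
        gcongr with i
        exact abs_apply_le_lpNorm hp v i
    _ = lpNorm p v ^ 2 := by
        rw [← Finset.sum_mul, ← lpNorm_rpow hp, ← Real.rpow_add hpos]
        norm_num

lemma lpNorm_two_le (hp : 1 ≤ p) (hp₂ : p ≤ 2) (v : Fin d → ℝ) : lpNorm 2 v ≤ lpNorm p v := by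
  refine (sq_le_sq₀ (lpNorm_nonneg (by norm_num) v) (lpNorm_nonneg hp v)).1 ?_
  rw [lpNorm_two_sq]
  exact dotProduct_self_le hp hp₂ v

/-- Power mean inequality for the numbers `|v i|^p` with exponent `2 / p ≥ 1`. Together with the
factor `d` in the per-round accuracy it produces the `d^(2/p)` of the final rate. -/
lemma lpNorm_sq_le (hp : 1 ≤ p) (hp₂ : p ≤ 2) (v : Fin d → ℝ) :
    lpNorm p v ^ 2 ≤ (d : ℝ) ^ (2 / p - 1) * (v ⬝ᵥ v) := by
  have hp0 : 0 < p := by linarith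
  have h := Real.rpow_sum_le_const_mul_sum_rpow Finset.univ (fun i => |v i| ^ p)
    (p := 2 / p) (by rw [le_div_iff₀ hp0]; linarith)
  simp only [abs_of_nonneg (Real.rpow_nonneg (abs_nonneg _) p)] at h
  rw [← lpNorm_rpow hp, ← Real.rpow_mul (lpNorm_nonneg hp v)] at h
  have e : p * (2 / p) = 2 := by field_simp
  simp only [← Real.rpow_mul (abs_nonneg _), e, Real.rpow_two, sq_abs] at h
  simpa [dotProduct, sq] using h

lemma abs_dotProduct_le (v w : Fin d → ℝ) : |v ⬝ᵥ w| ≤ lpNorm 2 v * lpNorm 2 w := by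
  refine abs_le_of_sq_le_sq ?_ (mul_nonneg (lpNorm_nonneg (by norm_num) v)
    (lpNorm_nonneg (by norm_num) w))
  rw [mul_pow, lpNorm_two_sq, lpNorm_two_sq]
  have := Finset.sum_mul_sq_le_sq_mul_sq Finset.univ v w
  simpa [dotProduct, sq] using this

/-- Only two coordinates matter, so the power mean inequality for two numbers suffices. This
constant is the exponent `2^(1-1/p)` of the separation. -/
lemma sub_apply_le (hp : 1 ≤ p) (v : Fin d → ℝ) (a b : Fin d) :
    v b - v a ≤ 2 ^ (1 - 1 / p) * lpNorm p v := by
  have hp0 : 0 < p := by linarith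
  by_cases hab : a = b
  · subst hab
    have := lpNorm_nonneg hp v
    simp only [sub_self]; positivity
  have h := Real.rpow_sum_le_const_mul_sum_rpow {a, b} v hp
  rw [Finset.sum_pair hab, Finset.card_pair hab] at h
  have h2 : ∑ i ∈ ({a, b} : Finset (Fin d)), |v i| ^ p ≤ lpNorm p v ^ p := by
    rw [lpNorm_rpow hp]
    exact Finset.sum_le_sum_of_subset_of_nonneg (Finset.subset_univ _)
      fun _ _ _ => by positivity
  have h3 : (|v a| + |v b|) ^ p ≤ (2 ^ (1 - 1 / p) * lpNorm p v) ^ p := by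
    rw [Real.mul_rpow (by positivity) (lpNorm_nonneg hp v), ← Real.rpow_mul (by norm_num)]
    have e : (1 - 1 / p) * p = p - 1 := by field_simp
    rw [e]
    refine h.trans ?_
    push_cast
    gcongr
  have h4 := (Real.rpow_le_rpow_iff (by positivity)
    (mul_nonneg (by positivity) (lpNorm_nonneg hp v)) hp0).1 h3
  have := le_abs_self (v b)
  have := neg_abs_le (v a)
  linarith

lemma lpNorm_le_sum (hp : 1 ≤ p) (v : Fin d → ℝ) : lpNorm p v ≤ ∑ i, |v i| := by
  have := fact_one_le hp
  have h : v = ∑ i, v i • (Pi.single i 1 : Fin d → ℝ) := by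
    ext j
    simp [Finset.sum_apply, Pi.single_apply]
  have h1 : ∀ i, lpNorm p (Pi.single i 1 : Fin d → ℝ) = 1 := fun i => by
    rw [lpNorm_eq hp, Finset.sum_eq_single i]
    · simp
    · intro j _ hj
      simp [Pi.single_eq_of_ne hj, Real.zero_rpow (by linarith : p ≠ 0)]
    · simp
  calc lpNorm p v = ‖∑ i, WithLp.toLp (ENNReal.ofReal p)
          (v i • (Pi.single i 1 : Fin d → ℝ))‖ := by
        rw [← WithLp.toLp_sum, ← h]; rfl
    _ ≤ ∑ i, lpNorm p (v i • (Pi.single i 1 : Fin d → ℝ)) := norm_sum_le _ _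
    _ = ∑ i, |v i| := by simp [lpNorm_smul hp, h1]

end Norms

/-! ### Finite distributions as real weights -/

section Weights

lemma sum_toReal {Z : Type*} [Fintype Z] (q : PMF Z) : ∑ z, (q z).toReal = 1 := by
  have h : ∑ z, q z = 1 := by rw [← tsum_fintype (L := .unconditional Z)]; exact q.tsum_coe
  rw [← ENNReal.toReal_sum fun z _ => q.apply_ne_top z, h, ENNReal.toReal_one]

lemma exists_pos {Z : Type*} (q : PMF Z) : ∃ z, 0 < (q z).toReal := by
  obtain ⟨a, ha⟩ := q.support_nonempty
  exact ⟨a, ENNReal.toReal_pos ((q.mem_support_iff a).mp ha) (q.apply_ne_top a)⟩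

lemma tilt_toReal {X A : Type*} [Fintype A] (π₀ : X → PMF A) (f : X → A → ℝ) (x : X) (a : A) :
    (tilt π₀ f x a).toReal = (π₀ x a).toReal * Real.exp (f x a) /
      ∑ b, (π₀ x b).toReal * Real.exp (f x b) := by
  rw [tilt, PMF.normalize_apply, tsum_fintype, ENNReal.toReal_mul, ENNReal.toReal_inv,
    ENNReal.toReal_sum fun b _ =>
      ENNReal.mul_ne_top ((π₀ x).apply_ne_top b) ENNReal.ofReal_ne_top]
  simp [ENNReal.toReal_mul, ENNReal.toReal_ofReal (Real.exp_pos _).le, div_eq_mul_inv]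

lemma tilt_norm_pos {X A : Type*} [Fintype A] (π₀ : X → PMF A) (f : X → A → ℝ) (x : X) :
    0 < ∑ b, (π₀ x b).toReal * Real.exp (f x b) := by
  obtain ⟨a, ha⟩ := exists_pos (π₀ x)
  exact Finset.sum_pos' (fun b _ => by positivity) ⟨a, Finset.mem_univ a, by positivity⟩

lemma tilt_pos_iff {X A : Type*} [Fintype A] (π₀ : X → PMF A) (f : X → A → ℝ) (x : X) (a : A) :
    0 < (tilt π₀ f x a).toReal ↔ 0 < (π₀ x a).toReal := by
  rw [tilt_toReal, div_pos_iff_of_pos_right (tilt_norm_pos π₀ f x),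
    mul_pos_iff_of_pos_right (Real.exp_pos _)]

end Weights

/-! ### Feature covariance and coverage -/

section Coverage

variable {X A : Type*} [Fintype X] [Fintype A] {d : ℕ} (P : Problem X A d)

/-- The quadratic form `vᵀ 𝕍(π) v`. -/
def Problem.covForm (π : X → PMF A) (v : Fin d → ℝ) : ℝ :=
  ∑ x, (P.D x).toReal * ∑ a, (π x a).toReal * (v ⬝ᵥ P.φ x a - v ⬝ᵥ P.featureMean π x) ^ 2

lemma Problem.dotProduct_featureCov_mulVec (π : X → PMF A) (v : Fin d → ℝ) :
    v ⬝ᵥ (P.featureCov π).mulVec v = P.covForm π v := by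
  simp only [featureCov, covForm, Matrix.sum_mulVec, dotProduct_sum, Matrix.smul_mulVec,
    dotProduct_smul, smul_eq_mul, Matrix.vecMulVec_mulVec]
  refine Finset.sum_congr rfl fun x _ => ?_
  congr 1
  refine Finset.sum_congr rfl fun a _ => ?_
  rw [← dotProduct_sub]
  simp [dotProduct_comm, sq]

lemma Problem.featureCov_isHermitian (π : X → PMF A) : (P.featureCov π).IsHermitian := by
  rw [Matrix.IsHermitian, featureCov]
  ext i j
  simp [Matrix.sum_apply, Matrix.vecMulVec_apply, mul_comm]

lemma Problem.posSemidef_iff (π π' : X → PMF A) (C : ℝ) :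
    (C • P.featureCov π - P.featureCov π').PosSemidef ↔
      ∀ v, P.covForm π' v ≤ C * P.covForm π v := by
  have key : ∀ v, v ⬝ᵥ (C • P.featureCov π - P.featureCov π').mulVec v
      = C * P.covForm π v - P.covForm π' v := fun v => by
    rw [Matrix.sub_mulVec, dotProduct_sub, Matrix.smul_mulVec, dotProduct_smul,
      P.dotProduct_featureCov_mulVec, P.dotProduct_featureCov_mulVec, smul_eq_mul]
  constructor
  · intro h v
    have := h.dotProduct_mulVec_nonneg v
    rw [star_trivial, key] at this
    linarith
  · intro h
    refine Matrix.PosSemidef.of_dotProduct_mulVec_nonneg ?_ fun v => ?_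
    · exact ((P.featureCov_isHermitian π).smul (IsSelfAdjoint.all C)).sub
        (P.featureCov_isHermitian π')
    · rw [star_trivial, key]
      linarith [h v]

lemma Problem.covForm_nonneg (π : X → PMF A) (v : Fin d → ℝ) : 0 ≤ P.covForm π v := by
  unfold covForm
  positivity

lemma Problem.dotProduct_featureMean (π : X → PMF A) (v : Fin d → ℝ) (x : X) :
    v ⬝ᵥ P.featureMean π x = ∑ a, (π x a).toReal * (v ⬝ᵥ P.φ x a) := by
  simp [featureMean, dotProduct_sum]

/-- The mean minimizes the second moment about a point, so any centre `c x` gives an upper bound. -/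
lemma Problem.covForm_le_center (π : X → PMF A) (v : Fin d → ℝ) (c : X → ℝ) :
    P.covForm π v ≤ ∑ x, (P.D x).toReal * ∑ a, (π x a).toReal * (v ⬝ᵥ P.φ x a - c x) ^ 2 := by
  unfold covForm
  refine Finset.sum_le_sum fun x _ => mul_le_mul_of_nonneg_left ?_ ENNReal.toReal_nonneg
  have h1 := sum_toReal (π x)
  have h2 := P.dotProduct_featureMean π v x
  set m := v ⬝ᵥ P.featureMean π x
  have : ∑ a, (π x a).toReal * (v ⬝ᵥ P.φ x a - c x) ^ 2
      = ∑ a, (π x a).toReal * (v ⬝ᵥ P.φ x a - m) ^ 2 + (m - c x) ^ 2 := by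
    have e : ∀ a, (π x a).toReal * (v ⬝ᵥ P.φ x a - c x) ^ 2
      = (π x a).toReal * (v ⬝ᵥ P.φ x a - m) ^ 2
        + 2 * (m - c x) * ((π x a).toReal * (v ⬝ᵥ P.φ x a))
        + (π x a).toReal * ((m - c x) ^ 2 - 2 * (m - c x) * m) := fun a => by ring
    simp only [e, Finset.sum_add_distrib, ← Finset.mul_sum, ← Finset.sum_mul, ← h2, h1]
    ring
  rw [this]
  linarith [sq_nonneg (m - c x)]

/-- Twice the variance is the mean squared difference of two independent copies. This links the
pairwise comparisons seen by DPO to `𝕍(π)`. -/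
lemma Problem.sum_sq_diff (π : X → PMF A) (v : Fin d → ℝ) :
    ∑ x, (P.D x).toReal * ∑ a, ∑ b, (π x a).toReal * (π x b).toReal *
      (v ⬝ᵥ P.φ x a - v ⬝ᵥ P.φ x b) ^ 2 = 2 * P.covForm π v := by
  rw [covForm, Finset.mul_sum]
  refine Finset.sum_congr rfl fun x _ => ?_
  rw [mul_left_comm]
  congr 1
  have h1 := sum_toReal (π x)
  have h2 := P.dotProduct_featureMean π v x
  set m := v ⬝ᵥ P.featureMean π x
  have e : ∀ a b, (π x a).toReal * (π x b).toReal * (v ⬝ᵥ P.φ x a - v ⬝ᵥ P.φ x b) ^ 2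
      = ((π x a).toReal * (v ⬝ᵥ P.φ x a) ^ 2) * (π x b).toReal
        + (π x a).toReal * ((π x b).toReal * (v ⬝ᵥ P.φ x b) ^ 2)
        - 2 * (((π x a).toReal * (v ⬝ᵥ P.φ x a)) * ((π x b).toReal * (v ⬝ᵥ P.φ x b))) :=
    fun a b => by ring
  have e' : ∀ a, (π x a).toReal * (v ⬝ᵥ P.φ x a - m) ^ 2
      = (π x a).toReal * (v ⬝ᵥ P.φ x a) ^ 2 - 2 * m * ((π x a).toReal * (v ⬝ᵥ P.φ x a))
        + (π x a).toReal * m ^ 2 := fun a => by ring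
  simp only [e, e', Finset.sum_add_distrib, Finset.sum_sub_distrib, ← Finset.mul_sum,
    ← Finset.sum_mul, ← h2, h1]
  ring

lemma Problem.covForm_add_le (π : X → PMF A) (v w : Fin d → ℝ) :
    P.covForm π (v + w) ≤ 2 * P.covForm π v + 2 * P.covForm π w := by
  unfold covForm
  rw [Finset.mul_sum, Finset.mul_sum, ← Finset.sum_add_distrib]
  refine Finset.sum_le_sum fun x _ => ?_
  have : ∑ a, (π x a).toReal * ((v + w) ⬝ᵥ P.φ x a - (v + w) ⬝ᵥ P.featureMean π x) ^ 2
      ≤ 2 * ∑ a, (π x a).toReal * (v ⬝ᵥ P.φ x a - v ⬝ᵥ P.featureMean π x) ^ 2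
       + 2 * ∑ a, (π x a).toReal * (w ⬝ᵥ P.φ x a - w ⬝ᵥ P.featureMean π x) ^ 2 := by
    rw [Finset.mul_sum, Finset.mul_sum, ← Finset.sum_add_distrib]
    refine Finset.sum_le_sum fun a _ => ?_
    rw [add_dotProduct, add_dotProduct]
    have h := (ENNReal.toReal_nonneg : 0 ≤ (π x a).toReal)
    have h2 := mul_nonneg h (sq_nonneg ((v ⬝ᵥ P.φ x a - v ⬝ᵥ P.featureMean π x)
      - (w ⬝ᵥ P.φ x a - w ⬝ᵥ P.featureMean π x)))
    linarith
  have h := mul_le_mul_of_nonneg_left this (ENNReal.toReal_nonneg : 0 ≤ (P.D x).toReal)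
  linarith

lemma Problem.abs_dotProduct_φ_le (v : Fin d → ℝ) (x : X) (a : A) :
    |v ⬝ᵥ P.φ x a| ≤ lpNorm 2 v :=
  (abs_dotProduct_le _ _).trans
    (mul_le_of_le_one_right (lpNorm_nonneg (by norm_num) v) (P.norm_φ_le x a))

lemma Problem.covForm_le (π : X → PMF A) (v : Fin d → ℝ) : P.covForm π v ≤ v ⬝ᵥ v := by
  refine (P.covForm_le_center π v 0).trans ?_
  calc _ ≤ ∑ x, (P.D x).toReal * ∑ a, (π x a).toReal * (v ⬝ᵥ v) := by
        gcongr with x _ a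
        rw [← lpNorm_two_sq, Pi.zero_apply, sub_zero]
        exact sq_le_sq' (neg_le_of_abs_le (P.abs_dotProduct_φ_le v x a))
          (le_of_abs_le (P.abs_dotProduct_φ_le v x a))
    _ = v ⬝ᵥ v := by simp [← Finset.sum_mul, sum_toReal]

/-- Centring the form of `π'` at the mean of `π` leaves a termwise comparison of weights. -/
lemma Problem.covForm_le_of_ratio {π π' : X → PMF A} {C : ℝ}
    (h : ∀ x a, (π' x a).toReal ≤ C * (π x a).toReal) (v : Fin d → ℝ) :
    P.covForm π' v ≤ C * P.covForm π v := by
  refine (P.covForm_le_center π' v fun x => v ⬝ᵥ P.featureMean π x).trans ?_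
  rw [covForm, Finset.mul_sum]
  refine Finset.sum_le_sum fun x _ => ?_
  rw [mul_left_comm]
  refine mul_le_mul_of_nonneg_left ?_ ENNReal.toReal_nonneg
  rw [Finset.mul_sum]
  refine Finset.sum_le_sum fun a _ => ?_
  rw [← mul_assoc]
  exact mul_le_mul_of_nonneg_right (h x a) (sq_nonneg _)

/-- A Lipschitz constant of the feature differences for the `L^p` norm. -/
def Problem.FeatureLipschitz (p α : ℝ) : Prop :=
  ∀ (w : Fin d → ℝ) (x : X) (a b : A), w ⬝ᵥ P.φ x b - w ⬝ᵥ P.φ x a ≤ α * lpNorm p w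

lemma Problem.featureLipschitz_two {p : ℝ} (hp : 1 ≤ p) (hp₂ : p ≤ 2) :
    P.FeatureLipschitz p 2 := fun w x a b => by
  have h1 := le_of_abs_le (P.abs_dotProduct_φ_le w x b)
  have h2 := neg_le_of_abs_le (P.abs_dotProduct_φ_le w x a)
  have := lpNorm_two_le hp hp₂ w
  linarith

variable {P} {p α : ℝ}

/-- After cross-multiplying with the normalizers, the term of `b` involves only the feature
difference between `b` and `a`. Hence numerator and normalizer together cost a single factor `α`,
not `2 α`. -/
lemma Problem.FeatureLipschitz.policy_le (hα : P.FeatureLipschitz p α) (θ θ' : Fin d → ℝ)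
    (x : X) (a : A) : (P.policy θ x a).toReal
      ≤ Real.exp (α * lpNorm p (θ' - θ)) * (P.policy θ' x a).toReal := by
  rw [Problem.policy, Problem.policy, tilt_toReal, tilt_toReal, ← mul_div_assoc,
    div_le_div_iff₀ (tilt_norm_pos P.π₀ (fun x a => θ ⬝ᵥ P.φ x a) x)
      (tilt_norm_pos P.π₀ (fun x a => θ' ⬝ᵥ P.φ x a) x), Finset.mul_sum, Finset.mul_sum]
  refine Finset.sum_le_sum fun b _ => ?_
  have h := hα (θ' - θ) x a b
  simp only [sub_dotProduct] at h
  have h2 : Real.exp (θ ⬝ᵥ P.φ x a) * Real.exp (θ' ⬝ᵥ P.φ x b)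
      ≤ Real.exp (α * lpNorm p (θ' - θ))
        * (Real.exp (θ' ⬝ᵥ P.φ x a) * Real.exp (θ ⬝ᵥ P.φ x b)) := by
    rw [← Real.exp_add, ← Real.exp_add, ← Real.exp_add, Real.exp_le_exp]
    linarith
  have h3 := mul_le_mul_of_nonneg_left h2
    (by positivity : 0 ≤ (P.π₀ x a).toReal * (P.π₀ x b).toReal)
  linarith

lemma Problem.FeatureLipschitz.covForm_le (hα : P.FeatureLipschitz p α) (θ θ' v : Fin d → ℝ) :
    P.covForm (P.policy θ) v
      ≤ Real.exp (α * lpNorm p (θ' - θ)) * P.covForm (P.policy θ') v :=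
  P.covForm_le_of_ratio (hα.policy_le θ θ') v

/-! ### Basic properties of the coverage and of its local supremum. -/

lemma Problem.coverage_le {π π' : X → PMF A} {C : ℝ} (hC : 0 < C)
    (h : ∀ v, P.covForm π' v ≤ C * P.covForm π v) : P.coverage π π' ≤ C :=
  csInf_le ⟨0, fun _ hc => hc.1.le⟩ ⟨hC, (P.posSemidef_iff π π' C).2 h⟩

lemma Problem.coverage_nonneg (π π' : X → PMF A) : 0 ≤ P.coverage π π' :=
  Real.sInf_nonneg fun _ hc => hc.1.le

/-- The infimum defining the coverage satisfies the defining inequality, provided some constant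
does: this excludes `sInf ∅ = 0`. -/
lemma Problem.covForm_le_coverage {π π' : X → PMF A} {C : ℝ} (hC : 0 < C)
    (h : ∀ v, P.covForm π' v ≤ C * P.covForm π v) (v : Fin d → ℝ) :
    P.covForm π' v ≤ P.coverage π π' * P.covForm π v := by
  have hne : {C : ℝ | 0 < C ∧ (C • P.featureCov π - P.featureCov π').PosSemidef}.Nonempty :=
    ⟨C, hC, (P.posSemidef_iff π π' C).2 h⟩
  rcases (P.covForm_nonneg π v).eq_or_lt with h0 | hpos
  · have := h v
    rw [← h0] at this ⊢
    linarith
  · rw [← div_le_iff₀ hpos]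
    refine le_csInf hne fun c hc => ?_
    rw [div_le_iff₀ hpos]
    exact (P.posSemidef_iff π π' c).1 hc.2 v

lemma Problem.FeatureLipschitz.covForm_le_coverage (hα : P.FeatureLipschitz p α)
    (θ θs v : Fin d → ℝ) : P.covForm (P.policy θs) v
      ≤ P.coverage (P.policy θ) (P.policy θs) * P.covForm (P.policy θ) v :=
  Problem.covForm_le_coverage (Real.exp_pos _) (hα.covForm_le θs θ) v

lemma Problem.FeatureLipschitz.coverage_le (hα : P.FeatureLipschitz p α) (hα0 : 0 ≤ α)
    {θ θs : Fin d → ℝ} {r : ℝ} (h : lpNorm p (θ - θs) ≤ r) :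
    P.coverage (P.policy θ) (P.policy θs) ≤ Real.exp (α * r) :=
  (Problem.coverage_le (Real.exp_pos _) (hα.covForm_le θs θ)).trans
    (Real.exp_le_exp.2 (by gcongr))

lemma Problem.FeatureLipschitz.bddAbove (hα : P.FeatureLipschitz p α) (hα0 : 0 ≤ α)
    (θs : Fin d → ℝ) (r : ℝ) :
    BddAbove {c : ℝ | ∃ θ, lpNorm p (θ - θs) ≤ r ∧
      c = P.coverage (P.policy θ) (P.policy θs)} :=
  ⟨Real.exp (α * r), by rintro c ⟨θ, hθ, rfl⟩; exact hα.coverage_le hα0 hθ⟩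

lemma Problem.FeatureLipschitz.coverage_le_local (hα : P.FeatureLipschitz p α) (hα0 : 0 ≤ α)
    {θ θs : Fin d → ℝ} {r : ℝ} (h : lpNorm p (θ - θs) ≤ r) :
    P.coverage (P.policy θ) (P.policy θs) ≤ P.localCoverage p θs r :=
  le_csSup (hα.bddAbove hα0 θs r) ⟨θ, h, rfl⟩

lemma Problem.localCoverage_le {θs : Fin d → ℝ} {r c : ℝ} (hp : 1 ≤ p) (hr : 0 ≤ r)
    (h : ∀ θ, lpNorm p (θ - θs) ≤ r → P.coverage (P.policy θ) (P.policy θs) ≤ c) :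
    P.localCoverage p θs r ≤ c := by
  refine csSup_le ⟨_, θs, ?_, rfl⟩ ?_
  · rwa [sub_self, lpNorm_zero hp]
  · rintro _ ⟨θ, hθ, rfl⟩
    exact h θ hθ

lemma Problem.FeatureLipschitz.localCoverage_le_exp (hα : P.FeatureLipschitz p α) (hα0 : 0 ≤ α)
    (hp : 1 ≤ p) (θs : Fin d → ℝ) {r : ℝ} (hr : 0 ≤ r) :
    P.localCoverage p θs r ≤ Real.exp (α * r) :=
  Problem.localCoverage_le hp hr fun _ hθ => hα.coverage_le hα0 hθ

lemma Problem.localCoverage_nonneg (θs : Fin d → ℝ) (r : ℝ) : 0 ≤ P.localCoverage p θs r :=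
  Real.sSup_nonneg (by rintro _ ⟨θ, _, rfl⟩; exact Problem.coverage_nonneg _ _)

lemma Problem.FeatureLipschitz.localCoverage_mono (hα : P.FeatureLipschitz p α) (hα0 : 0 ≤ α)
    (hp : 1 ≤ p) (θs : Fin d → ℝ) {r r' : ℝ} (hr : 0 ≤ r) (h : r ≤ r') :
    P.localCoverage p θs r ≤ P.localCoverage p θs r' :=
  Problem.localCoverage_le hp hr fun _ hθ => hα.coverage_le_local hα0 (hθ.trans h)

lemma Problem.FeatureLipschitz.covForm_le_local (hα : P.FeatureLipschitz p α) (hα0 : 0 ≤ α)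
    {θ θs : Fin d → ℝ} {r : ℝ} (h : lpNorm p (θ - θs) ≤ r) (v : Fin d → ℝ) :
    P.covForm (P.policy θs) v ≤ P.localCoverage p θs r * P.covForm (P.policy θ) v :=
  (hα.covForm_le_coverage θ θs v).trans
    (mul_le_mul_of_nonneg_right (hα.coverage_le_local hα0 h) (P.covForm_nonneg _ v))

/-- The centre `θs` itself is in the ball, and a nondegenerate direction forces its self-coverage to
be at least one. -/
lemma Problem.FeatureLipschitz.one_le_localCoverage (hα : P.FeatureLipschitz p α) (hα0 : 0 ≤ α)
    (hp : 1 ≤ p) {θs v : Fin d → ℝ} (hv : 0 < P.covForm (P.policy θs) v) {r : ℝ} (hr : 0 ≤ r) :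
    1 ≤ P.localCoverage p θs r := by
  have h := hα.covForm_le_local hα0 (θ := θs) (θs := θs) (r := r)
    (by rwa [sub_self, lpNorm_zero hp]) v
  by_contra! h1
  nlinarith

/-- The local coverage is log-Lipschitz in the radius. -/
lemma Problem.FeatureLipschitz.localCoverage_le_mul_exp (hα : P.FeatureLipschitz p α)
    (hα0 : 0 ≤ α) (hp : 1 ≤ p) {θs v : Fin d → ℝ} (hv : 0 < P.covForm (P.policy θs) v)
    {r r' : ℝ} (hr : 0 < r) (h : r ≤ r') :
    P.localCoverage p θs r' ≤ P.localCoverage p θs r * Real.exp (α * (r' - r)) := by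
  have h1 := hα.one_le_localCoverage hα0 hp hv hr.le
  have hr' : 0 < r' := hr.trans_le h
  refine Problem.localCoverage_le hp hr'.le fun θ' hθ' => ?_
  refine Problem.coverage_le (by positivity) fun w => ?_
  -- Shrinking `θ'` towards `θs` gives a point of the ball of radius `r` at distance at most `r' -
  -- r` from `θ'`; the covariance forms are compared through it.
  set θ := θs + (r / r') • (θ' - θs) with hθ
  have e1 : lpNorm p (θ - θs) ≤ r := by
    rw [hθ, add_sub_cancel_left, lpNorm_smul hp, abs_of_pos (by positivity)]
    calc r / r' * lpNorm p (θ' - θs) ≤ r / r' * r' := by gcongr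
      _ = r := by field_simp
  have e2 : lpNorm p (θ' - θ) ≤ r' - r := by
    have : θ' - θ = (1 - r / r') • (θ' - θs) := by rw [hθ]; module
    have h0 : 0 ≤ 1 - r / r' := by rw [sub_nonneg, div_le_one hr']; exact h
    rw [this, lpNorm_smul hp, abs_of_nonneg h0]
    calc (1 - r / r') * lpNorm p (θ' - θs) ≤ (1 - r / r') * r' := by gcongr
      _ = r' - r := by field_simp
  refine (hα.covForm_le_local hα0 e1 w).trans ?_
  rw [mul_assoc]
  gcongr
  refine (hα.covForm_le θ θ' w).trans ?_
  gcongr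
  exact P.covForm_nonneg _ w

end Coverage

/-! ### Expectations over finite distributions -/

section Expect

variable {Z W : Type*} [Fintype Z] [Fintype W]

/-- The expectation of a real function under a distribution on a finite type. -/
def expect (q : PMF Z) (f : Z → ℝ) : ℝ := ∑ z, (q z).toReal * f z

lemma expect_const (q : PMF Z) (c : ℝ) : expect q (fun _ => c) = c := by
  simp [expect, ← Finset.sum_mul, sum_toReal]

lemma expect_mono (q : PMF Z) {f g : Z → ℝ} (h : ∀ z, 0 < (q z).toReal → f z ≤ g z) :
    expect q f ≤ expect q g := by
  refine Finset.sum_le_sum fun z _ => ?_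
  rcases (ENNReal.toReal_nonneg : 0 ≤ (q z).toReal).eq_or_lt with h0 | h0
  · simp [← h0]
  · exact mul_le_mul_of_nonneg_left (h z h0) h0.le

lemma expect_nonneg (q : PMF Z) {f : Z → ℝ} (h : ∀ z, 0 ≤ f z) : 0 ≤ expect q f :=
  Finset.sum_nonneg fun z _ => mul_nonneg ENNReal.toReal_nonneg (h z)

lemma expect_sum {ι : Type*} (q : PMF Z) (s : Finset ι) (f : ι → Z → ℝ) :
    expect q (fun z => ∑ i ∈ s, f i z) = ∑ i ∈ s, expect q (f i) := by
  simp only [expect, Finset.mul_sum]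
  exact Finset.sum_comm

lemma expect_const_mul (q : PMF Z) (c : ℝ) (f : Z → ℝ) :
    expect q (fun z => c * f z) = c * expect q f := by
  simp only [expect, Finset.mul_sum]
  exact Finset.sum_congr rfl fun z _ => by ring

lemma expect_bind (p : PMF W) (k : W → PMF Z) (f : Z → ℝ) :
    expect (p.bind k) f = expect p (fun w => expect (k w) f) := by
  simp only [expect, Finset.mul_sum]
  rw [Finset.sum_comm]
  refine Finset.sum_congr rfl fun z _ => ?_
  rw [PMF.bind_apply, tsum_fintype, ENNReal.toReal_sum fun w _ =>
    ENNReal.mul_ne_top (p.apply_ne_top w) ((k w).apply_ne_top z), Finset.sum_mul]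
  exact Finset.sum_congr rfl fun w _ => by rw [ENNReal.toReal_mul, mul_assoc]

lemma expect_pure (w : Z) (f : Z → ℝ) : expect (PMF.pure w) f = f w := by
  classical
  rw [expect, Finset.sum_eq_single w]
  · simp
  · intro b _ hb; simp [PMF.pure_apply, hb]
  · simp

lemma expect_map (p : PMF W) (g : W → Z) (f : Z → ℝ) :
    expect (p.map g) f = expect p (fun w => f (g w)) := by
  rw [PMF.map, expect_bind]
  simp [expect_pure]

lemma expect_sigmoidCoin (z : ℝ) (f : Bool → ℝ) :
    expect (sigmoidCoin z) f = Real.sigmoid z * f true + Real.sigmoid (-z) * f false := by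
  rw [expect, Fintype.sum_bool, Real.sigmoid_neg]
  simp [sigmoidCoin, ENNReal.toReal_ofReal, Real.sigmoid_nonneg, Real.sigmoid_le_one]

lemma iid_toReal (n : ℕ) (q : PMF Z) (D : Fin n → Z) :
    (iid n q D).toReal = ∏ i, (q (D i)).toReal := by
  simp [iid, ENNReal.toReal_prod]

lemma sum_prod_apply (n : ℕ) (g : Z → ℝ) :
    ∑ D : Fin n → Z, ∏ i, g (D i) = (∑ z, g z) ^ n := by
  classical
  have h := Finset.prod_univ_sum (fun _ : Fin n => (Finset.univ : Finset Z)) (fun _ z => g z)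
  rw [Fintype.piFinset_univ] at h
  rw [← h]
  simp

lemma expect_iid_prod (n : ℕ) (q : PMF Z) (g : Z → ℝ) :
    expect (iid n q) (fun D => ∏ i, g (D i)) = expect q g ^ n := by
  simp only [expect, iid_toReal, ← Finset.prod_mul_distrib]
  exact sum_prod_apply n fun z => (q z).toReal * g z

lemma iid_pos (n : ℕ) (q : PMF Z) {D : Fin n → Z} (h : 0 < (iid n q D).toReal) (i : Fin n) :
    0 < (q (D i)).toReal := by
  rw [iid_toReal] at h
  refine ENNReal.toReal_nonneg.lt_of_ne' fun h0 => ?_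
  rw [Finset.prod_eq_zero (Finset.mem_univ i) h0] at h
  exact lt_irrefl _ h

open Classical in
lemma toOuterMeasure_eq_expect (q : PMF Z) (s : Set Z) :
    q.toOuterMeasure s = ENNReal.ofReal (expect q (fun z => if z ∈ s then 1 else 0)) := by
  rw [PMF.toOuterMeasure_apply_fintype, expect, ENNReal.ofReal_sum_of_nonneg]
  · refine Finset.sum_congr rfl fun z _ => ?_
    by_cases hz : z ∈ s <;> simp [hz, ENNReal.ofReal_toReal (q.apply_ne_top z)]
  · intro z _; positivity

open Classical in
-- Markov's inequality: on the support, `f` dominates the indicator of the complement of `s`.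
lemma le_toOuterMeasure (q : PMF Z) (s : Set Z) (f : Z → ℝ)
    (h : ∀ z, 0 < (q z).toReal → z ∉ s → 1 ≤ f z) (hf : ∀ z, 0 ≤ f z) {c : ℝ}
    (hc : expect q f ≤ c) : ENNReal.ofReal (1 - c) ≤ q.toOuterMeasure s := by
  rw [toOuterMeasure_eq_expect]
  refine ENNReal.ofReal_le_ofReal ?_
  have h1 : expect q (fun _ => 1) ≤ expect q (fun z => (if z ∈ s then 1 else 0) + f z) :=
    expect_mono q fun z hz => by
      by_cases hs : z ∈ s
      · simp [hs, hf z]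
      · simpa [hs] using h z hz hs
  rw [expect_const] at h1
  have h2 : expect q (fun z => (if z ∈ s then 1 else 0) + f z)
      = expect q (fun z => if z ∈ s then 1 else 0) + expect q f := by
    simp [expect, mul_add, Finset.sum_add_distrib]
  linarith

end Expect

/-! ### Labelled samples -/

section Samples

variable {X A : Type*} [Fintype X] [Fintype A] {d : ℕ} {P : Problem X A d}

lemma Problem.expect_sampleLaw (r : X → A → ℝ) (π : X → PMF A) (f : X × A × A → ℝ) :
    expect (P.sampleLaw r π) f = ∑ x, (P.D x).toReal * ∑ a, ∑ b,
      (π x a).toReal * (π x b).toReal *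
        (Real.sigmoid (r x a - r x b) * f (x, a, b)
          + Real.sigmoid (r x b - r x a) * f (x, b, a)) := by
  simp only [sampleLaw, expect_bind, expect_map, expect_sigmoidCoin]
  simp only [expect, Finset.mul_sum, neg_sub, if_true, mul_assoc, Bool.false_eq_true, if_false]

lemma Problem.sampleLaw_pos {r : X → A → ℝ} {π : X → PMF A} {z : X × A × A}
    (h : 0 < (P.sampleLaw r π z).toReal) :
    0 < (π z.1 z.2.1).toReal ∧ 0 < (π z.1 z.2.2).toReal := by
  have h1 : P.sampleLaw r π z ≠ 0 := fun h0 => by simp [h0] at h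
  rw [← PMF.mem_support_iff] at h1
  simp only [sampleLaw, PMF.mem_support_bind_iff, PMF.support_map, Set.mem_image] at h1
  obtain ⟨x, _, a, ha, b, hb, c, _, rfl⟩ := h1
  have ha' := ENNReal.toReal_pos (((π x).mem_support_iff a).1 ha) ((π x).apply_ne_top a)
  have hb' := ENNReal.toReal_pos (((π x).mem_support_iff b).1 hb) ((π x).apply_ne_top b)
  cases c
  · exact ⟨hb', ha'⟩
  · exact ⟨ha', hb'⟩

variable (P) in
/-- The reward difference `γ θᵀ (φ(x, a) - φ(x, b))` of a triple `z = (x, a, b)`. -/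
def Problem.margin (θ : Fin d → ℝ) (z : X × A × A) : ℝ :=
  P.γ * (θ ⬝ᵥ P.φ z.1 z.2.1 - θ ⬝ᵥ P.φ z.1 z.2.2)

lemma Problem.margin_swap (θ : Fin d → ℝ) (x : X) (a b : A) :
    P.margin θ (x, b, a) = -P.margin θ (x, a, b) := by
  simp only [margin]; ring

lemma Problem.log_policy (θ : Fin d → ℝ) {x : X} {a : A} (h : 0 < (P.π₀ x a).toReal) :
    Real.log (P.policy θ x a).toReal = Real.log (P.π₀ x a).toReal + θ ⬝ᵥ P.φ x a
      - Real.log (∑ b, (P.π₀ x b).toReal * Real.exp (θ ⬝ᵥ P.φ x b)) := by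
  rw [policy, tilt_toReal, Real.log_div (by positivity)
    (tilt_norm_pos P.π₀ (fun x a => θ ⬝ᵥ P.φ x a) x).ne',
    Real.log_mul h.ne' (Real.exp_pos _).ne', Real.log_exp]

lemma Problem.log_target (r : X → A → ℝ) {x : X} {a : A} (h : 0 < (P.π₀ x a).toReal) :
    Real.log (P.target r x a).toReal = Real.log (P.π₀ x a).toReal + r x a / P.γ
      - Real.log (∑ b, (P.π₀ x b).toReal * Real.exp (r x b / P.γ)) := by
  rw [target, tilt_toReal, Real.log_div (by positivity)
    (tilt_norm_pos P.π₀ (fun x a => r x a / P.γ) x).ne',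
    Real.log_mul h.ne' (Real.exp_pos _).ne', Real.log_exp]

/-- Equal target policies determine the reward on the support of `π₀` up to a constant per prompt.
The log-normalizers cancel in differences, which are all that the labels depend on. -/
lemma Problem.reward_sub_eq {r : X → A → ℝ} {θs : Fin d → ℝ} (hγ : 0 < P.γ)
    (hr : P.target r = P.policy θs) {x : X} {a b : A} (ha : 0 < (P.π₀ x a).toReal)
    (hb : 0 < (P.π₀ x b).toReal) : r x a - r x b = P.margin θs (x, a, b) := by
  have h1 := P.log_target r ha
  have h2 := P.log_target r hb
  rw [hr, P.log_policy θs ha] at h1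
  rw [hr, P.log_policy θs hb] at h2
  have h3 : r x a / P.γ - r x b / P.γ = θs ⬝ᵥ P.φ x a - θs ⬝ᵥ P.φ x b := by linarith
  rw [margin, ← h3]
  field_simp

/-- On the support of `π₀` the logarithms split and the normalizers cancel, so the DPO loss is the
negative log-likelihood of a logistic model. -/
lemma Problem.dpoLoss_policy (θ : Fin d → ℝ) {n : ℕ} (D : Fin n → X × A × A)
    (h : ∀ i, 0 < (P.π₀ (D i).1 (D i).2.1).toReal ∧ 0 < (P.π₀ (D i).1 (D i).2.2).toReal) :
    P.dpoLoss (P.policy θ) D = ∑ i, -Real.log (Real.sigmoid (P.margin θ (D i))) := by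
  refine Finset.sum_congr rfl fun i _ => ?_
  have h1 := (tilt_pos_iff P.π₀ (fun x a => θ ⬝ᵥ P.φ x a) (D i).1 (D i).2.1).2 (h i).1
  have h2 := (tilt_pos_iff P.π₀ (fun x a => θ ⬝ᵥ P.φ x a) (D i).1 (D i).2.2).2 (h i).2
  rw [← Problem.policy] at h1 h2
  rw [Real.log_div h1.ne' h2.ne', Real.log_div (h i).1.ne' (h i).2.ne',
    P.log_policy θ (h i).1, P.log_policy θ (h i).2, margin]
  ring_nf

lemma Problem.abs_margin_le (hγ : 0 < P.γ) (θ : Fin d → ℝ) (z : X × A × A) :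
    |P.margin θ z| ≤ 2 * P.γ * lpNorm 2 θ := by
  rw [margin, abs_mul, abs_of_pos hγ]
  have h1 := abs_sub (θ ⬝ᵥ P.φ z.1 z.2.1) (θ ⬝ᵥ P.φ z.1 z.2.2)
  have h2 := P.abs_dotProduct_φ_le θ z.1 z.2.1
  have h3 := P.abs_dotProduct_φ_le θ z.1 z.2.2
  nlinarith

lemma Problem.margin_sub (θ θ' : Fin d → ℝ) (z : X × A × A) :
    P.margin θ z - P.margin θ' z = P.margin (θ - θ') z := by
  simp only [margin, sub_dotProduct]; ring

end Samples

/-! ### The logistic likelihood -/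

section Logistic

/-- Multiplicative form of the fact that `log σ` is 1-Lipschitz. -/
lemma sigmoid_le_mul_exp (u v : ℝ) :
    Real.sigmoid u ≤ Real.sigmoid v * Real.exp |u - v| := by
  rw [Real.sigmoid_def, Real.sigmoid_def, inv_mul_eq_div, le_div_iff₀ (by positivity),
    inv_mul_le_iff₀ (by positivity)]
  have h1 : 1 ≤ Real.exp |u - v| := Real.one_le_exp (abs_nonneg _)
  have h2 : Real.exp (-v) ≤ Real.exp (-u) * Real.exp |u - v| := by
    rw [← Real.exp_add, Real.exp_le_exp]
    linarith [le_abs_self (u - v)]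
  linarith

lemma log_sigmoid_le (u v : ℝ) :
    Real.log (Real.sigmoid u) ≤ Real.log (Real.sigmoid v) + |u - v| := by
  have h := Real.log_le_log (Real.sigmoid_pos u) (sigmoid_le_mul_exp u v)
  rwa [Real.log_mul (Real.sigmoid_pos v).ne' (Real.exp_pos _).ne', Real.log_exp] at h

/-- A lower bound for the slope of the sigmoid on `[-M, M]`. -/
def sigmoidSlope (M : ℝ) : ℝ := Real.exp (-M) / (1 + Real.exp M) ^ 2

lemma sigmoidSlope_pos (M : ℝ) : 0 < sigmoidSlope M := by unfold sigmoidSlope; positivity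

lemma sigmoidSlope_le_one {M : ℝ} (hM : 0 ≤ M) : sigmoidSlope M ≤ 1 := by
  unfold sigmoidSlope
  rw [div_le_one (by positivity)]
  have h1 : Real.exp (-M) ≤ 1 := Real.exp_le_one_iff.2 (by linarith)
  nlinarith [Real.exp_pos M]

/-- Over a common denominator, the numerator is a difference of exponentials, bounded below by `1 +
x ≤ exp x`, and the denominator is at most `(1 + exp M)^2`. -/
lemma sigmoidSlope_mul_le {M u v : ℝ} (hu : |u| ≤ M) (hv : |v| ≤ M) (huv : v ≤ u) :
    sigmoidSlope M * (u - v) ≤ Real.sigmoid u - Real.sigmoid v := by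
  have e : Real.sigmoid u - Real.sigmoid v
      = (Real.exp (-v) - Real.exp (-u)) / ((1 + Real.exp (-u)) * (1 + Real.exp (-v))) := by
    rw [Real.sigmoid_def, Real.sigmoid_def]
    field_simp
    ring
  rw [e, sigmoidSlope, div_mul_eq_mul_div]
  have hu' := abs_le.1 hu
  have hv' := abs_le.1 hv
  have h1 : Real.exp (-M) * (u - v) ≤ Real.exp (-v) - Real.exp (-u) := by
    have h2 : Real.exp (-v) = Real.exp (-u) * Real.exp (u - v) := by
      rw [← Real.exp_add]; ring_nf
    have h3 := Real.add_one_le_exp (u - v)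
    have h4 : Real.exp (-M) ≤ Real.exp (-u) := Real.exp_le_exp.2 (by linarith)
    have h5 := mul_le_mul_of_nonneg_right h4 (sub_nonneg.2 huv)
    have h6 := mul_le_mul_of_nonneg_left h3 (Real.exp_pos (-u)).le
    rw [h2]
    linarith
  have h7 : 0 ≤ Real.exp (-M) * (u - v) := mul_nonneg (Real.exp_pos _).le (sub_nonneg.2 huv)
  refine div_le_div₀ (h7.trans h1) h1 (by positivity) ?_
  rw [sq]
  have := Real.exp_le_exp.2 (by linarith : -u ≤ M)
  have := Real.exp_le_exp.2 (by linarith : -v ≤ M)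
  gcongr

lemma sq_sigmoidSlope_mul_le {M u v : ℝ} (hu : |u| ≤ M) (hv : |v| ≤ M) :
    sigmoidSlope M ^ 2 * (u - v) ^ 2 ≤ (Real.sigmoid u - Real.sigmoid v) ^ 2 := by
  rw [← mul_pow, sq_le_sq]
  rcases le_total v u with h | h
  · have h1 := sigmoidSlope_mul_le hu hv h
    rw [abs_of_nonneg (mul_nonneg (sigmoidSlope_pos M).le (sub_nonneg.2 h))]
    exact h1.trans (le_abs_self _)
  · have h1 := sigmoidSlope_mul_le hv hu h
    rw [abs_mul, abs_sub_comm, abs_of_nonneg (sub_nonneg.2 h), abs_of_pos (sigmoidSlope_pos M),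
      abs_sub_comm]
    exact h1.trans (le_abs_self _)

/-- AM-GM with remainder: the gap is `(√a - √b)^2 / 2`, and `(a - b)^2 = (√a - √b)^2 (√a + √b)^2 ≤ 4
(√a - √b)^2`. -/
lemma sqrt_mul_sqrt_le {a b : ℝ} (ha : 0 ≤ a) (ha1 : a ≤ 1) (hb : 0 ≤ b) (hb1 : b ≤ 1) :
    √a * √b ≤ (a + b) / 2 - (a - b) ^ 2 / 8 := by
  have h1 := Real.sq_sqrt ha
  have h2 := Real.sq_sqrt hb
  have h3 := Real.sqrt_le_one.2 ha1
  have h4 := Real.sqrt_le_one.2 hb1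
  have h5 := Real.sqrt_nonneg a
  have h6 := Real.sqrt_nonneg b
  set x := √a
  set y := √b
  rw [← h1, ← h2]
  have h7 : (x + y) ^ 2 ≤ 4 := by nlinarith
  nlinarith [mul_nonneg (sq_nonneg (x - y)) (sub_nonneg.2 h7)]

/-- The square root of the likelihood ratio of a label with logit `v` against logit `u`. -/
def sqrtRatio (u v : ℝ) : ℝ :=
  Real.exp ((Real.log (Real.sigmoid v) - Real.log (Real.sigmoid u)) / 2)

lemma sigmoid_mul_sqrtRatio (u v : ℝ) :
    Real.sigmoid u * sqrtRatio u v = √(Real.sigmoid u) * √(Real.sigmoid v) := by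
  have h1 := Real.exp_log (Real.sigmoid_pos u)
  rw [Real.sqrt_eq_rpow, Real.sqrt_eq_rpow, Real.rpow_def_of_pos (Real.sigmoid_pos u),
    Real.rpow_def_of_pos (Real.sigmoid_pos v), ← Real.exp_add]
  nth_rw 1 [← h1]
  rw [sqrtRatio, ← Real.exp_add]
  ring_nf

/-- The Bhattacharyya coefficient of two Bernoulli laws with bounded logits. -/
lemma bhattacharyya_le {M u v : ℝ} (hu : |u| ≤ M) (hv : |v| ≤ M) :
    Real.sigmoid u * sqrtRatio u v + Real.sigmoid (-u) * sqrtRatio (-u) (-v)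
      ≤ 1 - sigmoidSlope M ^ 2 / 4 * (u - v) ^ 2 := by
  rw [sigmoid_mul_sqrtRatio, sigmoid_mul_sqrtRatio]
  have h1 := sqrt_mul_sqrt_le (Real.sigmoid_nonneg u) (Real.sigmoid_le_one u)
    (Real.sigmoid_nonneg v) (Real.sigmoid_le_one v)
  have h2 := sqrt_mul_sqrt_le (Real.sigmoid_nonneg (-u)) (Real.sigmoid_le_one (-u))
    (Real.sigmoid_nonneg (-v)) (Real.sigmoid_le_one (-v))
  rw [Real.sigmoid_neg u, Real.sigmoid_neg v] at *
  have h3 := sq_sigmoidSlope_mul_le hu hv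
  nlinarith

end Logistic

/-! ### One round of DPO -/

section Round

variable {X A : Type*} [Fintype X] [Fintype A] {d : ℕ} {P : Problem X A d}

lemma Problem.policy_pos_iff (θ : Fin d → ℝ) (x : X) (a : A) :
    0 < (P.policy θ x a).toReal ↔ 0 < (P.π₀ x a).toReal :=
  tilt_pos_iff _ _ _ _

/-- The pair of actions is drawn from `π_θ` whatever the reward, so only the label is informative.
Averaging the Bernoulli affinity bound over the pair gives `1` minus a multiple of the covariance
form by `Problem.sum_sq_diff`, and `1 - x ≤ exp (-x)` makes it exponential. -/
lemma Problem.expect_sqrtRatio_le {r : X → A → ℝ} {θs : Fin d → ℝ} (hγ : 0 < P.γ)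
    (hr : P.target r = P.policy θs) (θ θ' : Fin d → ℝ) {M : ℝ}
    (hs : 2 * P.γ * lpNorm 2 θs ≤ M) (h' : 2 * P.γ * lpNorm 2 θ' ≤ M) :
    expect (P.sampleLaw r (P.policy θ)) (fun z => sqrtRatio (P.margin θs z) (P.margin θ' z))
      ≤ Real.exp (-(sigmoidSlope M ^ 2 * P.γ ^ 2 / 2 * P.covForm (P.policy θ) (θ' - θs))) := by
  rw [P.expect_sampleLaw]
  have key : ∀ x a b, (P.policy θ x a).toReal * (P.policy θ x b).toReal *
        (Real.sigmoid (r x a - r x b) * sqrtRatio (P.margin θs (x, a, b)) (P.margin θ' (x, a, b))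
          + Real.sigmoid (r x b - r x a) *
            sqrtRatio (P.margin θs (x, b, a)) (P.margin θ' (x, b, a)))
      ≤ (P.policy θ x a).toReal * (P.policy θ x b).toReal - sigmoidSlope M ^ 2 * P.γ ^ 2 / 4 *
        ((P.policy θ x a).toReal * (P.policy θ x b).toReal *
          ((θ' - θs) ⬝ᵥ P.φ x a - (θ' - θs) ⬝ᵥ P.φ x b) ^ 2) := by
    intro x a b
    rcases (ENNReal.toReal_nonneg : 0 ≤ (P.policy θ x a).toReal).eq_or_lt with ha | ha
    · simp [← ha]
    rcases (ENNReal.toReal_nonneg : 0 ≤ (P.policy θ x b).toReal).eq_or_lt with hb | hb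
    · simp [← hb]
    have ha' := (P.policy_pos_iff θ x a).1 ha
    have hb' := (P.policy_pos_iff θ x b).1 hb
    rw [P.reward_sub_eq hγ hr ha' hb', P.reward_sub_eq hγ hr hb' ha', P.margin_swap θs x a b,
      P.margin_swap θ' x a b]
    have h1 := bhattacharyya_le ((P.abs_margin_le hγ θs (x, a, b)).trans hs)
      ((P.abs_margin_le hγ θ' (x, a, b)).trans h')
    have h2 : (P.margin θs (x, a, b) - P.margin θ' (x, a, b)) ^ 2
        = P.γ ^ 2 * ((θ' - θs) ⬝ᵥ P.φ x a - (θ' - θs) ⬝ᵥ P.φ x b) ^ 2 := by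
      simp only [margin, sub_dotProduct]; ring
    rw [h2] at h1
    have h3 := mul_le_mul_of_nonneg_left h1 (mul_pos ha hb).le
    refine h3.trans (le_of_eq ?_)
    ring
  have hsum := P.sum_sq_diff (P.policy θ) (θ' - θs)
  calc _ ≤ ∑ x, (P.D x).toReal * ∑ a, ∑ b, ((P.policy θ x a).toReal * (P.policy θ x b).toReal
        - sigmoidSlope M ^ 2 * P.γ ^ 2 / 4 *
        ((P.policy θ x a).toReal * (P.policy θ x b).toReal *
          ((θ' - θs) ⬝ᵥ P.φ x a - (θ' - θs) ⬝ᵥ P.φ x b) ^ 2)) :=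
        Finset.sum_le_sum fun x _ => mul_le_mul_of_nonneg_left
          (Finset.sum_le_sum fun a _ => Finset.sum_le_sum fun b _ => key x a b)
          ENNReal.toReal_nonneg
    _ = 1 - sigmoidSlope M ^ 2 * P.γ ^ 2 / 4 * (2 * P.covForm (P.policy θ) (θ' - θs)) := by
        rw [← hsum, Finset.mul_sum]
        simp only [Finset.sum_sub_distrib, ← Finset.mul_sum, sum_toReal, mul_one, mul_sub]
        congr 1
        rw [Finset.mul_sum]
        exact Finset.sum_congr rfl fun x _ => mul_left_comm _ _ _
    _ ≤ _ := by
        have := Real.add_one_le_exp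
          (-(sigmoidSlope M ^ 2 * P.γ ^ 2 / 2 * P.covForm (P.policy θ) (θ' - θs)))
        linarith

/-- The point of the grid of mesh `s` with integer coordinates `k`. -/
def gridPoint (s : ℝ) (k : Fin d → ℤ) : Fin d → ℝ := fun i => k i * s

/-- Coordinates are rounded down with mesh `ρ / d`, so even the `L^1` error is at most `ρ`. The grid
point need lie neither in `S` nor in the ball. -/
lemma exists_gridPoint {p R ρ : ℝ} (hp : 1 ≤ p) (hρ : 0 < ρ) (hd : 0 < d)
    {θ : Fin d → ℝ} (h : lpNorm p θ ≤ R) :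
    ∃ k ∈ Fintype.piFinset (fun _ : Fin d => Finset.Icc (-(⌈R * d / ρ⌉₊ : ℤ)) ⌈R * d / ρ⌉₊),
      lpNorm 2 (gridPoint (ρ / d) k - θ) ≤ ρ := by
  have hd' : (0 : ℝ) < d := by exact_mod_cast hd
  have hs : 0 < ρ / d := by positivity
  refine ⟨fun i => ⌊θ i / (ρ / d)⌋, ?_, ?_⟩
  · rw [Fintype.mem_piFinset]
    intro i
    have h1 := abs_le.1 ((abs_apply_le_lpNorm hp θ i).trans h)
    have h2 : θ i / (ρ / d) ≤ R * d / ρ := by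
      rw [div_div_eq_mul_div]; gcongr; exact h1.2
    have h3 : -(R * d / ρ) ≤ θ i / (ρ / d) := by
      rw [div_div_eq_mul_div, ← neg_div, ← neg_mul]; gcongr; exact h1.1
    have h4 := Nat.le_ceil (R * d / ρ)
    rw [Finset.mem_Icc]
    constructor
    · rw [Int.le_floor]; push_cast; linarith
    · have : ((⌊θ i / (ρ / d)⌋ : ℤ) : ℝ) ≤ (⌈R * d / ρ⌉₊ : ℝ) :=
        (Int.floor_le _).trans (h2.trans h4)
      exact_mod_cast this
  · refine (lpNorm_le_sum (by norm_num) _).trans ?_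
    have : ∀ i : Fin d, |(gridPoint (ρ / d) (fun i => ⌊θ i / (ρ / d)⌋) - θ) i| ≤ ρ / d := by
      intro i
      have h1 := Int.floor_le (θ i / (ρ / d))
      have h2 := Int.lt_floor_add_one (θ i / (ρ / d))
      rw [le_div_iff₀ hs] at h1
      rw [div_lt_iff₀ hs] at h2
      rw [Pi.sub_apply, gridPoint, abs_le]
      constructor <;> nlinarith
    calc _ ≤ ∑ _i : Fin d, ρ / d := Finset.sum_le_sum fun i _ => this i
      _ = ρ := by simp; field_simp

lemma card_grid (m : ℕ) :
    (Fintype.piFinset (fun _ : Fin d => Finset.Icc (-(m : ℤ)) m)).card = (2 * m + 1) ^ d := by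
  rw [Fintype.card_piFinset_const, Int.card_Icc]
  congr 1
  omega

/-- With high probability every DPO update has a small error in the covariance norm of the
sampling policy. -/
lemma Problem.dpoUpdate_concentration {r : X → A → ℝ} {θs : Fin d → ℝ} {p R M q : ℝ}
    {S : Submodule ℝ (Fin d → ℝ)} (hp : 1 ≤ p) (hp₂ : p ≤ 2) (hd : 0 < d)
    (hγ : 0 < P.γ) (hr : P.target r = P.policy θs) (hθs : θs ∈ paramSet p R S)
    (hM : 4 * P.γ * R ≤ M) (hq : 0 < q)
    (hρR : sigmoidSlope M ^ 2 * P.γ * q / 16 ≤ R)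
    (hρq : (sigmoidSlope M ^ 2 * P.γ * q / 16) ^ 2 ≤ q / 4)
    (θ : Fin d → ℝ) (n : ℕ) (sel : (Fin n → X × A × A) → Fin d → ℝ)
    (hsel : ∀ D, P.IsDPOUpdate p R S D (sel D)) :
    ENNReal.ofReal (1 - (2 * ⌈R * d / (sigmoidSlope M ^ 2 * P.γ * q / 16)⌉₊ + 1 : ℝ) ^ d *
        Real.exp (-(n * (sigmoidSlope M ^ 2 * P.γ ^ 2 * q / 16)))) ≤
      (iid n (P.sampleLaw r (P.policy θ))).toOuterMeasure
        {D | P.covForm (P.policy θ) (sel D - θs) ≤ q} := by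
  classical
  set h := sigmoidSlope M with hh
  have hpos : 0 < h := sigmoidSlope_pos M
  -- Discretization costs `n γ ρ = n h² γ² q / 16` in the exponent, half of the gain `n (h² γ² / 2)
  -- (q / 4)`; the other half remains.
  set ρ := h ^ 2 * P.γ * q / 16 with hρ
  have hρ0 : 0 < ρ := by positivity
  set m := ⌈R * d / ρ⌉₊
  set Q := P.covForm (P.policy θ) with hQ
  -- Grid points that can lie near a bad minimizer: the quadratic inequality for `Q` with `ρ² ≤ q /
  -- 4` leaves error at least `q / 4`, and `ρ ≤ R` keeps the logits below `4 γ R ≤ M`.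
  set G := (Fintype.piFinset (fun _ : Fin d => Finset.Icc (-(m : ℤ)) m)).filter
    (fun k => q / 4 ≤ Q (gridPoint (ρ / d) k - θs) ∧
      2 * P.γ * lpNorm 2 (gridPoint (ρ / d) k) ≤ M) with hG
  set q' := P.sampleLaw r (P.policy θ)
  have hR0 : lpNorm 2 θs ≤ R := (lpNorm_two_le hp hp₂ θs).trans hθs.2
  have hRnn : 0 ≤ R := (lpNorm_nonneg (by norm_num) θs).trans hR0
  -- The dominating function sums the square-root likelihood ratios of the grid points against `θs`.
  -- On the bad event the minimizer is at least as likely as `θs`, and its grid neighbour loses at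
  -- most `2 γ ρ` per sample, halved by the root; the factor `exp (n γ ρ)` compensates this loss.
  refine le_toOuterMeasure _ _ (fun D => ∑ k ∈ G, Real.exp (n * (P.γ * ρ)) *
    ∏ i, sqrtRatio (P.margin θs (D i)) (P.margin (gridPoint (ρ / d) k) (D i))) ?_ ?_ ?_
  · intro D hD hbad
    have hbad' : q < Q (sel D - θs) := not_le.1 hbad
    obtain ⟨hin, hmin⟩ := hsel D
    have hsupp : ∀ i, 0 < (P.π₀ (D i).1 (D i).2.1).toReal ∧
        0 < (P.π₀ (D i).1 (D i).2.2).toReal := fun i => by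
      have := Problem.sampleLaw_pos (iid_pos n q' hD i)
      rwa [P.policy_pos_iff, P.policy_pos_iff] at this
    have hloss := hmin θs hθs
    rw [P.dpoLoss_policy _ D hsupp, P.dpoLoss_policy _ D hsupp] at hloss
    obtain ⟨k, hk, hkθ⟩ := exists_gridPoint (ρ := ρ) hp hρ0 hd hin.2
    set g := gridPoint (ρ / d) k
    have hkG : k ∈ G := by
      rw [hG, Finset.mem_filter]
      refine ⟨hk, ?_, ?_⟩
      · have h1 := P.covForm_add_le (P.policy θ) (g - θs) (sel D - g)
        rw [← hQ, show g - θs + (sel D - g) = sel D - θs by abel] at h1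
        have h2 := P.covForm_le (P.policy θ) (sel D - g)
        rw [← lpNorm_two_sq, lpNorm_sub_comm (by norm_num)] at h2
        have h3 : lpNorm 2 (g - sel D) ^ 2 ≤ ρ ^ 2 :=
          pow_le_pow_left₀ (lpNorm_nonneg (by norm_num) _) hkθ 2
        linarith
      · have h1 := lpNorm_add_le (p := 2) (by norm_num) (g - sel D) (sel D)
        rw [sub_add_cancel] at h1
        have h2 := (lpNorm_two_le hp hp₂ (sel D)).trans hin.2
        nlinarith
    refine le_trans ?_ (Finset.single_le_sum (f := fun k => Real.exp (n * (P.γ * ρ)) *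
      ∏ i, sqrtRatio (P.margin θs (D i)) (P.margin (gridPoint (ρ / d) k) (D i)))
      (fun k _ => mul_nonneg (Real.exp_pos _).le
        (Finset.prod_nonneg fun i _ => (Real.exp_pos _).le)) hkG)
    simp only [sqrtRatio, ← Real.exp_sum, ← Real.exp_add]
    rw [← Real.exp_zero, Real.exp_le_exp]
    have hlip : ∀ i, Real.log (Real.sigmoid (P.margin (sel D) (D i)))
        ≤ Real.log (Real.sigmoid (P.margin g (D i))) + 2 * P.γ * ρ := fun i => by
      refine (log_sigmoid_le _ (P.margin g (D i))).trans ?_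
      rw [abs_sub_comm, P.margin_sub]
      have := (P.abs_margin_le hγ (g - sel D) (D i)).trans
        (mul_le_mul_of_nonneg_left hkθ (by positivity))
      linarith
    have hsum := Finset.sum_le_sum fun i (_ : i ∈ Finset.univ) => hlip i
    rw [Finset.sum_add_distrib] at hsum
    simp only [Finset.sum_const, Finset.card_univ, Fintype.card_fin, nsmul_eq_mul,
      Finset.sum_neg_distrib] at hsum hloss
    rw [← Finset.sum_div, Finset.sum_sub_distrib]
    linarith
  · intro D
    exact Finset.sum_nonneg fun k _ => mul_nonneg (Real.exp_pos _).le
      (Finset.prod_nonneg fun i _ => (Real.exp_pos _).le)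
  · rw [expect_sum]
    have hterm : ∀ k ∈ G, expect (iid n q') (fun D => Real.exp (n * (P.γ * ρ)) *
        ∏ i, sqrtRatio (P.margin θs (D i)) (P.margin (gridPoint (ρ / d) k) (D i)))
        ≤ Real.exp (-(n * (h ^ 2 * P.γ ^ 2 * q / 16))) := by
      intro k hk
      rw [hG, Finset.mem_filter] at hk
      rw [expect_const_mul, expect_iid_prod n q' (fun z => sqrtRatio (P.margin θs z)
        (P.margin (gridPoint (ρ / d) k) z))]
      have hs : 2 * P.γ * lpNorm 2 θs ≤ M := by nlinarith
      have h1 := P.expect_sqrtRatio_le hγ hr θ (gridPoint (ρ / d) k) hs hk.2.2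
      have h2 := pow_le_pow_left₀ (expect_nonneg _ fun z => (Real.exp_pos _).le) h1 n
      rw [← Real.exp_nat_mul] at h2
      refine (mul_le_mul_of_nonneg_left h2 (Real.exp_pos _).le).trans ?_
      rw [← Real.exp_add, Real.exp_le_exp, ← hh, ← hQ]
      have h3 : h ^ 2 * P.γ ^ 2 / 2 * (q / 4)
          ≤ h ^ 2 * P.γ ^ 2 / 2 * Q (gridPoint (ρ / d) k - θs) :=
        mul_le_mul_of_nonneg_left hk.2.1 (by positivity)
      have h4 := mul_le_mul_of_nonneg_left h3 (Nat.cast_nonneg n : (0 : ℝ) ≤ n)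
      have h5 : P.γ * ρ = h ^ 2 * P.γ ^ 2 * q / 16 := by rw [hρ]; ring
      rw [h5]
      linarith
    refine (Finset.sum_le_sum hterm).trans ?_
    rw [Finset.sum_const, nsmul_eq_mul]
    refine mul_le_mul_of_nonneg_right ?_ (Real.exp_pos _).le
    have hc : G.card ≤ (2 * m + 1) ^ d := by
      rw [← card_grid m]; exact Finset.card_filter_le _ _
    exact_mod_cast hc

/-- If in every round the invariant `s k` is preserved with probability at least `1 - η`, then
it holds after `K` rounds with probability at least `1 - K η`. -/
lemma Problem.onPolicyDPO_invariant {r : X → A → ℝ} {n : ℕ}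
    (sel : ℕ → (Fin d → ℝ) → (Fin n → X × A × A) → (Fin d → ℝ)) (s : ℕ → Set (Fin d → ℝ))
    {η : ℝ} (hη : η ≤ 1) (h0 : (0 : Fin d → ℝ) ∈ s 0)
    (hs : ∀ k, ∀ θ ∈ s k, ENNReal.ofReal (1 - η) ≤
      (iid n (P.sampleLaw r (P.policy θ))).toOuterMeasure {D | sel k θ D ∈ s (k + 1)}) (K : ℕ) :
    ENNReal.ofReal (1 - K * η) ≤ (P.onPolicyDPO r sel K).toOuterMeasure (s K) := by
  have key : ∀ k, ENNReal.ofReal ((1 - η) ^ k) ≤ (P.onPolicyDPO r sel k).toOuterMeasure (s k) := by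
    intro k
    induction k with
    | zero => simp [onPolicyDPO, PMF.toOuterMeasure_pure_apply, h0]
    | succ k ih =>
      rw [onPolicyDPO, PMF.toOuterMeasure_bind_apply, pow_succ,
        ENNReal.ofReal_mul (pow_nonneg (by linarith) k)]
      calc _ ≤ (P.onPolicyDPO r sel k).toOuterMeasure (s k) * ENNReal.ofReal (1 - η) := by
            gcongr
        _ = ∑' θ, (s k).indicator (P.onPolicyDPO r sel k) θ * ENNReal.ofReal (1 - η) := by
            rw [PMF.toOuterMeasure_apply, ENNReal.tsum_mul_right]
        _ ≤ _ := by
            refine ENNReal.tsum_le_tsum fun θ => ?_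
            by_cases hθ : θ ∈ s k
            · rw [Set.indicator_of_mem hθ, PMF.toOuterMeasure_map_apply]
              gcongr
              exact hs k θ hθ
            · simp [hθ]
  -- Bernoulli's inequality replaces `(1 - η)^K` by `1 - K η`.
  refine le_trans (ENNReal.ofReal_le_ofReal ?_) (key K)
  have := one_add_mul_le_pow (a := -η) (by linarith) K
  rw [← sub_eq_add_neg, mul_neg, ← sub_eq_add_neg] at this
  exact this

end Round

/-! ### The on-policy upper bound -/

section OnPolicy

/-- Both growth alternatives are used only through this affine bound. In the convex case it is the
chord between `0` and `R` with `C 0 ≤ 1`. In the interval case the sublevel set contains `R` and a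
small radius `r₀`, hence everything between, while below `r₀` the coverage is at most `e²`. -/
lemma Problem.CoverageGrowth.sqrt_le {X A : Type*} [Fintype X] [Fintype A] {d : ℕ}
    {P : Problem X A d} {p R κ : ℝ} {θs : Fin d → ℝ} (hp : 1 ≤ p) (hp₂ : p ≤ 2) (hR : 1 ≤ R)
    (hκ : 1 ≤ κ) (h : P.CoverageGrowth p θs R κ) {r : ℝ} (hr : 0 ≤ r) (hrR : r ≤ R) :
    √(P.localCoverage p θs r)
      ≤ Real.exp 1 * κ * (1 + r / R * √(P.localCoverage p θs R)) := by
  have hα := P.featureLipschitz_two hp hp₂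
  have hR0 : 0 < R := by linarith
  have he : 1 ≤ Real.exp 1 := Real.one_le_exp (by norm_num)
  have hA : 1 ≤ Real.exp 1 * κ := by nlinarith
  set C := P.localCoverage p θs with hC
  have hCR : 0 ≤ C R := Problem.localCoverage_nonneg θs R
  have hx : 0 ≤ r / R * √(C R) := by positivity
  rcases h with hconv | ⟨hord, hbig⟩
  · have h0 : √(C 0) ≤ 1 := by
      rw [Real.sqrt_le_one]
      simpa using hα.localCoverage_le_exp (by norm_num) hp θs le_rfl
    have h1 := hconv.2 (show (0 : ℝ) ∈ Set.Icc 0 R from ⟨le_rfl, hR0.le⟩)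
      (show R ∈ Set.Icc 0 R from ⟨hR0.le, le_rfl⟩) (show 0 ≤ 1 - r / R by rw [sub_nonneg, div_le_one hR0]; exact hrR)
      (show 0 ≤ r / R by positivity) (by ring)
    simp only [smul_eq_mul, mul_zero, zero_add, div_mul_cancel₀ r hR0.ne'] at h1
    have h2 : (1 - r / R) * √(C 0) ≤ 1 * 1 :=
      mul_le_mul (by linarith [show 0 ≤ r / R by positivity]) h0 (Real.sqrt_nonneg _) zero_le_one
    nlinarith
  · rw [← hC] at hord hbig
    set w := √(κ * C R) with hw
    have hwpos : 0 < w := lt_of_lt_of_le (by positivity) hbig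
    have hwsq : w ^ 2 = κ * C R := Real.sq_sqrt (by positivity)
    -- Chosen so that `κ C(R) r₀² = e² R²`. The assumption on `√(κ C(R))` says exactly `r₀ ≤ 1`,
    -- where the Lipschitz bound gives `C ≤ e²`.
    set r₀ := Real.exp 1 * R / w with hr₀
    have hr₀1 : r₀ ≤ 1 := (div_le_one hwpos).2 hbig
    have hr₀0 : 0 ≤ r₀ := by positivity
    have hsmall : ∀ t, 0 ≤ t → t ≤ 1 → C t ≤ Real.exp 1 ^ 2 := fun t ht ht1 => by
      refine (hα.localCoverage_le_exp (by norm_num) hp θs ht).trans ?_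
      rw [← Real.exp_nat_mul, Real.exp_le_exp]
      push_cast
      linarith
    rcases le_total r r₀ with hlt | hge
    · have h1 : √(C r) ≤ Real.exp 1 := Real.sqrt_le_iff.2
        ⟨(Real.exp_pos 1).le, hsmall r hr (hlt.trans hr₀1)⟩
      nlinarith
    · have hmem₀ : r₀ ∈ {t : ℝ | t ∈ Set.Icc 0 R ∧ C t * R ^ 2 ≤ κ * C R * t ^ 2} := by
        refine ⟨⟨hr₀0, hr₀1.trans hR⟩, ?_⟩
        have e : κ * C R * r₀ ^ 2 = Real.exp 1 ^ 2 * R ^ 2 := by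
          rw [← hwsq, hr₀]; field_simp
        rw [e]
        exact mul_le_mul_of_nonneg_right (hsmall r₀ hr₀0 hr₀1) (sq_nonneg R)
      have hmemR : R ∈ {t : ℝ | t ∈ Set.Icc 0 R ∧ C t * R ^ 2 ≤ κ * C R * t ^ 2} :=
        ⟨⟨hR0.le, le_rfl⟩, mul_le_mul_of_nonneg_right (le_mul_of_one_le_left hCR hκ)
          (sq_nonneg R)⟩
      have h1 := (hord.out hmem₀ hmemR ⟨hge, hrR⟩).2
      have h2 : √(C r) ≤ κ * (r / R * √(C R)) := by
        refine Real.sqrt_le_iff.2 ⟨by positivity, ?_⟩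
        rw [mul_pow, mul_pow, Real.sq_sqrt hCR, div_pow]
        rw [← le_div_iff₀ (by positivity)] at h1
        refine h1.trans ?_
        have : κ * C R * r ^ 2 / R ^ 2 = κ * (r ^ 2 / R ^ 2 * C R) := by ring
        rw [this]
        exact mul_le_mul_of_nonneg_right (by nlinarith) (by positivity)
      have h3 : κ * (r / R * √(C R)) ≤ Real.exp 1 * κ * (r / R * √(C R)) :=
        mul_le_mul_of_nonneg_right (by nlinarith) hx
      nlinarith

/-- The scalar core of the contraction: `r` is the old error, `y` the new one, `C` the coverage at
radius `r` and `s² = C(R)`. Since `R ≤ ε √m` and `s ≤ √m`, the growth bound gives `√C R ≤ A (R + r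
s) ≤ A (ε + r) √m`, and `m` cancels against the sample size. -/
lemma le_quarter_of_sq_le {A c₀ C R s r ε D lam m y : ℝ} (hR : 0 < R) (hs : 0 ≤ s) (hr : 0 ≤ r)
    (hε : 0 < ε) (hA : 0 < A) (hC : 0 ≤ C) (hD : 0 < D) (hlam : 0 < lam)
    (hc₀ : c₀ * A ^ 2 ≤ 1 / 16) (hc₀' : 0 ≤ c₀)
    (hCA : √C ≤ A * (1 + r / R * s)) (hm : m = max (R ^ 2 / ε ^ 2) (s ^ 2))
    (hy : y ^ 2 ≤ D * (C * (c₀ * R ^ 2 / (D / lam * m)) / lam)) : y ≤ (ε + r) / 4 := by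
  have hm0 : 0 < m := by rw [hm]; exact lt_max_of_lt_left (by positivity)
  have h1 : R ≤ ε * √m := by
    refine (sq_le_sq₀ hR.le (by positivity)).1 ?_
    rw [mul_pow, Real.sq_sqrt hm0.le, ← div_le_iff₀' (by positivity), hm]
    exact le_max_left _ _
  have h2 : s ≤ √m := by
    refine Real.le_sqrt_of_sq_le ?_
    rw [hm]; exact le_max_right _ _
  have h3 : √C * R ≤ A * ((ε + r) * √m) := by
    calc √C * R ≤ A * (1 + r / R * s) * R := by gcongr
      _ = A * (R + r * s) := by field_simp
      _ ≤ A * (ε * √m + r * √m) := by gcongr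
      _ = _ := by ring
  have h4 : C * R ^ 2 ≤ A ^ 2 * ((ε + r) ^ 2 * m) := by
    have := pow_le_pow_left₀ (by positivity) h3 2
    simpa only [mul_pow, Real.sq_sqrt hC, Real.sq_sqrt hm0.le] using this
  have h5 : D * (C * (c₀ * R ^ 2 / (D / lam * m)) / lam) = c₀ * (C * R ^ 2) / m := by
    field_simp
  refine abs_le_of_sq_le_sq' (hy.trans ?_) (by positivity) |>.2
  rw [h5, div_le_iff₀ hm0]
  calc c₀ * (C * R ^ 2) ≤ c₀ * (A ^ 2 * ((ε + r) ^ 2 * m)) := by gcongr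
    _ = c₀ * A ^ 2 * ((ε + r) ^ 2 * m) := by ring
    _ ≤ 1 / 16 * ((ε + r) ^ 2 * m) := by gcongr
    _ = ((ε + r) / 4) ^ 2 * m := by ring

/-- Union bound arithmetic: the logarithm of the net size is at most `d (log A₁ + log N)`. The
exponent `E` also carries a factor `d`, so it absorbs both this and `log T`. -/
lemma pow_mul_exp_neg_le {A₁ A₂ B N x T η E : ℝ} {d : ℕ} (hd : 0 < d) (hA₁ : 1 ≤ A₁)
    (hN : 4 ≤ N) (hx : 0 ≤ x) (hxN : x ≤ A₁ * N) (hT : 1 ≤ T) (hη : η = 1 / T)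
    (hB : 2 + Real.log A₁ ≤ A₂ * B) (hE : A₂ * B * d * Real.log (T * N) ≤ E) :
    x ^ d * Real.exp (-E) ≤ η := by
  have hN0 : 0 < N := by linarith
  have hT0 : 0 < T := by linarith
  have hd' : (1 : ℝ) ≤ d := by exact_mod_cast hd
  have hlogN : 1 ≤ Real.log N := by
    rw [Real.le_log_iff_exp_le hN0]
    linarith [Real.exp_one_lt_d9]
  have hlogT : 0 ≤ Real.log T := Real.log_nonneg hT
  have hlogA : 0 ≤ Real.log A₁ := Real.log_nonneg hA₁
  rw [Real.log_mul hT0.ne' hN0.ne'] at hE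
  set ℓ := Real.log T + Real.log N with hℓ
  have h1 : x ^ d ≤ Real.exp (d * (Real.log A₁ + Real.log N)) := by
    rw [Real.exp_nat_mul, Real.exp_add, Real.exp_log (by linarith), Real.exp_log hN0]
    exact pow_le_pow_left₀ hx hxN d
  have h2 : η = Real.exp (-Real.log T) := by
    rw [Real.exp_neg, Real.exp_log hT0, hη, one_div]
  calc x ^ d * Real.exp (-E) ≤ Real.exp (d * (Real.log A₁ + Real.log N)) * Real.exp (-E) := by
        gcongr
    _ ≤ η := by
      rw [← Real.exp_add, h2, Real.exp_le_exp]
      have h3 : (2 + Real.log A₁) * (d * ℓ) ≤ A₂ * B * (d * ℓ) := by gcongr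
      have h4 : Real.log A₁ * d ≤ Real.log A₁ * (d * ℓ) :=
        mul_le_mul_of_nonneg_left (by nlinarith) hlogA
      have h5 : (d : ℝ) * Real.log N ≤ d * ℓ := by gcongr; linarith
      have h6 : ℓ ≤ d * ℓ := by nlinarith
      linarith

/-- The accuracy `q = c₀ R² d / N` carries a factor `d`: it cancels the `d` in the number of grid
points per axis and makes the exponent proportional to `d`, as a `d`-dimensional net requires. All
remaining dependence on `γ` and `R` is through `γ R`. -/
lemma dpo_failure_le {h c₀ c₁ γ R N K δ B : ℝ} {d n : ℕ} (hd : 0 < d) (hh : 0 < h)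
    (hc₁ : 0 < c₁) (hc₀ : 0 < c₀) (hγ : 0 < γ) (hR : 0 < R) (hγR : c₁ ≤ γ * R) (hN : 4 ≤ N)
    (hK : 1 ≤ K) (hδ : 0 < δ) (hδ1 : δ < 1)
    (hBA : 2 + Real.log (32 / (h ^ 2 * c₁ * c₀) + 3) ≤ h ^ 2 * c₀ * c₁ ^ 2 / 16 * B)
    (hn : B * N * Real.log (K / δ * N) ≤ n) :
    (2 * ⌈R * d / (h ^ 2 * γ * (c₀ * R ^ 2 * d / N) / 16)⌉₊ + 1 : ℝ) ^ d *
        Real.exp (-(n * (h ^ 2 * γ ^ 2 * (c₀ * R ^ 2 * d / N) / 16))) ≤ δ / K := by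
  have hN0 : 0 < N := by linarith
  have hd' : (0 : ℝ) < d := by exact_mod_cast hd
  have hKδ : 1 ≤ K / δ := by rw [le_div_iff₀ hδ]; linarith
  refine pow_mul_exp_neg_le hd ?_ hN (by positivity) ?_ hKδ (by rw [one_div_div]) hBA ?_
  · have : 0 < 32 / (h ^ 2 * c₁ * c₀) := by positivity
    linarith
  · have h1 : R * d / (h ^ 2 * γ * (c₀ * R ^ 2 * d / N) / 16)
        = 16 * N / (h ^ 2 * (γ * R) * c₀) := by
      field_simp
    have h2 : 16 * N / (h ^ 2 * (γ * R) * c₀) ≤ 16 * N / (h ^ 2 * c₁ * c₀) := by gcongr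
    rw [h1]
    have h3 := (Nat.ceil_lt_add_one (a := 16 * N / (h ^ 2 * (γ * R) * c₀)) (by positivity)).le
    have h4 : (32 / (h ^ 2 * c₁ * c₀) + 3) * N = 2 * (16 * N / (h ^ 2 * c₁ * c₀)) + 3 * N := by
      ring
    rw [h4]
    linarith
  · have h1 : n * (h ^ 2 * γ ^ 2 * (c₀ * R ^ 2 * d / N) / 16)
        = n / N * (d * (h ^ 2 * c₀ * (γ * R) ^ 2 / 16)) := by
      field_simp
    have h2 : B * Real.log (K / δ * N) ≤ n / N := by
      rw [le_div_iff₀ hN0]; linarith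
    have hlog : 0 ≤ Real.log (K / δ * N) := Real.log_nonneg (by nlinarith)
    rw [h1]
    calc h ^ 2 * c₀ * c₁ ^ 2 / 16 * B * d * Real.log (K / δ * N)
        = B * Real.log (K / δ * N) * (d * (h ^ 2 * c₀ * c₁ ^ 2 / 16)) := by ring
      _ ≤ _ := by gcongr

lemma Problem.lam_le_one {X A : Type*} [Fintype X] [Fintype A] {d : ℕ} {P : Problem X A d}
    {S : Submodule ℝ (Fin d → ℝ)} {θs : Fin d → ℝ} {lam : ℝ} (hS : S ≠ ⊥)
    (h : P.CovLowerBound S θs lam) : lam ≤ 1 := by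
  obtain ⟨v, hv, hv0⟩ := S.exists_mem_ne_zero_of_ne_bot hS
  have h1 := h v hv
  rw [P.dotProduct_featureCov_mulVec] at h1
  have h2 := P.covForm_le (P.policy θs) v
  have h3 : 0 < v ⬝ᵥ v := by
    refine lt_of_le_of_ne (Finset.sum_nonneg fun i _ => mul_self_nonneg _) ?_
    rw [Ne, eq_comm, dotProduct_self_eq_zero]
    exact hv0
  nlinarith

lemma rpow_two_div_ge {p : ℝ} (hp : 1 ≤ p) (hp₂ : p ≤ 2) {d : ℕ} (hd : 0 < d) :
    (d : ℝ) ≤ (d : ℝ) ^ (2 / p) := by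
  have hd' : (1 : ℝ) ≤ d := by exact_mod_cast hd
  have h : (1 : ℝ) ≤ 2 / p := by rw [le_div_iff₀ (by linarith)]; linarith
  simpa using Real.rpow_le_rpow_of_exponent_le hd' h

lemma effective_size_ge {p R lam ε c : ℝ} (hp : 1 ≤ p) (hp₂ : p ≤ 2) {d : ℕ} (hd : 0 < d)
    (hlam : 0 < lam) (hlam1 : lam ≤ 1) (hε : 0 < ε) :
    d * (R ^ 2 / ε ^ 2) ≤ (d : ℝ) ^ (2 / p) / lam * max (R ^ 2 / ε ^ 2) c := by
  have h1 := rpow_two_div_ge hp hp₂ hd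
  have h2 : (d : ℝ) ≤ (d : ℝ) ^ (2 / p) / lam := by
    rw [le_div_iff₀ hlam]
    have : (0 : ℝ) ≤ d := Nat.cast_nonneg d
    nlinarith
  exact mul_le_mul h2 (le_max_left _ _) (by positivity) ((Nat.cast_nonneg d).trans h2)

lemma sq_le_sq_div {R ε : ℝ} (hε : 0 < ε) (hε1 : ε ≤ 1) : R ^ 2 ≤ R ^ 2 / ε ^ 2 := by
  rw [le_div_iff₀ (by positivity)]
  have : ε ^ 2 ≤ 1 := pow_le_one₀ hε.le hε1
  nlinarith [sq_nonneg R]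

lemma log_two_le_log_div {R ε : ℝ} (hR : 2 ≤ R) (hε : 0 < ε) (hε1 : ε ≤ 1) :
    Real.log 2 ≤ Real.log (R / ε) := by
  refine Real.log_le_log (by norm_num) ?_
  rw [le_div_iff₀ hε]
  linarith

lemma div_four_pow_le {R ε B : ℝ} {K : ℕ} (hR : 2 ≤ R) (hε : 0 < ε) (hε1 : ε ≤ 1) (hB : 2 ≤ B)
    (hK : B * Real.log (R / ε) ≤ K) : R / 4 ^ K ≤ ε / 2 := by
  have h2 := log_two_le_log_div hR hε hε1
  have h3 : 0 < Real.log 2 := Real.log_pos (by norm_num)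
  have h4 : Real.log (2 * (R / ε)) ≤ K := by
    rw [Real.log_mul (by norm_num) (by positivity)]
    nlinarith
  have h5 : 2 * (R / ε) ≤ 4 ^ K := by
    rw [Real.log_le_iff_le_exp (by positivity)] at h4
    refine h4.trans ?_
    rw [← mul_one (K : ℝ), Real.exp_nat_mul]
    exact pow_le_pow_left₀ (Real.exp_pos 1).le (by linarith [Real.exp_one_lt_d9]) K
  rw [div_le_iff₀ (by positivity)]
  calc R = ε / 2 * (2 * (R / ε)) := by field_simp
    _ ≤ ε / 2 * 4 ^ K := by gcongr

/-- One round of the contraction from `θ` to `θ'`: local coverage moves the error bound from `π_θ`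
to `π_θs`, the eigenvalue bound applies because the difference lies in `S`, and `d^(2/p-1) * d =
d^(2/p)` absorbs the norm change. -/
lemma Problem.lpNorm_sub_le_quarter {X A : Type*} [Fintype X] [Fintype A] {d : ℕ}
    {P : Problem X A d} {S : Submodule ℝ (Fin d → ℝ)} {p R κ c₀ lam ε N : ℝ}
    {θ θ' θs : Fin d → ℝ} (hp : 1 ≤ p) (hp₂ : p ≤ 2) (hd : 0 < d) (hR : 1 ≤ R) (hκ : 1 ≤ κ)
    (hε : 0 < ε) (hlam : 0 < lam) (hcov : P.CovLowerBound S θs lam)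
    (hgrow : P.CoverageGrowth p θs R κ) (hc₀ : 0 ≤ c₀)
    (hc₀A : c₀ * (Real.exp 1 * κ) ^ 2 ≤ 1 / 16)
    (hN : N = (d : ℝ) ^ (2 / p) / lam * max (R ^ 2 / ε ^ 2) (P.localCoverage p θs R))
    (hS : θ' - θs ∈ S) (hθ : lpNorm p (θ - θs) ≤ R)
    (h : P.covForm (P.policy θ) (θ' - θs) ≤ c₀ * R ^ 2 * d / N) :
    lpNorm p (θ' - θs) ≤ (ε + lpNorm p (θ - θs)) / 4 := by
  have hα := P.featureLipschitz_two hp hp₂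
  have hd' : (0 : ℝ) < d := by exact_mod_cast hd
  have hρ0 : 0 ≤ lpNorm p (θ - θs) := lpNorm_nonneg hp _
  have hCnn : 0 ≤ P.localCoverage p θs (lpNorm p (θ - θs)) := Problem.localCoverage_nonneg _ _
  have hCR : 0 ≤ P.localCoverage p θs R := Problem.localCoverage_nonneg _ _
  have h1 : lam * ((θ' - θs) ⬝ᵥ (θ' - θs))
      ≤ P.localCoverage p θs (lpNorm p (θ - θs)) * (c₀ * R ^ 2 * d / N) := by
    have e1 := hcov _ hS
    rw [P.dotProduct_featureCov_mulVec] at e1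
    exact e1.trans ((hα.covForm_le_local (by norm_num) le_rfl _).trans
      (mul_le_mul_of_nonneg_left h hCnn))
  have h2 : lpNorm p (θ' - θs) ^ 2 ≤ (d : ℝ) ^ (2 / p) *
      (P.localCoverage p θs (lpNorm p (θ - θs)) * (c₀ * R ^ 2 / N) / lam) := by
    refine (lpNorm_sq_le hp hp₂ _).trans ?_
    have e1 : (θ' - θs) ⬝ᵥ (θ' - θs)
        ≤ P.localCoverage p θs (lpNorm p (θ - θs)) * (c₀ * R ^ 2 * d / N) / lam := by
      rw [le_div_iff₀ hlam]; linarith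
    have e2 : (d : ℝ) ^ (2 / p) = (d : ℝ) ^ (2 / p - 1) * d := by
      rw [Real.rpow_sub_one (by positivity), div_mul_cancel₀ _ (by positivity)]
    refine (mul_le_mul_of_nonneg_left e1 (by positivity)).trans (le_of_eq ?_)
    rw [e2]; ring
  have h3 := hgrow.sqrt_le hp hp₂ hR hκ hρ0 hθ
  have hA : 0 < Real.exp 1 * κ := by positivity
  have hD : 0 < (d : ℝ) ^ (2 / p) := by positivity
  exact le_quarter_of_sq_le (by linarith) (Real.sqrt_nonneg _) hρ0 hε hA hCnn hD
    hlam hc₀A hc₀ h3 rfl (by rw [Real.sq_sqrt hCR, ← hN]; exact h2)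

lemma net_radius_bounds {h γ q R c₂ c₀ : ℝ} (hh0 : 0 ≤ h) (hh1 : h ≤ 1) (hγ : 0 ≤ γ)
    (hR : 1 ≤ R) (hq0 : 0 ≤ q) (hq : q ≤ c₀) (hγR : γ * R ≤ c₂)
    (hc : c₀ * (1 + c₂) ^ 2 ≤ 1 / 16) :
    h ^ 2 * γ * q / 16 ≤ R ∧ (h ^ 2 * γ * q / 16) ^ 2 ≤ q / 4 := by
  have hγc : γ ≤ c₂ := (le_mul_of_one_le_right hγ hR).trans hγR
  have hc₂ : 0 ≤ c₂ := hγ.trans hγc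
  have hh2 : h ^ 2 ≤ 1 := pow_le_one₀ hh0 hh1
  have h1 : γ * q ≤ c₀ * (1 + c₂) ^ 2 := by
    calc γ * q ≤ c₂ * c₀ := by gcongr
      _ ≤ (1 + c₂) ^ 2 * c₀ := mul_le_mul_of_nonneg_right (by nlinarith) (hq0.trans hq)
      _ = _ := mul_comm _ _
  have h2 : γ ^ 2 * q ≤ c₀ * (1 + c₂) ^ 2 := by
    calc γ ^ 2 * q ≤ c₂ ^ 2 * c₀ := by gcongr
      _ ≤ (1 + c₂) ^ 2 * c₀ := mul_le_mul_of_nonneg_right (by nlinarith) (hq0.trans hq)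
      _ = _ := mul_comm _ _
  constructor
  · have : h ^ 2 * (γ * q) ≤ 1 * 1 := by
      have : γ * q ≤ 1 := by linarith
      gcongr
    linarith
  · have e : (h ^ 2 * γ * q / 16) ^ 2 = (h ^ 2 * h ^ 2) * (γ ^ 2 * q) * q / 256 := by ring
    have h3 : (h ^ 2 * h ^ 2) * (γ ^ 2 * q) * q ≤ (1 * 1) * 1 * q := by
      have : γ ^ 2 * q ≤ 1 := by linarith
      gcongr
    rw [e]
    linarith

lemma exists_onPolicy_const {p : ℝ} (hp : 1 ≤ p) (hp₂ : p ≤ 2) {c₁ c₂ κ : ℝ} (hc₁ : 0 < c₁)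
    (hc₂ : c₁ ≤ c₂) (hκ : 1 ≤ κ) :
    ∃ B : ℝ, 0 < B ∧
      ∀ (X : Type*) (A : Type*) [Fintype X] [Fintype A] (d : ℕ) (P : Problem X A d)
        (S : Submodule ℝ (Fin d → ℝ)) (r : X → A → ℝ) (θs : Fin d → ℝ) (R lam : ℝ),
      S ≠ ⊥ → 2 ≤ R → c₁ / R ≤ P.γ → P.γ ≤ c₂ / R →
      θs ∈ paramSet p R S → P.target r = P.policy θs →
      0 < lam → P.CovLowerBound S θs lam → P.CoverageGrowth p θs R κ →
      ∀ ε δ : ℝ, 0 < ε → ε ≤ 1 → 0 < δ → δ < 1 →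
        ∀ n K : ℕ,
          B * Real.log (R / ε) ≤ K →
          B * ((d : ℝ) ^ (2 / p) / lam * max (R ^ 2 / ε ^ 2) (P.localCoverage p θs R))
            * Real.log (K / δ * ((d : ℝ) ^ (2 / p) / lam
                * max (R ^ 2 / ε ^ 2) (P.localCoverage p θs R))) ≤ n →
          P.OnPolicySucceeds p R S r θs ε δ n K := by
  have hc₂0 : 0 < c₂ := hc₁.trans_le hc₂
  -- Bounds the logits, since `4 γ R ≤ 4 c₂`.
  set M := 4 * c₂ with hM
  set h := sigmoidSlope M with hh
  have hpos : 0 < h := sigmoidSlope_pos M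
  have hle : h ≤ 1 := sigmoidSlope_le_one (by positivity)
  set A₀ := Real.exp 1 * κ with hA₀
  have hA₀1 : 1 ≤ A₀ := by
    have : 1 ≤ Real.exp 1 := Real.one_le_exp (by norm_num)
    nlinarith
  -- Meets two demands: `c₀ A₀² ≤ 1 / 16` for the contraction and `c₀ (1 + c₂)² ≤ 1 / 16` for the
  -- two conditions on the net radius.
  set c₀ := 1 / (16 * A₀ ^ 2 * (1 + c₂) ^ 2) with hc₀
  have hc₀pos : 0 < c₀ := by positivity
  have hc₀A : c₀ * A₀ ^ 2 ≤ 1 / 16 := by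
    rw [hc₀, div_mul_eq_mul_div, div_le_div_iff₀ (by positivity) (by norm_num)]
    have : A₀ ^ 2 ≤ A₀ ^ 2 * (1 + c₂) ^ 2 :=
      le_mul_of_one_le_right (by positivity) (one_le_pow₀ (by linarith))
    linarith
  have hc₀c : c₀ * (1 + c₂) ^ 2 ≤ 1 / 16 := by
    rw [hc₀, div_mul_eq_mul_div, div_le_div_iff₀ (by positivity) (by norm_num)]
    have : (1 + c₂) ^ 2 ≤ A₀ ^ 2 * (1 + c₂) ^ 2 :=
      le_mul_of_one_le_left (by positivity) (one_le_pow₀ hA₀1)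
    linarith
  set A₁ := 32 / (h ^ 2 * c₁ * c₀) + 3 with hA₁
  set A₂ := h ^ 2 * c₀ * c₁ ^ 2 / 16 with hA₂
  have hA₁1 : 1 ≤ A₁ := by
    have : 0 < 32 / (h ^ 2 * c₁ * c₀) := by positivity
    linarith
  have hA₂0 : 0 < A₂ := by positivity
  set B := 2 + (2 + Real.log A₁) / A₂ with hBdef
  have hlogA : 0 ≤ Real.log A₁ := Real.log_nonneg hA₁1
  have hB2 : 2 ≤ B := by
    have : 0 ≤ (2 + Real.log A₁) / A₂ := by positivity
    linarith
  have hBA : 2 + Real.log A₁ ≤ A₂ * B := by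
    rw [hBdef, mul_add, mul_div_cancel₀ _ hA₂0.ne']
    linarith
  rw [hA₁, hA₂] at hBA
  clear_value B A₁ A₂ c₀ h M
  refine ⟨B, by linarith, ?_⟩
  intro X A _ _ d P S r θs R lam hS hR hγ₁ hγ₂ hθs hr hlam hcov hgrow ε δ hε hε1 hδ hδ1 n K hK hn
  have hR0 : 0 < R := by linarith
  have hγ : 0 < P.γ := lt_of_lt_of_le (by positivity) hγ₁
  have hγR₁ : c₁ ≤ P.γ * R := (div_le_iff₀ hR0).1 hγ₁
  have hγR₂ : P.γ * R ≤ c₂ := (le_div_iff₀ hR0).1 hγ₂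
  have hd : 0 < d := by
    rcases Nat.eq_zero_or_pos d with rfl | h
    · exact absurd (Subsingleton.elim S ⊥) hS
    · exact h
  have hd' : (1 : ℝ) ≤ d := by exact_mod_cast hd
  set N := (d : ℝ) ^ (2 / p) / lam * max (R ^ 2 / ε ^ 2) (P.localCoverage p θs R) with hN
  have hNd : d * R ^ 2 ≤ N :=
    (mul_le_mul_of_nonneg_left (sq_le_sq_div hε hε1) (by linarith)).trans
      (effective_size_ge hp hp₂ hd hlam (Problem.lam_le_one hS hcov) hε)
  have hR4 : 2 ^ 2 ≤ R ^ 2 := pow_le_pow_left₀ (by norm_num) hR 2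
  have hN4 : 4 ≤ N := by
    have := le_mul_of_one_le_left (sq_nonneg R) hd'
    linarith
  have hN0 : 0 < N := by linarith
  have hKpos : 0 < K := by
    have h2 := log_two_le_log_div hR hε hε1
    have h3 : 0 < Real.log 2 := Real.log_pos (by norm_num)
    have : (0 : ℝ) < K := (mul_pos (by linarith) (h3.trans_le h2)).trans_le hK
    exact_mod_cast this
  have hK1 : (1 : ℝ) ≤ K := by exact_mod_cast hKpos
  set q := c₀ * R ^ 2 * d / N with hq
  have hq0 : 0 < q := by positivity
  have hqc : q ≤ c₀ := by
    rw [hq, div_le_iff₀ hN0, mul_assoc, mul_comm (R ^ 2)]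
    exact mul_le_mul_of_nonneg_left hNd hc₀pos.le
  obtain ⟨hρle, hρq⟩ := net_radius_bounds hpos.le hle hγ.le (by linarith) hq0.le hqc hγR₂ hc₀c
  intro sel hsel
  -- Invariant after `k` rounds. From `x ≤ ε / 2 + R / 4^k` one gets `(ε + x) / 4 ≤ 3 ε / 8 + R /
  -- 4^(k+1)`, and the bound by `R`, needed for the growth condition, persists because `ε ≤ R`.
  set s : ℕ → Set (Fin d → ℝ) := fun k =>
    {θ | lpNorm p (θ - θs) ≤ R ∧ lpNorm p (θ - θs) ≤ ε / 2 + R / 4 ^ k} with hs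
  have hfail := dpo_failure_le (n := n) (K := K) (B := B) hd hpos hc₁ hc₀pos hγ hR0 hγR₁ hN4
    hK1 hδ hδ1 hBA hn
  rw [← hq, hh] at hfail
  rw [hh] at hρle hρq
  have hinit : (0 : Fin d → ℝ) ∈ s 0 := by
    have : lpNorm p (0 - θs) ≤ R := by rw [zero_sub, lpNorm_neg hp]; exact hθs.2
    exact ⟨this, by rw [pow_zero, div_one]; linarith⟩
  have hstep : ∀ k, ∀ θ ∈ s k, ENNReal.ofReal (1 - δ / K) ≤
      (iid n (P.sampleLaw r (P.policy θ))).toOuterMeasure {D | sel k θ D ∈ s (k + 1)} := by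
    rintro k θ ⟨hθR, hθk⟩
    have hconc := P.dpoUpdate_concentration (M := M) hp hp₂ hd hγ hr hθs (by linarith) hq0 hρle
      hρq θ n (sel k θ) (hsel k θ)
    refine (ENNReal.ofReal_le_ofReal (by linarith)).trans (hconc.trans ?_)
    refine MeasureTheory.measure_mono fun D hD => ?_
    have h4 := P.lpNorm_sub_le_quarter hp hp₂ hd (by linarith) hκ hε hlam hcov hgrow hc₀pos.le
      hc₀A hN (S.sub_mem (hsel k θ D).1.1 hθs.1) hθR hD
    have h5 : R / 4 ^ (k + 1) = R / 4 ^ k / 4 := by rw [pow_succ, div_mul_eq_div_div]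
    exact ⟨by linarith, by rw [h5]; linarith⟩
  have hη : δ / K ≤ 1 := by rw [div_le_one (by linarith)]; linarith
  have hfin := P.onPolicyDPO_invariant sel s hη hinit hstep K
  rw [mul_div_cancel₀ _ (by positivity)] at hfin
  refine hfin.trans (MeasureTheory.measure_mono fun θ hθ => ?_)
  have := div_four_pow_le hR hε hε1 hB2 hK
  exact hθ.2.trans (by linarith)

/-- Rounding up costs at most `2 L` since `2 log 2 > 1`. As `K ≤ (B₀ + 2) L` and `L ≤ N`, the term
`log K` is absorbed by a multiple of `log (N / δ)`. -/
lemma exists_sample_sizes {B₀ L N δ : ℝ} (hB₀ : 0 < B₀) (hL : Real.log 2 ≤ L) (hLN : L ≤ N)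
    (hN : 4 ≤ N) (hδ : 0 < δ) (hδ1 : δ < 1) :
    B₀ * L ≤ ⌈B₀ * L⌉₊ ∧ (⌈B₀ * L⌉₊ : ℝ) ≤ (B₀ + 2) * L ∧
    (⌈B₀ * N * Real.log (⌈B₀ * L⌉₊ / δ * N)⌉₊ : ℝ)
      ≤ (B₀ * (2 + Real.log (B₀ + 2)) + 1) * N * Real.log (N / δ) := by
  have hlog2 := Real.log_two_gt_d9
  have hL0 : 0 < L := by linarith
  have hN0 : 0 < N := by linarith
  have hK : (⌈B₀ * L⌉₊ : ℝ) ≤ (B₀ + 2) * L := by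
    have := (Nat.ceil_lt_add_one (a := B₀ * L) (by positivity)).le
    linarith
  refine ⟨Nat.le_ceil _, hK, ?_⟩
  have hK0 : (1 : ℝ) ≤ ⌈B₀ * L⌉₊ := by
    have : 0 < ⌈B₀ * L⌉₊ := Nat.ceil_pos.2 (by positivity)
    exact_mod_cast this
  set K : ℝ := (⌈B₀ * L⌉₊ : ℝ)
  have hNδ : N ≤ N / δ := by rw [le_div_iff₀ hδ]; nlinarith
  have hℓ : 1 ≤ Real.log (N / δ) := by
    rw [Real.le_log_iff_exp_le (by positivity)]
    linarith [Real.exp_one_lt_d9]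
  have hlogB : 0 ≤ Real.log (B₀ + 2) := Real.log_nonneg (by linarith)
  have hKl : Real.log K ≤ Real.log (B₀ + 2) + Real.log (N / δ) := by
    rw [← Real.log_mul (by positivity) (by positivity)]
    refine Real.log_le_log (by linarith) (hK.trans ?_)
    gcongr
    linarith
  have hsplit : Real.log (K / δ * N) = Real.log K + Real.log (N / δ) := by
    rw [← Real.log_mul (by positivity) (by positivity)]
    congr 1; ring
  have hle : Real.log (K / δ * N) ≤ (2 + Real.log (B₀ + 2)) * Real.log (N / δ) := by
    rw [hsplit]; nlinarith
  have hnn : 0 ≤ Real.log (K / δ * N) := by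
    rw [hsplit]; linarith [Real.log_nonneg hK0]
  calc (⌈B₀ * N * Real.log (K / δ * N)⌉₊ : ℝ) ≤ B₀ * N * Real.log (K / δ * N) + 1 :=
        (Nat.ceil_lt_add_one (by positivity)).le
    _ ≤ B₀ * N * ((2 + Real.log (B₀ + 2)) * Real.log (N / δ)) + N * Real.log (N / δ) := by
        gcongr
        nlinarith
    _ = _ := by ring

theorem onPolicy_upper_bound {p : ℝ} (hp : 1 ≤ p) (hp₂ : p ≤ 2) {c₁ c₂ : ℝ} (hc₁ : 0 < c₁)
    (hc₂ : c₁ ≤ c₂) (κ : ℝ) (hκ : 1 ≤ κ) : ∃ B : ℝ, 0 < B ∧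
      ∀ (X : Type*) (A : Type*) [Fintype X] [Fintype A] (d : ℕ) (P : Problem X A d)
        (S : Submodule ℝ (Fin d → ℝ)) (r : X → A → ℝ) (θs : Fin d → ℝ) (R lam : ℝ),
      S ≠ ⊥ → 2 ≤ R → c₁ / R ≤ P.γ → P.γ ≤ c₂ / R →
      θs ∈ paramSet p R S → P.target r = P.policy θs →
      0 < lam → P.CovLowerBound S θs lam → P.CoverageGrowth p θs R κ →
      ∀ ε δ : ℝ, 0 < ε → ε ≤ 1 → 0 < δ → δ < 1 →
        (∀ n K : ℕ,
          B * Real.log (R / ε) ≤ K →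
          B * ((d : ℝ) ^ (2 / p) / lam * max (R ^ 2 / ε ^ 2) (P.localCoverage p θs R))
            * Real.log (K / δ * ((d : ℝ) ^ (2 / p) / lam
                * max (R ^ 2 / ε ^ 2) (P.localCoverage p θs R))) ≤ n →
          P.OnPolicySucceeds p R S r θs ε δ n K) ∧
        (∃ n K : ℕ,
          P.OnPolicySucceeds p R S r θs ε δ n K ∧
          (K : ℝ) ≤ B * Real.log (R / ε) ∧
          (n : ℝ) ≤ B * ((d : ℝ) ^ (2 / p) / lam
              * max (R ^ 2 / ε ^ 2) (P.localCoverage p θs R))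
            * Real.log ((d : ℝ) ^ (2 / p) / lam
              * max (R ^ 2 / ε ^ 2) (P.localCoverage p θs R) / δ) ∧
          (n : ℝ) * K ≤ B * ((d : ℝ) ^ (2 / p) / lam
              * max (R ^ 2 / ε ^ 2 * Real.log (R / ε))
                  (Real.log (R / ε) * P.localCoverage p θs R))
            * Real.log ((d : ℝ) ^ (2 / p) / lam
              * max (R ^ 2 / ε ^ 2) (P.localCoverage p θs R) / δ)) := by
  obtain ⟨B₀, hB₀, H⟩ := exists_onPolicy_const hp hp₂ hc₁ hc₂ hκ
  set B₁ := B₀ * (2 + Real.log (B₀ + 2)) + 1 with hB₁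
  have hlogB : 0 ≤ Real.log (B₀ + 2) := Real.log_nonneg (by linarith)
  have hB₁1 : 1 ≤ B₁ := by
    have : 0 ≤ B₀ * (2 + Real.log (B₀ + 2)) := by positivity
    linarith
  have hBB : B₀ + 2 ≤ (B₀ + 2) * B₁ := le_mul_of_one_le_right (by linarith) hB₁1
  have hBB' : B₁ ≤ (B₀ + 2) * B₁ := le_mul_of_one_le_left (by linarith) (by linarith)
  clear_value B₁
  -- The bounds for `K` and `n` have constants `B₀ + 2` and `B₁`; their product serves for `n K` and
  -- dominates each of them.
  refine ⟨(B₀ + 2) * B₁, by positivity, ?_⟩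
  intro X A _ _ d P S r θs R lam hS hR hγ₁ hγ₂ hθs hr hlam hcov hgrow ε δ hε hε1 hδ hδ1
  have H' := H X A d P S r θs R lam hS hR hγ₁ hγ₂ hθs hr hlam hcov hgrow ε δ hε hε1 hδ hδ1
  have hd : 0 < d := by
    rcases Nat.eq_zero_or_pos d with rfl | h
    · exact absurd (Subsingleton.elim S ⊥) hS
    · exact h
  have hd' : (1 : ℝ) ≤ d := by exact_mod_cast hd
  have hNd := effective_size_ge (R := R) (c := P.localCoverage p θs R) hp hp₂ hd hlam
    (Problem.lam_le_one hS hcov) hε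
  set N := (d : ℝ) ^ (2 / p) / lam * max (R ^ 2 / ε ^ 2) (P.localCoverage p θs R) with hN
  have hL := log_two_le_log_div hR hε hε1
  have hRε : 2 ≤ R / ε := by rw [le_div_iff₀ hε]; linarith
  have hNR : (R / ε) ^ 2 ≤ N := by
    rw [div_pow]
    exact (le_mul_of_one_le_left (by positivity) hd').trans hNd
  have hN4 : 4 ≤ N := by nlinarith
  have hLN : Real.log (R / ε) ≤ N := by
    have := Real.log_le_sub_one_of_pos (show 0 < R / ε by linarith)
    nlinarith
  have hL0 : 0 < Real.log (R / ε) := (Real.log_pos (by norm_num)).trans_le hL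
  have hmax : (d : ℝ) ^ (2 / p) / lam * max (R ^ 2 / ε ^ 2 * Real.log (R / ε))
      (Real.log (R / ε) * P.localCoverage p θs R) = N * Real.log (R / ε) := by
    rw [mul_comm (Real.log (R / ε)), ← max_mul_of_nonneg _ _ hL0.le, hN, mul_assoc]
  obtain ⟨hK₁, hK₂, hn⟩ := exists_sample_sizes hB₀ hL hLN hN4 hδ hδ1
  rw [← hB₁] at hn
  have hℓ : 0 ≤ Real.log (N / δ) := Real.log_nonneg (by rw [le_div_iff₀ hδ]; linarith)
  constructor
  · intro n K hK hn'
    have hB₀le : B₀ ≤ (B₀ + 2) * B₁ := by linarith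
    have hK0 : (0 : ℝ) < K := lt_of_lt_of_le (by positivity) hK
    have hK1 : (1 : ℝ) ≤ K := by
      have : 0 < K := by exact_mod_cast hK0
      exact_mod_cast this
    have hlog : 0 ≤ Real.log (K / δ * N) := by
      refine Real.log_nonneg ?_
      have : 1 ≤ K / δ := by rw [le_div_iff₀ hδ]; linarith
      nlinarith
    refine H' n K (le_trans (by gcongr) hK) (le_trans ?_ hn')
    gcongr
  · refine ⟨⌈B₀ * N * Real.log (⌈B₀ * Real.log (R / ε)⌉₊ / δ * N)⌉₊, ⌈B₀ * Real.log (R / ε)⌉₊,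
      H' _ _ hK₁ (Nat.le_ceil _), hK₂.trans (by gcongr), hn.trans (by gcongr), ?_⟩
    rw [hmax]
    calc _ ≤ B₁ * N * Real.log (N / δ) * ((B₀ + 2) * Real.log (R / ε)) := by gcongr
      _ = _ := by ring

end OnPolicy

/-! ### Hard bandit instances -/

section Bandit

variable {d : ℕ} {π₀ : PMF (Fin d)} {γ : ℝ}

lemma armedBandit_dotProduct (v : Fin d → ℝ) (x : Unit) (i : Fin d) :
    v ⬝ᵥ (armedBandit d π₀ γ).φ x i = v i := by
  simp [armedBandit]

lemma armedBandit_featureLipschitz {p : ℝ} (hp : 1 ≤ p) :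
    (armedBandit d π₀ γ).FeatureLipschitz p (2 ^ (1 - 1 / p)) := fun w x a b => by
  rw [armedBandit_dotProduct, armedBandit_dotProduct]
  exact sub_apply_le hp w a b

lemma armedBandit_D (x : Unit) : ((armedBandit d π₀ γ).D x).toReal = 1 := by
  simp [armedBandit]

lemma armedBandit_target (hγ : γ ≠ 0) (θ : Fin d → ℝ) :
    (armedBandit d π₀ γ).target ((armedBandit d π₀ γ).reward θ)
      = (armedBandit d π₀ γ).policy θ := by
  have h : (armedBandit d π₀ γ).γ = γ := rfl
  simp only [Problem.target, Problem.policy, Problem.reward, h, mul_div_cancel_left₀ _ hγ]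

/-- For a vector with zero sum, centring can only increase the Euclidean norm: the cross term
vanishes. -/
lemma armedBandit_covForm_ge {π : Unit → PMF (Fin d)} {c : ℝ} (hc : 0 ≤ c)
    (h : ∀ i, c ≤ (π () i).toReal) {v : Fin d → ℝ} (hv : ∑ i, v i = 0) :
    c * (v ⬝ᵥ v) ≤ (armedBandit d π₀ γ).covForm π v := by
  simp only [Problem.covForm, Finset.univ_unique, Finset.sum_singleton, armedBandit_D, one_mul,
    armedBandit_dotProduct]
  set m := v ⬝ᵥ (armedBandit d π₀ γ).featureMean π default
  calc c * (v ⬝ᵥ v) ≤ c * ∑ i, (v i - m) ^ 2 := by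
        refine mul_le_mul_of_nonneg_left ?_ hc
        have e : ∀ i, (v i - m) ^ 2 = v i * v i - 2 * m * v i + m ^ 2 := fun i => by ring
        simp only [e, Finset.sum_add_distrib, Finset.sum_sub_distrib, ← Finset.mul_sum, hv]
        have : 0 ≤ ∑ _i : Fin d, m ^ 2 := Finset.sum_nonneg fun _ _ => sq_nonneg m
        simp only [dotProduct]
        linarith
    _ ≤ _ := by
        rw [Finset.mul_sum]
        exact Finset.sum_le_sum fun i _ => mul_le_mul_of_nonneg_right (h i) (sq_nonneg _)

/-- The parameter `t (e_{i₀} - e_{i₁})`. -/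
def hardCenter (i₀ i₁ : Fin d) (t : ℝ) : Fin d → ℝ :=
  fun i => (if i = i₀ then t else 0) - if i = i₁ then t else 0

/-- The projection of `e_{i₀}` onto `𝟏^⊥`. -/
def hardDir (i₀ : Fin d) : Fin d → ℝ := fun i => (if i = i₀ then 1 else 0) - 1 / d

/-- The base policy proportional to `exp (-t (e_{i₀} - e_{i₁}))`. -/
def hardBase (i₀ i₁ : Fin d) (t : ℝ) : PMF (Fin d) :=
  have : Nonempty (Fin d) := ⟨i₀⟩
  tilt (fun _ : Unit => PMF.uniformOfFintype (Fin d)) (fun _ i => -hardCenter i₀ i₁ t i) ()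

/-- The parameter `t (e_{i₀} - e_{i₁}) - s (e_{i₀} - 𝟏 / d)`. -/
def hardParam (i₀ i₁ : Fin d) (t s : ℝ) : Fin d → ℝ := hardCenter i₀ i₁ t - s • hardDir i₀

variable {i₀ i₁ : Fin d} {t s : ℝ}

/-! ### Base and target policies of the hard instances. -/

lemma hardBase_toReal (i : Fin d) : (hardBase i₀ i₁ t i).toReal
    = Real.exp (-hardCenter i₀ i₁ t i) / ∑ j, Real.exp (-hardCenter i₀ i₁ t j) := by
  have : Nonempty (Fin d) := ⟨i₀⟩
  have hd : (0 : ℝ) < d := by exact_mod_cast (i₀.pos)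
  rw [hardBase, tilt_toReal]
  simp only [PMF.uniformOfFintype_apply, Fintype.card_fin, ← Finset.mul_sum]
  rw [mul_div_mul_left]
  simp [hd.ne']

lemma hardBandit_policy (θ : Fin d → ℝ) (i : Fin d) :
    ((armedBandit d (hardBase i₀ i₁ t) γ).policy θ () i).toReal
      = Real.exp (θ i - hardCenter i₀ i₁ t i) / ∑ j, Real.exp (θ j - hardCenter i₀ i₁ t j) := by
  rw [Problem.policy, tilt_toReal]
  simp only [armedBandit_dotProduct]
  have hW : 0 < ∑ j, Real.exp (-hardCenter i₀ i₁ t j) :=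
    Finset.sum_pos (fun j _ => Real.exp_pos _) ⟨i₀, Finset.mem_univ _⟩
  have e : ∀ j, ((armedBandit d (hardBase i₀ i₁ t) γ).π₀ () j).toReal * Real.exp (θ j)
      = (∑ j, Real.exp (-hardCenter i₀ i₁ t j))⁻¹ * Real.exp (θ j - hardCenter i₀ i₁ t j) := by
    intro j
    change (hardBase i₀ i₁ t j).toReal * _ = _
    rw [hardBase_toReal, sub_eq_add_neg, Real.exp_add]
    ring
  simp only [e, ← Finset.mul_sum]
  rw [mul_div_mul_left _ _ (inv_ne_zero hW.ne')]

/-- The normalizer is at least the weight `exp t` of arm `i₁`, against the weight `exp (-t)` of arm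
`i₀`. -/
lemma hardBase_le (h : i₀ ≠ i₁) : (hardBase i₀ i₁ t i₀).toReal ≤ Real.exp (-(2 * t)) := by
  rw [hardBase_toReal, div_le_iff₀
    (Finset.sum_pos (fun j _ => Real.exp_pos _) ⟨i₀, Finset.mem_univ _⟩)]
  have h1 := Finset.single_le_sum (f := fun j => Real.exp (-hardCenter i₀ i₁ t j))
    (fun j _ => (Real.exp_pos _).le) (Finset.mem_univ i₁)
  refine le_trans (le_of_eq ?_) (mul_le_mul_of_nonneg_left h1 (Real.exp_pos _).le)
  rw [← Real.exp_add]
  simp only [hardCenter, h, h.symm, if_true, if_false]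
  ring_nf

lemma sum_hardDir (i₀ : Fin d) : ∑ i, hardDir i₀ i = 0 := by
  have hd : (0 : ℝ) < d := by exact_mod_cast (i₀.pos)
  simp [hardDir, Finset.sum_sub_distrib, hd.ne']

lemma sum_hardCenter (i₀ i₁ : Fin d) (t : ℝ) : ∑ i, hardCenter i₀ i₁ t i = 0 := by
  simp [hardCenter, Finset.sum_sub_distrib]

lemma hardParam_mem_sumZero : hardParam i₀ i₁ t s ∈ sumZero d :=
  (sumZero d).sub_mem (sum_hardCenter i₀ i₁ t) ((sumZero d).smul_mem s (sum_hardDir i₀))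

lemma lpNorm_hardDir_le {p : ℝ} (hp : 1 ≤ p) (i₀ : Fin d) : lpNorm p (hardDir i₀) ≤ 2 := by
  have hd : (0 : ℝ) < d := by exact_mod_cast (i₀.pos)
  refine (lpNorm_le_sum hp _).trans ?_
  calc ∑ i, |hardDir i₀ i| ≤ ∑ i, ((if i = i₀ then 1 else 0) + 1 / (d : ℝ)) := by
        refine Finset.sum_le_sum fun i _ => ?_
        have h1 : |(if i = i₀ then (1 : ℝ) else 0)| = if i = i₀ then 1 else 0 := by
          split_ifs <;> simp
        have h2 : |1 / (d : ℝ)| = 1 / d := abs_of_pos (by positivity)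
        calc |hardDir i₀ i| ≤ |(if i = i₀ then (1 : ℝ) else 0)| + |1 / (d : ℝ)| := abs_sub _ _
          _ = _ := by rw [h1, h2]
    _ = 2 := by simp [Finset.sum_add_distrib, hd.ne']; norm_num

lemma hardDir_self_ge (hd : 2 ≤ d) (i₀ : Fin d) : 1 / 2 ≤ hardDir i₀ i₀ := by
  have hd' : (2 : ℝ) ≤ d := by exact_mod_cast hd
  have : 1 / (d : ℝ) ≤ 1 / 2 := by gcongr
  simp only [hardDir, if_true]
  linarith

lemma half_le_lpNorm_hardDir {p : ℝ} (hp : 1 ≤ p) (hd : 2 ≤ d) (i₀ : Fin d) :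
    1 / 2 ≤ lpNorm p (hardDir i₀) :=
  (hardDir_self_ge hd i₀).trans ((le_abs_self _).trans (abs_apply_le_lpNorm hp _ i₀))

lemma quarter_le_hardDir_dotProduct (hd : 2 ≤ d) (i₀ : Fin d) :
    1 / 4 ≤ hardDir i₀ ⬝ᵥ hardDir i₀ := by
  have h := Finset.single_le_sum (f := fun i => hardDir i₀ i * hardDir i₀ i)
    (fun i _ => mul_self_nonneg _) (Finset.mem_univ i₀)
  have := hardDir_self_ge hd i₀
  simp only [dotProduct]
  nlinarith

lemma abs_hardDir_le (hd : 2 ≤ d) (i₀ i : Fin d) : |hardDir i₀ i| ≤ 1 := by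
  have hd' : (2 : ℝ) ≤ d := by exact_mod_cast hd
  have h1 : 1 / (d : ℝ) ≤ 1 / 2 := by gcongr
  have h2 : 0 < 1 / (d : ℝ) := by positivity
  rw [hardDir, abs_le]
  split_ifs <;> constructor <;> linarith

lemma sumZero_ne_bot (hd : 2 ≤ d) : sumZero d ≠ ⊥ := by
  intro h
  have h1 : hardDir (⟨0, by omega⟩ : Fin d) ∈ sumZero d := sum_hardDir _
  rw [h, Submodule.mem_bot] at h1
  have := hardDir_self_ge hd ⟨0, by omega⟩
  rw [h1] at this
  norm_num at this

lemma lpNorm_hardCenter {p : ℝ} (hp : 1 ≤ p) (h : i₀ ≠ i₁) (ht : 0 ≤ t) :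
    lpNorm p (hardCenter i₀ i₁ t) = 2 ^ (1 / p) * t := by
  have hp0 : p ≠ 0 := by linarith
  rw [lpNorm_eq hp]
  have e : ∀ i, |hardCenter i₀ i₁ t i| ^ p
      = (if i = i₀ then t ^ p else 0) + if i = i₁ then t ^ p else 0 := by
    intro i
    rw [hardCenter]
    by_cases h0 : i = i₀
    · subst h0; simp [h, abs_of_nonneg ht]
    · by_cases h1 : i = i₁
      · subst h1; simp [h0, abs_of_nonneg ht]
      · simp [h0, h1, Real.zero_rpow hp0]
  simp only [e, Finset.sum_add_distrib, Finset.sum_ite_eq', Finset.mem_univ, if_true]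
  rw [← two_mul, Real.mul_rpow (by norm_num) (by positivity), ← Real.rpow_mul ht, mul_one_div,
    div_self hp0, Real.rpow_one]

lemma lpNorm_hardParam_le {p R : ℝ} (hp : 1 ≤ p) (h : i₀ ≠ i₁) (ht : 0 ≤ t)
    (htR : 2 ^ (1 / p) * t + 2 ≤ R) (hs : 0 ≤ s) (hs1 : s ≤ 1) :
    lpNorm p (hardParam i₀ i₁ t s) ≤ R := by
  have h1 := lpNorm_add_le hp (hardCenter i₀ i₁ t) (-(s • hardDir i₀))
  rw [lpNorm_neg hp, lpNorm_smul hp, lpNorm_hardCenter hp h ht, abs_of_nonneg hs,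
    ← sub_eq_add_neg] at h1
  have h2 := lpNorm_hardDir_le hp i₀
  have h3 := lpNorm_nonneg hp (hardDir i₀)
  rw [hardParam]
  nlinarith

/-- The base weights cancel `hardCenter`, leaving a uniform policy tilted by exponents in `[-1, 1]`:
one factor `e` is lost in the weight and one in the normalizer. -/
lemma hardPolicy_ge (hd : 2 ≤ d) (hs : 0 ≤ s) (hs1 : s ≤ 1) (i : Fin d) :
    Real.exp (-2) / d
      ≤ ((armedBandit d (hardBase i₀ i₁ t) γ).policy (hardParam i₀ i₁ t s) () i).toReal := by
  have hd' : (0 : ℝ) < d := by exact_mod_cast (by omega : 0 < d)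
  rw [hardBandit_policy]
  have e : ∀ j, hardParam i₀ i₁ t s j - hardCenter i₀ i₁ t j = -(s * hardDir i₀ j) := fun j => by
    simp [hardParam]
  have hb : ∀ j, |s * hardDir i₀ j| ≤ 1 := fun j => by
    rw [abs_mul, abs_of_nonneg hs]
    have := abs_hardDir_le hd i₀ j
    have := abs_nonneg (hardDir i₀ j)
    nlinarith
  simp only [e]
  rw [div_le_div_iff₀ hd' (Finset.sum_pos (fun j _ => Real.exp_pos _) ⟨i₀, Finset.mem_univ _⟩)]
  calc Real.exp (-2) * ∑ j, Real.exp (-(s * hardDir i₀ j))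
      ≤ Real.exp (-2) * ∑ _j : Fin d, Real.exp 1 := by
        gcongr with j
        linarith [(abs_le.1 (hb j)).1]
    _ = Real.exp (-1) * d := by
        rw [Finset.sum_const, Finset.card_univ, Fintype.card_fin, nsmul_eq_mul, mul_left_comm,
          ← Real.exp_add]
        norm_num [mul_comm]
    _ ≤ _ := by
        gcongr
        exact (abs_le.1 (hb i)).2

lemma hardBandit_covForm_ge (hd : 2 ≤ d) (hs : 0 ≤ s) (hs1 : s ≤ 1) {v : Fin d → ℝ}
    (hv : ∑ i, v i = 0) : Real.exp (-2) / d * (v ⬝ᵥ v)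
      ≤ (armedBandit d (hardBase i₀ i₁ t) γ).covForm
        ((armedBandit d (hardBase i₀ i₁ t) γ).policy (hardParam i₀ i₁ t s)) v :=
  armedBandit_covForm_ge (by positivity) (hardPolicy_ge hd hs hs1) hv

/-- Centring at `-1 / d` annihilates every arm except `i₀`, so the form is at most the base
probability of `i₀`. -/
lemma hardBandit_covForm_zero_le (h : i₀ ≠ i₁) : (armedBandit d (hardBase i₀ i₁ t) γ).covForm
    ((armedBandit d (hardBase i₀ i₁ t) γ).policy 0) (hardDir i₀) ≤ Real.exp (-(2 * t)) := by
  refine (Problem.covForm_le_center _ _ _ fun _ => -(1 / d)).trans ?_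
  simp only [Finset.univ_unique, Finset.sum_singleton, armedBandit_D, one_mul,
    armedBandit_dotProduct]
  rw [Finset.sum_eq_single i₀]
  · have e : hardDir i₀ i₀ - -(1 / d) = 1 := by simp [hardDir]
    rw [e, one_pow, mul_one]
    refine le_trans (le_of_eq ?_) (hardBase_le (t := t) h)
    rw [hardBase_toReal]
    change ((armedBandit d (hardBase i₀ i₁ t) γ).policy 0 () i₀).toReal = _
    rw [hardBandit_policy]
    simp
  · intro j _ hj
    simp [hardDir, hj]
  · simp

/-- The local coverage of the hard instance is exponentially large. -/
lemma hardBandit_localCoverage_ge {p R : ℝ} (hp : 1 ≤ p) (hd : 2 ≤ d) (h : i₀ ≠ i₁)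
    (ht : 0 ≤ t) (htR : 2 ^ (1 / p) * t + 2 ≤ R) (hs : 0 ≤ s) (hs1 : s ≤ 1) :
    Real.exp (-2) / (4 * d) * Real.exp (2 * t)
      ≤ (armedBandit d (hardBase i₀ i₁ t) γ).localCoverage p (hardParam i₀ i₁ t s) R := by
  have hα := armedBandit_featureLipschitz (d := d) (π₀ := hardBase i₀ i₁ t) (γ := γ) hp
  -- The base policy is `π_0`, and `0` is within `R` of the true parameter; it is the badly covering
  -- policy.
  have h1 := hα.covForm_le_local (by positivity) (θ := 0) (θs := hardParam i₀ i₁ t s) (r := R)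
    (by rw [zero_sub, lpNorm_neg hp]; exact lpNorm_hardParam_le hp h ht htR hs hs1) (hardDir i₀)
  have h2 := hardBandit_covForm_ge (i₀ := i₀) (i₁ := i₁) (t := t) (γ := γ) hd hs hs1
    (sum_hardDir i₀)
  have h3 := hardBandit_covForm_zero_le (t := t) (γ := γ) h
  have h4 := quarter_le_hardDir_dotProduct hd i₀
  set C := (armedBandit d (hardBase i₀ i₁ t) γ).localCoverage p (hardParam i₀ i₁ t s) R
  have hC : 0 ≤ C := Problem.localCoverage_nonneg _ _
  have h5 : Real.exp (-2) / d * (1 / 4) ≤ C * Real.exp (-(2 * t)) :=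
    (mul_le_mul_of_nonneg_left h4 (by positivity)).trans
      (h2.trans (h1.trans (mul_le_mul_of_nonneg_left h3 hC)))
  calc Real.exp (-2) / (4 * d) * Real.exp (2 * t)
      = Real.exp (-2) / d * (1 / 4) * Real.exp (2 * t) := by ring
    _ ≤ C * Real.exp (-(2 * t)) * Real.exp (2 * t) := by gcongr
    _ = C := by rw [mul_assoc, ← Real.exp_add]; simp

/-- If the coverage at radius `R` is large enough, the coverage growth condition holds. -/
lemma Problem.FeatureLipschitz.coverageGrowth {X A : Type*} [Fintype X] [Fintype A] {d : ℕ}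
    {P : Problem X A d} {p α R : ℝ} {θs v : Fin d → ℝ} (hα : P.FeatureLipschitz p α)
    (hα0 : 0 ≤ α) (hα2 : α ≤ 2) (hp : 1 ≤ p) (hv : 0 < P.covForm (P.policy θs) v) (hR : 0 < R)
    (hαR : 4 ≤ α * R)
    (hbig : R ^ 2 * Real.exp (α * R / 2) ≤ 4 * P.localCoverage p θs R) :
    P.CoverageGrowth p θs R 4 := by
  right
  set C := P.localCoverage p θs with hC
  -- The sublevel set is upward closed in `[0, R]`, hence an interval.
  have hup : ∀ r r', 0 ≤ r → r ≤ r' → r' ≤ R → C r * R ^ 2 ≤ 4 * C R * r ^ 2 →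
      C r' * R ^ 2 ≤ 4 * C R * r' ^ 2 := by
    intro r r' hr hrr hr'R h
    have h1 : 1 ≤ C r := hα.one_le_localCoverage hα0 hp hv hr
    have hCR : 0 ≤ C R := Problem.localCoverage_nonneg _ _
    have hr' : 0 ≤ r' := hr.trans hrr
    -- Radii above `R / 2`: monotonicity suffices because `κ = 4`. Radii in `[1, R / 2]`: the
    -- exponential bound at `R / 2` is covered by `hbig`. Radii below `1`: the log-Lipschitz bound
    -- applies, since `exp (2 r) / r²` decreases on `(0, 1]`.
    rcases le_total (R / 2) r' with h2 | h2
    · have h3 : C r' ≤ C R := hα.localCoverage_mono hα0 hp θs hr' hr'R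
      have h4 : R ^ 2 ≤ 4 * r' ^ 2 := by nlinarith
      calc C r' * R ^ 2 ≤ C R * (4 * r' ^ 2) := by gcongr
        _ = _ := by ring
    rcases le_total 1 r' with h3 | h3
    · have h4 : C r' ≤ Real.exp (α * R / 2) := by
        refine (hα.localCoverage_le_exp hα0 hp θs hr').trans (Real.exp_le_exp.2 ?_)
        nlinarith
      calc C r' * R ^ 2 ≤ Real.exp (α * R / 2) * R ^ 2 := by gcongr
        _ ≤ 4 * C R * 1 := by linarith
        _ ≤ 4 * C R * r' ^ 2 := by
          have : 1 ≤ r' ^ 2 := one_le_pow₀ h3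
          gcongr
    -- Radius `0` violates the inequality, as the coverage there is at least one.
    · have hr0 : 0 < r := by
        refine hr.lt_of_ne' fun h0 => ?_
        rw [h0] at h h1
        nlinarith [sq_pos_of_pos hR]
      have h4 : C r' ≤ C r * Real.exp (α * (r' - r)) :=
        hα.localCoverage_le_mul_exp hα0 hp hv hr0 hrr
      have h5 : r * Real.exp (r' - r) ≤ r' := by
        have e1 := Real.add_one_le_exp (-(r' - r))
        have e2 : r ≤ r' * Real.exp (-(r' - r)) := by nlinarith
        calc r * Real.exp (r' - r) ≤ r' * Real.exp (-(r' - r)) * Real.exp (r' - r) := by gcongr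
          _ = r' := by rw [mul_assoc, ← Real.exp_add]; simp
      have h6 : r ^ 2 * Real.exp (α * (r' - r)) ≤ r' ^ 2 := by
        calc r ^ 2 * Real.exp (α * (r' - r)) ≤ r ^ 2 * Real.exp (2 * (r' - r)) := by
              gcongr
          _ = (r * Real.exp (r' - r)) ^ 2 := by
              rw [mul_pow, ← Real.exp_nat_mul]; norm_num
          _ ≤ r' ^ 2 := by gcongr
      calc C r' * R ^ 2 ≤ C r * Real.exp (α * (r' - r)) * R ^ 2 := by gcongr
        _ = C r * R ^ 2 * Real.exp (α * (r' - r)) := by ring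
        _ ≤ 4 * C R * r ^ 2 * Real.exp (α * (r' - r)) := by gcongr
        _ = 4 * C R * (r ^ 2 * Real.exp (α * (r' - r))) := by ring
        _ ≤ 4 * C R * r' ^ 2 := by gcongr
  constructor
  · refine ⟨fun r hr r' hr' z hz => ?_⟩
    have hzR : z ≤ R := hz.2.trans hr'.1.2
    exact ⟨⟨hr.1.1.trans hz.1, hzR⟩, hup r z hr.1.1 hz.1 hzR hr.2⟩
  · refine Real.le_sqrt_of_sq_le (le_trans ?_ hbig)
    rw [mul_pow, mul_comm, ← Real.exp_nat_mul]
    gcongr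
    push_cast
    linarith

end Bandit

/-! ### The offline lower bound -/

section Offline

variable {Z : Type*} [Fintype Z]

lemma sum_iid_toReal (n : ℕ) (q : PMF Z) : ∑ D, (iid n q D).toReal = 1 := sum_toReal _

/-- Two-point lower bound through the chi-square divergence. -/
lemma log_two_le_of_test {n : ℕ} {q₀ q₁ : PMF Z} {x : ℝ}
    (hac : ∀ z, (q₁ z).toReal = 0 → (q₀ z).toReal = 0)
    (hx : ∑ z, ((q₀ z).toReal - (q₁ z).toReal) ^ 2 / (q₁ z).toReal ≤ x)
    (s : Finset (Fin n → Z)) (h₀ : 3 / 4 ≤ ∑ D ∈ s, (iid n q₀ D).toReal)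
    (h₁ : ∑ D ∈ s, (iid n q₁ D).toReal ≤ 1 / 4) : Real.log 2 ≤ n * x := by
  have hac' : ∀ D, (iid n q₁ D).toReal = 0 → (iid n q₀ D).toReal = 0 := by
    intro D hD
    rw [iid_toReal, Finset.prod_eq_zero_iff] at hD ⊢
    obtain ⟨i, hi, h⟩ := hD
    exact ⟨i, hi, hac _ h⟩
  -- Absolute continuity makes this valid for `b = 0` too, where division returns `0`.
  have expand : ∀ a b : ℝ, (b = 0 → a = 0) → (a - b) ^ 2 / b = a ^ 2 / b - 2 * a + b := by
    intro a b hab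
    by_cases hb : b = 0
    · simp [hb, hab hb]
    · field_simp
      ring
  have hsum : ∑ z, (q₀ z).toReal ^ 2 / (q₁ z).toReal ≤ Real.exp x := by
    have e : ∑ z, ((q₀ z).toReal - (q₁ z).toReal) ^ 2 / (q₁ z).toReal
        = ∑ z, (q₀ z).toReal ^ 2 / (q₁ z).toReal - 1 := by
      simp only [expand _ _ (hac _), Finset.sum_add_distrib, Finset.sum_sub_distrib,
        ← Finset.mul_sum, sum_toReal]
      ring
    have := Real.add_one_le_exp x
    linarith
  -- The second moment of the likelihood ratio is multiplicative over independent samples.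
  have hprod : ∑ D, (iid n q₀ D).toReal ^ 2 / (iid n q₁ D).toReal ≤ Real.exp (n * x) := by
    have e : ∀ D, (iid n q₀ D).toReal ^ 2 / (iid n q₁ D).toReal
        = ∏ i, (q₀ (D i)).toReal ^ 2 / (q₁ (D i)).toReal := fun D => by
      rw [iid_toReal, iid_toReal, ← Finset.prod_pow, Finset.prod_div_distrib]
    simp only [e]
    rw [sum_prod_apply n fun z => (q₀ z).toReal ^ 2 / (q₁ z).toReal, Real.exp_nat_mul]
    exact pow_le_pow_left₀ (Finset.sum_nonneg fun z _ => by positivity) hsum n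
  have hchi : ∑ D ∈ s, ((iid n q₀ D).toReal - (iid n q₁ D).toReal) ^ 2 / (iid n q₁ D).toReal
      ≤ Real.exp (n * x) - 1 := by
    calc _ ≤ ∑ D, ((iid n q₀ D).toReal - (iid n q₁ D).toReal) ^ 2 / (iid n q₁ D).toReal :=
          Finset.sum_le_sum_of_subset_of_nonneg (Finset.subset_univ s)
            fun D _ _ => by positivity
      _ ≤ _ := by
        simp only [expand _ _ (hac' _), Finset.sum_add_distrib, Finset.sum_sub_distrib,
          ← Finset.mul_sum, sum_iid_toReal]
        linarith
  -- Cauchy-Schwarz bounds the squared difference of the two probabilities of `s` by chi-square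
  -- times the second one. With the gap `1 / 2` this forces `exp (n x) ≥ 2`.
  have hcs := Finset.sum_sq_le_sum_mul_sum_of_sq_le_mul s
    (r := fun D => (iid n q₀ D).toReal - (iid n q₁ D).toReal)
    (f := fun D => ((iid n q₀ D).toReal - (iid n q₁ D).toReal) ^ 2 / (iid n q₁ D).toReal)
    (g := fun D => (iid n q₁ D).toReal)
    (fun D _ => by positivity) (fun D _ => by positivity) (fun D _ => by
      by_cases h : (iid n q₁ D).toReal = 0
      · simp [h, hac' D h]
      · exact le_of_eq (by field_simp))
  rw [Finset.sum_sub_distrib] at hcs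
  have hnn : 0 ≤ ∑ D ∈ s, (iid n q₁ D).toReal := Finset.sum_nonneg fun D _ => by positivity
  have hχ : 0 ≤ Real.exp (n * x) - 1 := le_trans (Finset.sum_nonneg fun D _ => by positivity) hchi
  have h2 : (1 / 2 : ℝ) ^ 2 ≤ (Real.exp (n * x) - 1) * (1 / 4) := by
    refine le_trans (pow_le_pow_left₀ (by norm_num) (by linarith) 2) (hcs.trans ?_)
    gcongr
  rw [Real.log_le_iff_le_exp (by norm_num)]
  linarith

lemma abs_sigmoid_sub_le (u v : ℝ) : |Real.sigmoid u - Real.sigmoid v| ≤ |u - v| := by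
  have key : ∀ u v, Real.sigmoid u - Real.sigmoid v ≤ |u - v| := by
    intro u v
    have h1 := sigmoid_le_mul_exp u v
    have h2 := Real.add_one_le_exp (-|u - v|)
    have h3 : Real.sigmoid u * Real.exp (-|u - v|) ≤ Real.sigmoid v := by
      calc _ ≤ Real.sigmoid v * Real.exp |u - v| * Real.exp (-|u - v|) := by gcongr
        _ = _ := by rw [mul_assoc, ← Real.exp_add]; simp
    have h4 := Real.sigmoid_le_one u
    have h5 := Real.sigmoid_nonneg u
    nlinarith [abs_nonneg (u - v)]
  rw [abs_le]
  have h1 := key u v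
  have h2 := key v u
  rw [abs_sub_comm] at h2
  constructor <;> linarith

/-- The factor 2 counts the two orders in which the pair can be drawn; it is also correct for `a =
b`, where the sigmoid is `1 / 2`. -/
lemma Problem.sampleLaw_toReal {X A : Type*} [Fintype X] [Fintype A] {d : ℕ}
    {P : Problem X A d} (r : X → A → ℝ) (π : X → PMF A) (x : X) (a b : A) :
    (P.sampleLaw r π (x, a, b)).toReal
      = 2 * (P.D x).toReal * (π x a).toReal * (π x b).toReal * Real.sigmoid (r x a - r x b) := by
  classical
  have h := P.expect_sampleLaw r π (fun z => if z = (x, a, b) then 1 else 0)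
  have h1 : expect (P.sampleLaw r π) (fun z => if z = (x, a, b) then 1 else 0)
      = (P.sampleLaw r π (x, a, b)).toReal := by simp [expect]
  rw [← h1, h, Finset.sum_eq_single x]
  · simp only [Prod.mk.injEq, true_and, mul_add, Finset.sum_add_distrib, ite_and, mul_ite, mul_one,
      mul_zero, Finset.sum_ite_eq', Finset.mem_univ, if_true]
    rw [Finset.sum_comm]
    simp only [Finset.sum_ite_eq', Finset.mem_univ, if_true]
    ring
  · intro y _ hy
    simp [hy]
  · simp

open Classical in
lemma Problem.OfflineReaches.prob_ge {X A : Type*} [Fintype X] [Fintype A] {d : ℕ}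
    {P : Problem X A d} {p ε : ℝ} {Θs : Set (Fin d → ℝ)} {n : ℕ}
    {est : (Fin n → X × A × A) → (Fin d → ℝ)} (hp : 1 ≤ p) (hε : 0 < ε)
    (h : P.OfflineReaches p Θs ε est) {θs : Fin d → ℝ} (hθ : θs ∈ Θs) :
    3 / 4 ≤ ∑ D with lpNorm p (est D - θs) ≤ 4 * ε, (P.offlineLaw θs n D).toReal := by
  rw [Finset.sum_filter]
  rcases h with h | h
  · have h1 := h θs hθ
    have e : (3 / 4 : ℝ≥0∞) = ENNReal.ofReal (3 / 4) := by
      rw [ENNReal.ofReal_div_of_pos (by norm_num)]; norm_num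
    rw [toOuterMeasure_eq_expect, e, ENNReal.ofReal_le_ofReal_iff
      (expect_nonneg _ fun z => by positivity)] at h1
    refine h1.trans (Finset.sum_le_sum fun D _ => ?_)
    by_cases h2 : lpNorm p (est D - θs) ≤ ε
    · have h3 : lpNorm p (est D - θs) ≤ 4 * ε := by linarith
      simp [h2, h3]
    · simp only [Set.mem_ofPred_eq, h2, if_false, mul_zero]
      positivity
  -- Markov's inequality turns mean error `ε` into error `4 ε` with probability `3 / 4`, so both
  -- success criteria are handled at radius `4 ε`.
  · have h1 := h θs hθ
    have h2 : ∑ D, ((P.offlineLaw θs n D).toReal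
        - (P.offlineLaw θs n D).toReal * lpNorm p (est D - θs) / (4 * ε))
        ≤ ∑ D, if lpNorm p (est D - θs) ≤ 4 * ε then (P.offlineLaw θs n D).toReal else 0 := by
      refine Finset.sum_le_sum fun D _ => ?_
      have h0 : 0 ≤ (P.offlineLaw θs n D).toReal := ENNReal.toReal_nonneg
      split_ifs with h3
      · have := lpNorm_nonneg hp (est D - θs)
        have : 0 ≤ (P.offlineLaw θs n D).toReal * lpNorm p (est D - θs) / (4 * ε) := by
          positivity
        linarith
      · rw [sub_nonpos, le_div_iff₀ (by positivity)]
        exact mul_le_mul_of_nonneg_left (not_le.1 h3).le h0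
    rw [Finset.sum_sub_distrib, sum_toReal, ← Finset.sum_div] at h2
    have h3 : (∑ D, (P.offlineLaw θs n D).toReal * lpNorm p (est D - θs)) / (4 * ε) ≤ 1 / 4 := by
      rw [div_le_iff₀ (by positivity)]
      linarith
    linarith

/-- Two parameters of the model at distance more than `8 ε` force a sample size inversely
proportional to their chi-square divergence. -/
lemma Problem.OfflineReaches.log_two_le {X A : Type*} [Fintype X] [Fintype A] {d : ℕ}
    {P : Problem X A d} {p ε x : ℝ} {Θs : Set (Fin d → ℝ)} {n : ℕ}
    {est : (Fin n → X × A × A) → (Fin d → ℝ)} (hp : 1 ≤ p) (hε : 0 < ε)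
    (h : P.OfflineReaches p Θs ε est) {θ₀ θ₁ : Fin d → ℝ} (h₀ : θ₀ ∈ Θs) (h₁ : θ₁ ∈ Θs)
    (hdist : 8 * ε < lpNorm p (θ₀ - θ₁))
    (hx : ∑ z : X × A × A, ((P.sampleLaw (P.reward θ₀) P.π₀ z).toReal
      - (P.sampleLaw (P.reward θ₁) P.π₀ z).toReal) ^ 2
        / (P.sampleLaw (P.reward θ₁) P.π₀ z).toReal ≤ x) : Real.log 2 ≤ n * x := by
  classical
  refine log_two_le_of_test (q₀ := P.sampleLaw (P.reward θ₀) P.π₀)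
    (q₁ := P.sampleLaw (P.reward θ₁) P.π₀) ?_ hx
    (Finset.univ.filter fun D => lpNorm p (est D - θ₀) ≤ 4 * ε) ?_ ?_
  · rintro ⟨y, a, b⟩ hz
    rw [P.sampleLaw_toReal] at hz ⊢
    rw [(mul_eq_zero.1 hz).resolve_right (Real.sigmoid_pos _).ne', zero_mul]
  · convert h.prob_ge hp hε h₀
    rfl
  · have e1 := h.prob_ge hp hε h₁
    have hsum : ∑ D, (P.offlineLaw θ₁ n D).toReal = 1 := sum_toReal _
    have hdisj : Disjoint (Finset.univ.filter fun D => lpNorm p (est D - θ₀) ≤ 4 * ε)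
        (Finset.univ.filter fun D => lpNorm p (est D - θ₁) ≤ 4 * ε) := by
      rw [Finset.disjoint_filter]
      intro D _ h2 h3
      have h4 := lpNorm_add_le hp (θ₀ - est D) (est D - θ₁)
      rw [sub_add_sub_cancel, lpNorm_sub_comm hp θ₀ (est D)] at h4
      linarith
    have h5 := Finset.sum_le_sum_of_subset_of_nonneg
      (f := fun D => (P.offlineLaw θ₁ n D).toReal)
      (Finset.subset_univ ((Finset.univ.filter fun D => lpNorm p (est D - θ₀) ≤ 4 * ε) ∪
        (Finset.univ.filter fun D => lpNorm p (est D - θ₁) ≤ 4 * ε)))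
      (fun _ _ _ => ENNReal.toReal_nonneg)
    rw [Finset.sum_union hdisj, hsum] at h5
    have h6 : ∑ D with lpNorm p (est D - θ₀) ≤ 4 * ε, (P.offlineLaw θ₁ n D).toReal ≤ 1 / 4 := by
      linarith
    exact h6

/-- The two parameters differ by `s • hardDir i₀`, whose constant part cancels in margins. The label
law therefore changes only for pairs with exactly one arm equal to `i₀`, and such pairs have base
probability of order `exp (-2t)`. -/
lemma hardBandit_chiSquare_le {d : ℕ} {i₀ i₁ : Fin d} {p R γ c₂ t s : ℝ} (hp : 1 ≤ p)
    (h : i₀ ≠ i₁) (ht : 0 ≤ t) (htR : 2 ^ (1 / p) * t + 2 ≤ R) (hs : 0 ≤ s)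
    (hs1 : s ≤ 1) (hγ : 0 < γ) (hγR : γ * R ≤ c₂) :
    ∑ z : Unit × Fin d × Fin d,
      (((armedBandit d (hardBase i₀ i₁ t) γ).sampleLaw
          ((armedBandit d (hardBase i₀ i₁ t) γ).reward (hardParam i₀ i₁ t 0))
          (armedBandit d (hardBase i₀ i₁ t) γ).π₀ z).toReal
        - ((armedBandit d (hardBase i₀ i₁ t) γ).sampleLaw
          ((armedBandit d (hardBase i₀ i₁ t) γ).reward (hardParam i₀ i₁ t s))
          (armedBandit d (hardBase i₀ i₁ t) γ).π₀ z).toReal) ^ 2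
        / ((armedBandit d (hardBase i₀ i₁ t) γ).sampleLaw
          ((armedBandit d (hardBase i₀ i₁ t) γ).reward (hardParam i₀ i₁ t s))
          (armedBandit d (hardBase i₀ i₁ t) γ).π₀ z).toReal
      ≤ 4 * (γ * s) ^ 2 * Real.exp (-(2 * t)) / Real.sigmoid (-(2 * c₂)) := by
  set P := armedBandit d (hardBase i₀ i₁ t) γ with hP
  set w : Fin d → ℝ := fun a => (hardBase i₀ i₁ t a).toReal with hw
  have hw1 : ∑ a, w a = 1 := sum_toReal _
  have hw0 : ∀ a, 0 ≤ w a := fun a => ENNReal.toReal_nonneg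
  set k := (γ * s) ^ 2 / Real.sigmoid (-(2 * c₂)) with hk
  have hσ := Real.sigmoid_pos (-(2 * c₂))
  have hk0 : 0 ≤ k := by positivity
  have hreward : ∀ θ : Fin d → ℝ, ∀ a b, P.reward θ () a - P.reward θ () b = γ * (θ a - θ b) := by
    intro θ a b
    simp only [Problem.reward, hP, armedBandit_dotProduct]
    simp only [armedBandit]
    ring
  have hlaw : ∀ θ : Fin d → ℝ, ∀ a b, (P.sampleLaw (P.reward θ) P.π₀ ((), a, b)).toReal
      = 2 * w a * w b * Real.sigmoid (γ * (θ a - θ b)) := by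
    intro θ a b
    rw [P.sampleLaw_toReal, hreward, hP, armedBandit_D]
    simp only [armedBandit, hw]
    ring
  have hterm : ∀ a b, ((P.sampleLaw (P.reward (hardParam i₀ i₁ t 0)) P.π₀ ((), a, b)).toReal
      - (P.sampleLaw (P.reward (hardParam i₀ i₁ t s)) P.π₀ ((), a, b)).toReal) ^ 2
      / (P.sampleLaw (P.reward (hardParam i₀ i₁ t s)) P.π₀ ((), a, b)).toReal
      ≤ 2 * k * ((if a = i₀ then w a else 0) * w b + w a * (if b = i₀ then w b else 0)) := by
    intro a b
    rw [hlaw, hlaw]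
    set u := γ * (hardParam i₀ i₁ t 0 a - hardParam i₀ i₁ t 0 b)
    set v := γ * (hardParam i₀ i₁ t s a - hardParam i₀ i₁ t s b) with hv
    have huv : u - v = γ * s * ((if a = i₀ then 1 else 0) - (if b = i₀ then 1 else 0)) := by
      simp only [u, v, hardParam, hardDir, Pi.sub_apply, Pi.smul_apply, smul_eq_mul]
      ring
    have h1 : (Real.sigmoid u - Real.sigmoid v) ^ 2
        ≤ (γ * s) ^ 2 * ((if a = i₀ then 1 else 0) + (if b = i₀ then 1 else 0)) := by
      have e1 := sq_le_sq.2 (abs_sigmoid_sub_le u v)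
      rw [huv, mul_pow] at e1
      refine e1.trans (mul_le_mul_of_nonneg_left ?_ (sq_nonneg _))
      split_ifs <;> norm_num
    have h2 : Real.sigmoid (-(2 * c₂)) ≤ Real.sigmoid v := by
      refine Real.sigmoid_le ?_
      have e1 := lpNorm_hardParam_le hp h ht htR hs hs1
      have e2 := (abs_apply_le_lpNorm hp (hardParam i₀ i₁ t s) a).trans e1
      have e3 := (abs_apply_le_lpNorm hp (hardParam i₀ i₁ t s) b).trans e1
      have e4 := (abs_le.1 e2).1
      have e5 := (abs_le.1 e3).2
      have e6 : γ * (-(2 * R)) ≤ v := mul_le_mul_of_nonneg_left (by linarith) hγ.le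
      linarith
    have h3 : (2 * w a * w b * Real.sigmoid u - 2 * w a * w b * Real.sigmoid v) ^ 2
        / (2 * w a * w b * Real.sigmoid v)
        = 2 * w a * w b * ((Real.sigmoid u - Real.sigmoid v) ^ 2 / Real.sigmoid v) := by
      rw [← mul_sub, mul_pow]
      rcases eq_or_ne (2 * w a * w b) 0 with h0 | h0
      · simp [h0]
      · have := (Real.sigmoid_pos v).ne'
        field_simp
    rw [h3]
    have h4 : (Real.sigmoid u - Real.sigmoid v) ^ 2 / Real.sigmoid v
        ≤ k * ((if a = i₀ then 1 else 0) + (if b = i₀ then 1 else 0)) := by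
      rw [hk, div_mul_eq_mul_div]
      exact div_le_div₀ (le_trans (sq_nonneg _) h1) h1 hσ h2
    refine (mul_le_mul_of_nonneg_left h4 (by have := hw0 a; have := hw0 b; positivity)).trans
      (le_of_eq ?_)
    split_ifs <;> ring
  rw [Fintype.sum_prod_type]
  simp only [Finset.univ_unique, Finset.sum_singleton, Fintype.sum_prod_type]
  calc _ ≤ ∑ a, ∑ b, 2 * k *
        ((if a = i₀ then w a else 0) * w b + w a * (if b = i₀ then w b else 0)) :=
        Finset.sum_le_sum fun a _ => Finset.sum_le_sum fun b _ => hterm a b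
    _ = 4 * k * w i₀ := by
        simp only [← Finset.mul_sum, Finset.sum_add_distrib, hw1, mul_one, Finset.sum_ite_eq',
          Finset.mem_univ, if_true, ← Finset.sum_mul, one_mul]
        ring
    _ ≤ 4 * k * Real.exp (-(2 * t)) := by
        gcongr
        exact hardBase_le h
    _ = _ := by rw [hk]; ring

end Offline

/-! ### Separation -/

section Separation

lemma exists_pow_le_exp (a : ℝ) (k : ℕ) : ∃ R₀ : ℝ, ∀ R, R₀ ≤ R → a * R ^ k ≤ Real.exp (R / 2) := by
  have h := (Real.tendsto_exp_div_pow_atTop k).eventually_ge_atTop (a * 2 ^ k)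
  obtain ⟨x₀, hx₀⟩ := Filter.eventually_atTop.1 (h.and (Filter.eventually_gt_atTop 0))
  refine ⟨2 * x₀, fun R hR => ?_⟩
  obtain ⟨h1, h2⟩ := hx₀ (R / 2) (by linarith)
  rw [le_div_iff₀ (by positivity), div_pow, mul_assoc,
    mul_div_cancel₀ _ (by positivity)] at h1
  exact h1

lemma one_le_two_rpow {p : ℝ} (hp : 1 ≤ p) : (1 : ℝ) ≤ 2 ^ (1 - 1 / p) := by
  refine Real.one_le_rpow (by norm_num) ?_
  rw [sub_nonneg, div_le_one (by linarith)]
  exact hp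

lemma two_rpow_le_two {p : ℝ} (hp : 1 ≤ p) : (2 : ℝ) ^ (1 - 1 / p) ≤ 2 := by
  have h : 1 - 1 / p ≤ 1 := by
    have : 0 < 1 / p := by positivity
    linarith
  simpa using Real.rpow_le_rpow_of_exponent_le (by norm_num : (1 : ℝ) ≤ 2) h

/-- The height of the hard instance at radius `R`. -/
def hardHeight (p R : ℝ) : ℝ := (2 ^ (1 - 1 / p) * R - 4) / 2

lemma hardHeight_nonneg {p R : ℝ} (hp : 1 ≤ p) (hR : 4 ≤ R) : 0 ≤ hardHeight p R := by
  have := one_le_two_rpow hp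
  rw [hardHeight]
  nlinarith

/-- Since `2^(1/p) * 2^(1-1/p) = 2`, the centre has norm `R - 2 * 2^(1/p)`, leaving at least the `2`
needed by the perturbation. -/
lemma hardHeight_le {p : ℝ} (hp : 1 ≤ p) (R : ℝ) : 2 ^ (1 / p) * hardHeight p R + 2 ≤ R := by
  have h1 : (2 : ℝ) ^ (1 / p) * 2 ^ (1 - 1 / p) = 2 := by
    rw [← Real.rpow_add (by norm_num)]; norm_num
  have h2 : (1 : ℝ) ≤ 2 ^ (1 / p) := Real.one_le_rpow (by norm_num) (by positivity)
  have h3 : (2 : ℝ) ^ (1 / p) * hardHeight p R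
      = (2 ^ (1 / p) * 2 ^ (1 - 1 / p)) * R / 2 - 2 * 2 ^ (1 / p) := by
    rw [hardHeight]; ring
  rw [h3, h1]
  linarith

lemma exp_two_mul_hardHeight (p R : ℝ) :
    Real.exp (2 * hardHeight p R) = Real.exp (-4) * Real.exp (2 ^ (1 - 1 / p) * R) := by
  rw [← Real.exp_add, hardHeight]; ring_nf

variable {d : ℕ} {i₀ i₁ : Fin d} {p R γ : ℝ}

lemma hardBandit_coverage_bounds {s c : ℝ} (hp : 1 ≤ p) (hd : 2 ≤ d) (h : i₀ ≠ i₁) (hR : 4 ≤ R)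
    (hs : 0 ≤ s) (hs1 : s ≤ 1) (hc : c ≤ Real.exp (-6) / 4) :
    c * Real.exp (2 ^ (1 - 1 / p) * R) / d
      ≤ (armedBandit d (hardBase i₀ i₁ (hardHeight p R)) γ).localCoverage p
        (hardParam i₀ i₁ (hardHeight p R) s) R ∧
    (armedBandit d (hardBase i₀ i₁ (hardHeight p R)) γ).localCoverage p
        (hardParam i₀ i₁ (hardHeight p R) s) R ≤ Real.exp (2 ^ (1 - 1 / p) * R) := by
  constructor
  · refine le_trans ?_ (hardBandit_localCoverage_ge hp hd h (hardHeight_nonneg hp hR)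
      (hardHeight_le hp R) hs hs1)
    rw [exp_two_mul_hardHeight]
    calc c * Real.exp (2 ^ (1 - 1 / p) * R) / d
        ≤ Real.exp (-6) / 4 * Real.exp (2 ^ (1 - 1 / p) * R) / d := by gcongr
      _ = _ := by
        rw [show (-6 : ℝ) = -2 + -4 by norm_num, Real.exp_add]
        ring
  · exact (armedBandit_featureLipschitz hp).localCoverage_le_exp (by positivity) hp _
      (by linarith)

lemma hardBandit_covLowerBound {s c t : ℝ} (hd : 2 ≤ d) (hs : 0 ≤ s) (hs1 : s ≤ 1)
    (hc : c ≤ Real.exp (-6) / 4) :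
    (armedBandit d (hardBase i₀ i₁ t) γ).CovLowerBound (sumZero d) (hardParam i₀ i₁ t s)
      (c / d) := by
  intro v hv
  rw [Problem.dotProduct_featureCov_mulVec]
  refine le_trans ?_ (hardBandit_covForm_ge hd hs hs1 hv)
  have h1 : c ≤ Real.exp (-2) := by
    have : Real.exp (-6) ≤ Real.exp (-2) := Real.exp_le_exp.2 (by norm_num)
    linarith [Real.exp_pos (-6)]
  have h2 : 0 ≤ v ⬝ᵥ v := Finset.sum_nonneg fun i _ => mul_self_nonneg _
  gcongr

/-- Since `d` is polynomial in `R`, the lower bound of order `exp (α R) / d` for the coverage still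
beats `R² exp (α R / 2)`. -/
lemma hardBandit_coverageGrowth {s b : ℝ} {m : ℕ} (hp : 1 ≤ p) (hd : 2 ≤ d) (h : i₀ ≠ i₁)
    (hR : 4 ≤ R) (hs : 0 ≤ s) (hs1 : s ≤ 1) (hdR : (d : ℝ) ≤ b * R ^ m)
    (hbig : b * Real.exp 6 * R ^ (m + 2) ≤ Real.exp (R / 2)) :
    (armedBandit d (hardBase i₀ i₁ (hardHeight p R)) γ).CoverageGrowth p
      (hardParam i₀ i₁ (hardHeight p R) s) R 4 := by
  have hd' : (0 : ℝ) < d := by exact_mod_cast (by omega : 0 < d)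
  have hα1 := one_le_two_rpow hp
  have hv : 0 < (armedBandit d (hardBase i₀ i₁ (hardHeight p R)) γ).covForm
      ((armedBandit d (hardBase i₀ i₁ (hardHeight p R)) γ).policy
        (hardParam i₀ i₁ (hardHeight p R) s)) (hardDir i₀) := by
    refine lt_of_lt_of_le ?_ (hardBandit_covForm_ge hd hs hs1 (sum_hardDir i₀))
    have := quarter_le_hardDir_dotProduct hd i₀
    positivity
  refine (armedBandit_featureLipschitz hp).coverageGrowth (by positivity) (two_rpow_le_two hp) hp
    hv (by linarith) (by nlinarith) ?_
  have hlow := (hardBandit_coverage_bounds (γ := γ) (s := s) hp hd h hR hs hs1 le_rfl).1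
  set α : ℝ := 2 ^ (1 - 1 / p)
  set C := (armedBandit d (hardBase i₀ i₁ (hardHeight p R)) γ).localCoverage p
        (hardParam i₀ i₁ (hardHeight p R) s) R
  have h1 : d * Real.exp 6 * R ^ 2 ≤ Real.exp (α * R / 2) := by
    calc d * Real.exp 6 * R ^ 2 ≤ b * R ^ m * Real.exp 6 * R ^ 2 := by gcongr
      _ = b * Real.exp 6 * R ^ (m + 2) := by ring
      _ ≤ Real.exp (R / 2) := hbig
      _ ≤ _ := Real.exp_le_exp.2 (by nlinarith)
  have h2 : Real.exp (α * R) = Real.exp (α * R / 2) * Real.exp (α * R / 2) := by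
    rw [← Real.exp_add]; ring_nf
  have h3 : Real.exp (-6) * Real.exp 6 = 1 := by rw [← Real.exp_add]; simp
  calc R ^ 2 * Real.exp (α * R / 2)
      = Real.exp (-6) / d * (d * Real.exp 6 * R ^ 2) * Real.exp (α * R / 2) := by
        field_simp
        exact h3.symm
    _ ≤ Real.exp (-6) / d * Real.exp (α * R / 2) * Real.exp (α * R / 2) := by gcongr
    _ = 4 * (Real.exp (-6) / 4 * Real.exp (α * R) / d) := by rw [h2]; ring
    _ ≤ 4 * C := by gcongr

/-- The set of hard parameters. -/
def hardSet (i₀ i₁ : Fin d) (t : ℝ) : Set (Fin d → ℝ) := hardParam i₀ i₁ t '' Set.Icc 0 1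

lemma hardBandit_offline_lower {c₂ ε c : ℝ} (hp : 1 ≤ p) (hd : 2 ≤ d) (h : i₀ ≠ i₁) (hR : 4 ≤ R)
    (hγ : 0 < γ) (hγR : γ * R ≤ c₂) (hε : 0 < ε) (hε₀ : ε ≤ 1 / 20)
    (hc : c ≤ Real.sigmoid (-(2 * c₂)) / (3200 * c₂ ^ 2 * Real.exp 4)) {N : ℕ}
    {est : (Fin N → Unit × Fin d × Fin d) → (Fin d → ℝ)}
    (hest : (armedBandit d (hardBase i₀ i₁ (hardHeight p R)) γ).OfflineReaches p
      (hardSet i₀ i₁ (hardHeight p R)) ε est) :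
    c * (Real.exp (2 ^ (1 - 1 / p) * R) / ε ^ 2) ≤ N := by
  have hγc : γ ≤ c₂ := (le_mul_of_one_le_right hγ.le (by linarith)).trans hγR
  have hc₂ : 0 < c₂ := hγ.trans_le hγc
  have hs1 : 20 * ε ≤ 1 := by linarith
  have hs0 : 0 ≤ 20 * ε := by positivity
  -- The two test points are `s = 0` and `s = 20 ε`: as `hardDir` has norm at least `1 / 2`, they
  -- are at least `10 ε` apart.
  have hdist : 8 * ε < lpNorm p (hardParam i₀ i₁ (hardHeight p R) 0
      - hardParam i₀ i₁ (hardHeight p R) (20 * ε)) := by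
    have e : hardParam i₀ i₁ (hardHeight p R) 0 - hardParam i₀ i₁ (hardHeight p R) (20 * ε)
        = (20 * ε) • hardDir i₀ := by
      simp only [hardParam]; module
    rw [e, lpNorm_smul hp, abs_of_nonneg hs0]
    have := half_le_lpNorm_hardDir hp hd i₀
    nlinarith
  have hx := hardBandit_chiSquare_le hp h (hardHeight_nonneg hp hR) (hardHeight_le hp R) hs0 hs1
    hγ hγR
  have h1 := hest.log_two_le hp hε ⟨0, ⟨le_rfl, zero_le_one⟩, rfl⟩ ⟨20 * ε, ⟨hs0, hs1⟩, rfl⟩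
    hdist hx
  set E := Real.exp (2 ^ (1 - 1 / p) * R) with hE
  have hE0 : 0 < E := Real.exp_pos _
  have hexp : Real.exp (-(2 * hardHeight p R)) = Real.exp 4 / E := by
    rw [Real.exp_neg, exp_two_mul_hardHeight, ← hE, Real.exp_neg]
    field_simp
  have hσ := Real.sigmoid_pos (-(2 * c₂))
  have hlog2 := Real.log_two_gt_d9
  have h2 : (1 : ℝ) / 2 ≤ N * (4 * (c₂ * (20 * ε)) ^ 2 * (Real.exp 4 / E)
      / Real.sigmoid (-(2 * c₂))) := by
    rw [hexp] at h1
    refine le_trans (by linarith) (h1.trans ?_)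
    gcongr
  have h3 : (N : ℝ) * (4 * (c₂ * (20 * ε)) ^ 2 * (Real.exp 4 / E) / Real.sigmoid (-(2 * c₂)))
      = N * (ε ^ 2 / E) / 2
        * (Real.sigmoid (-(2 * c₂)) / (3200 * c₂ ^ 2 * Real.exp 4))⁻¹ := by
    field_simp
    ring
  have hK : 0 < Real.sigmoid (-(2 * c₂)) / (3200 * c₂ ^ 2 * Real.exp 4) := by positivity
  rw [h3, ← div_eq_mul_inv, le_div_iff₀ hK] at h2
  have h4 : c ≤ N * (ε ^ 2 / E) := by linarith
  calc c * (E / ε ^ 2) ≤ (N : ℝ) * (ε ^ 2 / E) * (E / ε ^ 2) := by gcongr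
    _ = (N : ℝ) := by field_simp

/-! ### Comparison of on-policy and offline sample sizes. -/

lemma log_size_le {a R x ε δ N : ℝ} {k : ℕ} (ha : 0 < a) (hR : 2 ≤ R) (hx : x ≤ 2 * R)
    (hε : 0 < ε) (hε1 : ε ≤ 1) (hδ : 0 < δ) (hδ1 : δ < 1) (hN : 0 < N)
    (hNle : N ≤ a * R ^ k * (Real.exp x / ε ^ 2)) :
    Real.log (N / δ) ≤ (2 * |Real.log a| + k + 6) * (R * Real.log (R / (ε * δ))) := by
  have hR0 : 0 < R := by linarith
  have hlogε : Real.log ε ≤ 0 := Real.log_nonpos hε.le hε1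
  have hlogδ : Real.log δ ≤ 0 := Real.log_nonpos hδ.le hδ1.le
  have hlogR : 1 / 2 ≤ Real.log R := by
    have := Real.log_le_log (by norm_num) hR
    linarith [Real.log_two_gt_d9]
  have hΛ : Real.log (R / (ε * δ)) = Real.log R - Real.log ε - Real.log δ := by
    rw [Real.log_div hR0.ne' (by positivity), Real.log_mul hε.ne' hδ.ne']; ring
  have h1 : Real.log (N / δ) ≤ Real.log a + k * Real.log R + x - 2 * Real.log ε - Real.log δ := by
    rw [Real.log_div hN.ne' hδ.ne']
    have h2 := Real.log_le_log hN hNle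
    rw [Real.log_mul (by positivity) (by positivity), Real.log_mul ha.ne' (by positivity),
      Real.log_div (Real.exp_pos x).ne' (by positivity), Real.log_exp, Real.log_pow,
      Real.log_pow] at h2
    push_cast at h2
    linarith
  rw [hΛ]
  set Λ := Real.log R - Real.log ε - Real.log δ with hΛdef
  have hΛ2 : 1 / 2 ≤ Λ := by linarith
  have hRΛ : Λ ≤ R * Λ := le_mul_of_one_le_left (by linarith) (by linarith)
  have h3 : |Real.log a| ≤ 2 * |Real.log a| * (R * Λ) := by
    have : 1 ≤ 2 * (R * Λ) := by linarith
    nlinarith [abs_nonneg (Real.log a)]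
  have h4 : (k : ℝ) * Real.log R ≤ k * (R * Λ) := by gcongr; linarith
  have h5 : x ≤ 4 * (R * Λ) := by nlinarith
  have h6 := le_abs_self (Real.log a)
  linarith

/-- Factoring `E / ε²`, the order of the offline sample size, out of `max (1 / ε²) E` leaves the
separation factor `max E⁻¹ (ε²)`. The remaining `d^(2/p) * d ≤ d³` is polynomial in `R`. -/
lemma hard_size_le {b c E ε : ℝ} {m : ℕ} (hp : 1 ≤ p) (hd : 2 ≤ d) (hR : 1 ≤ R)
    (hdR : (d : ℝ) ≤ b * R ^ m) (hc : 0 < c) (hE : 0 < E) (hε : 0 < ε) :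
    (d : ℝ) ^ (2 / p) / (c / d) * max (R ^ 2 / ε ^ 2) E
      ≤ b ^ 3 / c * R ^ (3 * m + 2) * (E / ε ^ 2 * max E⁻¹ (ε ^ 2)) := by
  have hd0 : (0 : ℝ) < d := by exact_mod_cast (by omega : 0 < d)
  have hd1 : (1 : ℝ) ≤ d := by exact_mod_cast (by omega : 1 ≤ d)
  have hR2 : (1 : ℝ) ≤ R ^ 2 := one_le_pow₀ hR
  have h1 : (d : ℝ) ^ (2 / p) ≤ (d : ℝ) ^ 2 := by
    rw [← Real.rpow_two]
    refine Real.rpow_le_rpow_of_exponent_le hd1 ?_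
    rw [div_le_iff₀ (by linarith)]
    linarith
  have h2 : max (R ^ 2 / ε ^ 2) E ≤ R ^ 2 * (E / ε ^ 2 * max E⁻¹ (ε ^ 2)) := by
    refine max_le ?_ ?_
    · calc R ^ 2 / ε ^ 2 = R ^ 2 * (E / ε ^ 2 * E⁻¹) := by field_simp
        _ ≤ _ := by gcongr; exact le_max_left _ _
    · calc E = 1 * (E / ε ^ 2 * ε ^ 2) := by field_simp
        _ ≤ _ := by gcongr; exact le_max_right _ _
  calc (d : ℝ) ^ (2 / p) / (c / d) * max (R ^ 2 / ε ^ 2) E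
      = (d : ℝ) ^ (2 / p) * d / c * max (R ^ 2 / ε ^ 2) E := by field_simp
    _ ≤ (d : ℝ) ^ 2 * d / c * (R ^ 2 * (E / ε ^ 2 * max E⁻¹ (ε ^ 2))) := by gcongr
    _ = (d : ℝ) ^ 3 / c * (R ^ 2 * (E / ε ^ 2 * max E⁻¹ (ε ^ 2))) := by ring
    _ ≤ (b * R ^ m) ^ 3 / c * (R ^ 2 * (E / ε ^ 2 * max E⁻¹ (ε ^ 2))) := by gcongr
    _ = _ := by ring

/-- The size `N₁` is replaced by the offline size via `hoff`. One logarithm comes from the number of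
rounds, the other together with a factor `R` from `log (N₁ / δ)`, since `N₁` may be exponential in
`R`. -/
lemma separation_arith {b c B₀ B₁ R x E ε δ N₁ n K N : ℝ} {k : ℕ} (hR : 2 ≤ R) (hx0 : 0 ≤ x)
    (hx : x ≤ 2 * R) (hE : E = Real.exp x) (hc : 0 < c) (hb : 0 < b) (hB₀ : 0 < B₀)
    (hB₁ : 0 < B₁) (hε : 0 < ε) (hε1 : ε ≤ 1) (hδ : 0 < δ) (hδ1 : δ < 1) (hN₁ : 4 ≤ N₁)
    (hN₁le : N₁ ≤ b ^ 3 / c * R ^ k * (E / ε ^ 2 * max E⁻¹ (ε ^ 2)))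
    (hoff : c * (E / ε ^ 2) ≤ N) (hn0 : 0 ≤ n) (hn : n ≤ B₁ * N₁ * Real.log (N₁ / δ))
    (hK : K ≤ (B₀ + 2) * Real.log (R / ε)) :
    n * K ≤ B₁ * (B₀ + 2) * (b ^ 3 / c ^ 2) * (2 * |Real.log (b ^ 3 / c)| + (k : ℝ) + 6)
      * R ^ (k + 1) * Real.log (R / (ε * δ)) ^ 2 * max E⁻¹ (ε ^ 2) * N := by
  have hR0 : 0 < R := by linarith
  have hN₁0 : 0 < N₁ := by linarith
  have hE0 : 0 < E := hE ▸ Real.exp_pos _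
  have hE1 : 1 ≤ E := hE ▸ Real.one_le_exp hx0
  have hmax1 : max E⁻¹ (ε ^ 2) ≤ 1 :=
    max_le (inv_le_one_of_one_le₀ hE1) (pow_le_one₀ hε.le hε1)
  have hmax0 : 0 < max E⁻¹ (ε ^ 2) := lt_max_of_lt_left (by positivity)
  have hlogN := log_size_le (a := b ^ 3 / c) (N := N₁) (k := k) (by positivity) hR hx hε hε1
    hδ hδ1 hN₁0 (by
      rw [← hE]
      exact hN₁le.trans (mul_le_mul_of_nonneg_left
        (mul_le_of_le_one_right (by positivity) hmax1) (by positivity)))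
  have hL0 : 0 ≤ Real.log (R / ε) := by
    have := log_two_le_log_div hR hε hε1
    linarith [Real.log_two_gt_d9]
  have hLΛ : Real.log (R / ε) ≤ Real.log (R / (ε * δ)) := by
    refine Real.log_le_log (by positivity) ?_
    gcongr
    exact mul_le_of_le_one_right hε.le hδ1.le
  have hℓ : 0 ≤ Real.log (N₁ / δ) := Real.log_nonneg (by rw [le_div_iff₀ hδ]; linarith)
  have hN₁N : N₁ ≤ b ^ 3 / c ^ 2 * R ^ k * max E⁻¹ (ε ^ 2) * N := by
    calc N₁ ≤ b ^ 3 / c * R ^ k * (E / ε ^ 2 * max E⁻¹ (ε ^ 2)) := hN₁le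
      _ = b ^ 3 / c ^ 2 * R ^ k * max E⁻¹ (ε ^ 2) * (c * (E / ε ^ 2)) := by
        field_simp
      _ ≤ _ := by gcongr
  generalize Real.log (R / (ε * δ)) = Λ at *
  generalize Real.log (R / ε) = L at *
  generalize max E⁻¹ (ε ^ 2) = μ at *
  generalize Real.log (N₁ / δ) = ℓ at *
  have hk₂ : 0 < 2 * |Real.log (b ^ 3 / c)| + (k : ℝ) + 6 := by positivity
  generalize 2 * |Real.log (b ^ 3 / c)| + (k : ℝ) + 6 = k₂ at *
  have hN₁' : 0 ≤ b ^ 3 / c ^ 2 * R ^ k * μ * N := hN₁0.le.trans hN₁N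
  have e : B₁ * (B₀ + 2) * (b ^ 3 / c ^ 2) * k₂ * R ^ (k + 1) * Λ ^ 2 * μ * N
      = B₁ * (b ^ 3 / c ^ 2 * R ^ k * μ * N) * (k₂ * (R * Λ)) * ((B₀ + 2) * Λ) := by ring
  rw [e]
  generalize b ^ 3 / c ^ 2 * R ^ k * μ * N = G at *
  have hΛ : 0 ≤ Λ := hL0.trans hLΛ
  calc n * K ≤ B₁ * N₁ * ℓ * ((B₀ + 2) * L) :=
        (mul_le_mul_of_nonneg_left hK hn0).trans (mul_le_mul_of_nonneg_right hn (by positivity))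
    _ ≤ B₁ * G * (k₂ * (R * Λ)) * ((B₀ + 2) * Λ) := by gcongr

lemma threshold_mono {B N N' K δ : ℝ} (hB : 0 ≤ B) (hN : 1 ≤ N) (h : N ≤ N') (hK : 1 ≤ K)
    (hδ : 0 < δ) (hδ1 : δ < 1) :
    B * N * Real.log (K / δ * N) ≤ B * N' * Real.log (K / δ * N') := by
  have hKδ : 1 ≤ K / δ := by rw [le_div_iff₀ hδ]; linarith
  have hlog : 0 ≤ Real.log (K / δ * N) := Real.log_nonneg (by nlinarith)
  have hN' : 0 ≤ N' := by linarith
  have hBN : 0 ≤ B * N' := mul_nonneg hB hN'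
  gcongr

theorem offline_separation {p : ℝ} (hp : 1 ≤ p) (hp₂ : p ≤ 2) {c₁ c₂ : ℝ} (hc₁ : 0 < c₁)
    (hc₂ : c₁ ≤ c₂) (b : ℝ) (m : ℕ) (hb : 0 < b) :
      ∃ (c ε₀ κ R₀ B : ℝ) (M : ℕ), 0 < c ∧ 0 < ε₀ ∧ 1 ≤ κ ∧ 2 ≤ R₀ ∧ 0 < B ∧
      ∀ R : ℝ, R₀ ≤ R → ∀ d : ℕ, 2 ≤ d → (d : ℝ) ≤ b * R ^ m →
      ∀ γ : ℝ, c₁ / R ≤ γ → γ ≤ c₂ / R →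
      ∃ (π₀ : PMF (Fin d)) (Θs : Set (Fin d → ℝ)),
        Θs.Nonempty ∧ Θs ⊆ paramSet p R (sumZero d) ∧
        (∀ θs ∈ Θs,
          (armedBandit d π₀ γ).CovLowerBound (sumZero d) θs (c / d) ∧
          (armedBandit d π₀ γ).CoverageGrowth p θs R κ ∧
          c * Real.exp (2 ^ (1 - 1 / p) * R) / d
            ≤ (armedBandit d π₀ γ).localCoverage p θs R) ∧
        (∀ ε : ℝ, 0 < ε → ε ≤ ε₀ →
          (∀ (N : ℕ) (est : (Fin N → Unit × Fin d × Fin d) → (Fin d → ℝ)),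
            (armedBandit d π₀ γ).OfflineReaches p Θs ε est →
            ∀ θs ∈ Θs,
              c * ((armedBandit d π₀ γ).localCoverage p θs R / ε ^ 2) ≤ (N : ℝ)) ∧
          (∀ δ : ℝ, 0 < δ → δ < 1 → ∃ n K : ℕ,
            (∀ θs ∈ Θs, (armedBandit d π₀ γ).OnPolicySucceeds p R (sumZero d)
              ((armedBandit d π₀ γ).reward θs) θs ε δ n K) ∧
            ∀ (N : ℕ) (est : (Fin N → Unit × Fin d × Fin d) → (Fin d → ℝ)),
              (armedBandit d π₀ γ).OfflineReaches p Θs ε est →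
              (n : ℝ) * K ≤ B * R ^ M * Real.log (R / (ε * δ)) ^ 2
                * max (Real.exp (-(2 ^ (1 - 1 / p) * R))) (ε ^ 2) * N)) := by
  have hc₂0 : 0 < c₂ := hc₁.trans_le hc₂
  obtain ⟨B₀, hB₀, H⟩ := exists_onPolicy_const hp hp₂ hc₁ hc₂ (show (1 : ℝ) ≤ 4 by norm_num)
  obtain ⟨R₁, hR₁⟩ := exists_pow_le_exp (b * Real.exp 6) (m + 2)
  have hσ := Real.sigmoid_pos (-(2 * c₂))
  obtain ⟨c, hc0, hcL, hcN⟩ : ∃ c : ℝ, 0 < c ∧ c ≤ Real.exp (-6) / 4 ∧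
      c ≤ Real.sigmoid (-(2 * c₂)) / (3200 * c₂ ^ 2 * Real.exp 4) :=
    ⟨min (Real.exp (-6) / 4) (Real.sigmoid (-(2 * c₂)) / (3200 * c₂ ^ 2 * Real.exp 4)),
      lt_min (by positivity) (by positivity), min_le_left _ _, min_le_right _ _⟩
  have hlogB : 0 ≤ Real.log (B₀ + 2) := Real.log_nonneg (by linarith)
  obtain ⟨B₁, hB₁⟩ : ∃ B₁, B₁ = B₀ * (2 + Real.log (B₀ + 2)) + 1 := ⟨_, rfl⟩
  have hB₁0 : 0 < B₁ := by rw [hB₁]; positivity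
  obtain ⟨k₂, hk₂⟩ : ∃ k₂, k₂ = 2 * |Real.log (b ^ 3 / c)| + ((3 * m + 2 : ℕ) : ℝ) + 6 := ⟨_, rfl⟩
  have hk₂0 : 0 < k₂ := by rw [hk₂]; positivity
  -- `ε₀ = 1 / 20` keeps the test parameter `20 ε` in `[0, 1]`. The exponent `3 m + 3` collects
  -- `R^(3m)` from `d³`, `R²` from the sample size and one `R` from its logarithm.
  refine ⟨c, 1 / 20, 4, max 4 R₁, B₁ * (B₀ + 2) * (b ^ 3 / c ^ 2) * k₂, 3 * m + 3, hc0,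
    by norm_num, by norm_num, le_max_of_le_left (by norm_num), by positivity, ?_⟩
  intro R hR d hd hdR γ hγ₁ hγ₂
  have hR4 : 4 ≤ R := (le_max_left _ _).trans hR
  have hR0 : 0 < R := by linarith
  have hbig := hR₁ R ((le_max_right _ _).trans hR)
  have hγ : 0 < γ := lt_of_lt_of_le (by positivity) hγ₁
  have hγR : γ * R ≤ c₂ := (le_div_iff₀ hR0).1 hγ₂
  obtain ⟨i₀, i₁, hi⟩ : ∃ i₀ i₁ : Fin d, i₀ ≠ i₁ :=
    ⟨⟨0, by omega⟩, ⟨1, by omega⟩, by simp⟩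
  have hd0 : 0 < d := by omega
  have hd1 : (1 : ℝ) ≤ d := by exact_mod_cast hd0
  have hsub : hardSet i₀ i₁ (hardHeight p R) ⊆ paramSet p R (sumZero d) := by
    rintro _ ⟨s, hs, rfl⟩
    exact ⟨hardParam_mem_sumZero, lpNorm_hardParam_le hp hi (hardHeight_nonneg hp hR4)
      (hardHeight_le hp R) hs.1 hs.2⟩
  refine ⟨hardBase i₀ i₁ (hardHeight p R), hardSet i₀ i₁ (hardHeight p R),
    ⟨_, 0, ⟨le_rfl, zero_le_one⟩, rfl⟩, hsub, ?_, ?_⟩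
  · rintro _ ⟨s, hs, rfl⟩
    exact ⟨hardBandit_covLowerBound hd hs.1 hs.2 hcL,
      hardBandit_coverageGrowth hp hd hi hR4 hs.1 hs.2 hdR hbig,
      (hardBandit_coverage_bounds hp hd hi hR4 hs.1 hs.2 hcL).1⟩
  intro ε hε hε₀
  have hε1 : ε ≤ 1 := by linarith
  constructor
  · rintro N est hest _ ⟨s, hs, rfl⟩
    refine le_trans ?_ (hardBandit_offline_lower hp hd hi hR4 hγ hγR hε hε₀ hcN hest)
    have := (hardBandit_coverage_bounds (γ := γ) hp hd hi hR4 hs.1 hs.2 hcL).2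
    gcongr
  intro δ hδ hδ1
  have hcd : c / d ≤ 1 := by
    rw [div_le_one (by linarith)]
    have : Real.exp (-6) ≤ 1 := Real.exp_le_one_iff.2 (by norm_num)
    linarith
  have hcd0 : 0 < c / d := by positivity
  obtain ⟨E, hE⟩ : ∃ E, E = Real.exp (2 ^ (1 - 1 / p) * R) := ⟨_, rfl⟩
  have hE0 : 0 < E := hE ▸ Real.exp_pos _
  -- The coverage is replaced by its upper bound `E`, so that one choice of `n` and `K` serves every
  -- parameter in the class; `threshold_mono` justifies this.
  obtain ⟨N₁, hN₁⟩ : ∃ N₁, N₁ = (d : ℝ) ^ (2 / p) / (c / d) * max (R ^ 2 / ε ^ 2) E := ⟨_, rfl⟩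
  have hL := log_two_le_log_div (show 2 ≤ R by linarith) hε hε1
  have hRε : 2 ≤ R / ε := by rw [le_div_iff₀ hε]; linarith
  have hsize : ∀ C, (R / ε) ^ 2 ≤ (d : ℝ) ^ (2 / p) / (c / d) * max (R ^ 2 / ε ^ 2) C := by
    intro C
    rw [div_pow]
    exact (le_mul_of_one_le_left (by positivity) hd1).trans
      (effective_size_ge hp hp₂ hd0 hcd0 hcd hε)
  have hRε4 : 4 ≤ (R / ε) ^ 2 := by nlinarith
  have hN₁4 : 4 ≤ N₁ := by rw [hN₁]; exact hRε4.trans (hsize E)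
  have hN₁0 : 0 < N₁ := by linarith
  have hLN : Real.log (R / ε) ≤ N₁ := by
    have h1 := Real.log_le_sub_one_of_pos (show 0 < R / ε by linarith)
    have h2 := hsize E
    rw [← hN₁] at h2
    nlinarith
  have hL0 : 0 < Real.log (R / ε) := (Real.log_pos (by norm_num)).trans_le hL
  obtain ⟨hK₁, hK₂, hn⟩ := exists_sample_sizes hB₀ hL hLN hN₁4 hδ hδ1
  rw [← hB₁] at hn
  have hK0 : (1 : ℝ) ≤ ⌈B₀ * Real.log (R / ε)⌉₊ := by
    have : 0 < ⌈B₀ * Real.log (R / ε)⌉₊ := Nat.ceil_pos.2 (by positivity)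
    exact_mod_cast this
  obtain ⟨K, hK⟩ : ∃ K, K = ⌈B₀ * Real.log (R / ε)⌉₊ := ⟨_, rfl⟩
  obtain ⟨n, hn'⟩ : ∃ n, n = ⌈B₀ * N₁ * Real.log (K / δ * N₁)⌉₊ := ⟨_, rfl⟩
  rw [← hK] at hK₁ hK₂ hn hK0
  rw [← hn'] at hn
  refine ⟨n, K, ?_, ?_⟩
  · intro θs hθs
    obtain ⟨s, hs, rfl⟩ := hθs
    refine H _ _ d _ (sumZero d) _ _ R (c / d) (sumZero_ne_bot hd) (by linarith) hγ₁ hγ₂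
      (hsub ⟨s, hs, rfl⟩) (armedBandit_target hγ.ne' _) hcd0
      (hardBandit_covLowerBound hd hs.1 hs.2 hcL)
      (hardBandit_coverageGrowth hp hd hi hR4 hs.1 hs.2 hdR hbig) ε δ hε hε1 hδ hδ1 n K hK₁ ?_
    have hCE := (hardBandit_coverage_bounds (γ := γ) hp hd hi hR4 hs.1 hs.2 hcL).2
    rw [← hE] at hCE
    have hNs := hsize ((armedBandit d (hardBase i₀ i₁ (hardHeight p R)) γ).localCoverage p
        (hardParam i₀ i₁ (hardHeight p R) s) R)
    have hle : (d : ℝ) ^ (2 / p) / (c / d) * max (R ^ 2 / ε ^ 2)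
        ((armedBandit d (hardBase i₀ i₁ (hardHeight p R)) γ).localCoverage p
          (hardParam i₀ i₁ (hardHeight p R) s) R) ≤ N₁ := by
      rw [hN₁]; gcongr
    have hle' : B₀ * N₁ * Real.log (K / δ * N₁) ≤ n := by rw [hn']; exact Nat.le_ceil _
    exact (threshold_mono hB₀.le (by linarith) hle hK0 hδ hδ1).trans hle'
  · intro N est hest
    have hoff := hardBandit_offline_lower hp hd hi hR4 hγ hγR hε hε₀ hcN hest
    rw [← hE] at hoff
    have hEinv : Real.exp (-(2 ^ (1 - 1 / p) * R)) = E⁻¹ := by rw [Real.exp_neg, hE]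
    rw [hEinv, hk₂]
    exact separation_arith (x := 2 ^ (1 - 1 / p) * R) (k := 3 * m + 2) (by linarith)
      (mul_nonneg (by positivity) hR0.le)
      (mul_le_mul_of_nonneg_right (two_rpow_le_two hp) hR0.le) hE hc0 hb hB₀ hB₁0 hε hε1 hδ hδ1
      hN₁4 (hN₁ ▸ hard_size_le hp hd (by linarith) hdR hc0 hE0 hε) hoff
      (Nat.cast_nonneg n) hn hK₂

end Separation

end PrefLearn

end

open PrefLearn in
theorem mainTheorem3 (p : ℝ) (hp₁ : 1 ≤ p) (hp₂ : p ≤ 2)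
    (c₁ c₂ : ℝ) (hc₁ : 0 < c₁) (hc₂ : c₁ ≤ c₂) :
    -- offline lower bound and separation on a family of hard bandit instances
    (∀ (b : ℝ) (m : ℕ), 0 < b →
      ∃ (c ε₀ κ R₀ B : ℝ) (M : ℕ), 0 < c ∧ 0 < ε₀ ∧ 1 ≤ κ ∧ 2 ≤ R₀ ∧ 0 < B ∧
      ∀ R : ℝ, R₀ ≤ R → ∀ d : ℕ, 2 ≤ d → (d : ℝ) ≤ b * R ^ m →
      ∀ γ : ℝ, c₁ / R ≤ γ → γ ≤ c₂ / R →
      ∃ (π₀ : PMF (Fin d)) (Θs : Set (Fin d → ℝ)),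
        Θs.Nonempty ∧ Θs ⊆ paramSet p R (sumZero d) ∧
        (∀ θs ∈ Θs,
          (armedBandit d π₀ γ).CovLowerBound (sumZero d) θs (c / d) ∧
          (armedBandit d π₀ γ).CoverageGrowth p θs R κ ∧
          c * Real.exp (2 ^ (1 - 1 / p) * R) / d
            ≤ (armedBandit d π₀ γ).localCoverage p θs R) ∧
        (∀ ε : ℝ, 0 < ε → ε ≤ ε₀ →
          (∀ (N : ℕ) (est : (Fin N → Unit × Fin d × Fin d) → (Fin d → ℝ)),
            (armedBandit d π₀ γ).OfflineReaches p Θs ε est →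
            ∀ θs ∈ Θs,
              c * ((armedBandit d π₀ γ).localCoverage p θs R / ε ^ 2) ≤ (N : ℝ)) ∧
          (∀ δ : ℝ, 0 < δ → δ < 1 → ∃ n K : ℕ,
            (∀ θs ∈ Θs, (armedBandit d π₀ γ).OnPolicySucceeds p R (sumZero d)
              ((armedBandit d π₀ γ).reward θs) θs ε δ n K) ∧
            ∀ (N : ℕ) (est : (Fin N → Unit × Fin d × Fin d) → (Fin d → ℝ)),
              (armedBandit d π₀ γ).OfflineReaches p Θs ε est →
              (n : ℝ) * K ≤ B * R ^ M * Real.log (R / (ε * δ)) ^ 2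
                * max (Real.exp (-(2 ^ (1 - 1 / p) * R))) (ε ^ 2) * N))) ∧
    -- on-policy upper bound
    (∀ κ : ℝ, 1 ≤ κ → ∃ B : ℝ, 0 < B ∧
      ∀ (X : Type*) (A : Type*) [Fintype X] [Fintype A] (d : ℕ) (P : Problem X A d)
        (S : Submodule ℝ (Fin d → ℝ)) (r : X → A → ℝ) (θs : Fin d → ℝ) (R lam : ℝ),
      S ≠ ⊥ → 2 ≤ R → c₁ / R ≤ P.γ → P.γ ≤ c₂ / R →
      θs ∈ paramSet p R S → P.target r = P.policy θs →
      0 < lam → P.CovLowerBound S θs lam → P.CoverageGrowth p θs R κ →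
      ∀ ε δ : ℝ, 0 < ε → ε ≤ 1 → 0 < δ → δ < 1 →
        (∀ n K : ℕ,
          B * Real.log (R / ε) ≤ K →
          B * ((d : ℝ) ^ (2 / p) / lam * max (R ^ 2 / ε ^ 2) (P.localCoverage p θs R))
            * Real.log (K / δ * ((d : ℝ) ^ (2 / p) / lam
                * max (R ^ 2 / ε ^ 2) (P.localCoverage p θs R))) ≤ n →
          P.OnPolicySucceeds p R S r θs ε δ n K) ∧
        (∃ n K : ℕ,
          P.OnPolicySucceeds p R S r θs ε δ n K ∧
          (K : ℝ) ≤ B * Real.log (R / ε) ∧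
          (n : ℝ) ≤ B * ((d : ℝ) ^ (2 / p) / lam
              * max (R ^ 2 / ε ^ 2) (P.localCoverage p θs R))
            * Real.log ((d : ℝ) ^ (2 / p) / lam
              * max (R ^ 2 / ε ^ 2) (P.localCoverage p θs R) / δ) ∧
          (n : ℝ) * K ≤ B * ((d : ℝ) ^ (2 / p) / lam
              * max (R ^ 2 / ε ^ 2 * Real.log (R / ε))
                  (Real.log (R / ε) * P.localCoverage p θs R))
            * Real.log ((d : ℝ) ^ (2 / p) / lam
              * max (R ^ 2 / ε ^ 2) (P.localCoverage p θs R) / δ))) := by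
  exact ⟨fun b m hb => offline_separation hp₁ hp₂ hc₁ hc₂ b m hb,
    fun κ hκ => onPolicy_upper_bound hp₁ hp₂ hc₁ hc₂ κ hκ⟩
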